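/- **Theorem (Plane Wave Asymptotics).** Let $\mathbf E$ be a finite-dimensional real Euclidean space and $\mathbf R\subset\mathbf E$ an irreducible crystallographic root system (possibly nonreduced) spanning $\mathbf E$, with positive roots $\mathbf R^+$, coroots $\alpha^\vee=2\alpha/\langle\alpha,\alpha\rangle$ and Weyl group $W\subset\mathrm{GL}(\mathbf E)$. Write $\xi_w=w(\xi)$, $(-1)^w=\det w$, and $$\mathcal P^+=\{\lambda\in\mathbf E:\langle\lambda,\alpha^\vee\rangle\in\mathbb Z_{\ge0}\ \forall\alpha\in\mathbf R^+\},\qquad m(\lambda)=\min_{\alpha\in\mathbf R^+}\langle\lambda,\alpha^\vee\rangle ,$$ $$\mathbf A=\{\xi\in\mathbf E: 0<\langle\xi,\alpha\rangle<2\pi\ \forall\alpha\in\mathbf R^+\},\qquad m_\mu(\xi)=\frac1{|W_\mu|}\sum_{w\in W}e^{i\langle\mu,\xi_w\rangle},$$ where $W_\mu$ is the stabilizer of $\mu$. Let $\mathbf R_0^+$ (resp. $\mathbf R_1^+$) be the set of those $\alpha\in\mathbf R^+$ with $2\alpha\notin\mathbf R$ (resp. $\alpha/2\notin\mathbf R$),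 and put $\rho=\frac12\sum_{\alpha\in\mathbf R_0^+}\alpha$ and $\delta(\xi)=\prod_{\alpha\in\mathbf R_0^+}(e^{i\langle\alpha,\xi\rangle/2}-e^{-i\langle\alpha,\xi\rangle/2})$. For the roots $\alpha\in\mathbf R_1^+$ let $\hat c_{|\alpha|}$ be functions, depending only on the length of $\alpha$, that are analytic and zero-free on the closed disc $|z|\le\varrho$ of radius $\varrho>1$, real-valued for real $z$, and normalized by $\hat c_{|\alpha|}(0)=1$. Put $$\hat{\mathcal C}(\xi)=\prod_{\alpha\in\mathbf R_1^+}\hat c_{|\alpha|}(e^{-i\langle\alpha,\xi\rangle}),\qquad \hat\Delta(\xi)=\frac1{\hat{\mathcal C}(\xi)\hat{\mathcal C}(-\xi)}>0,\qquad \hat S_w(\xi)=\frac{\hat{\mathcal C}(\xi_w)}{\hat{\mathcal C}(-\xi_w)},$$ and let $$(f,g)=\frac1{|W|\,\mathrm{Vol}(\mathbf A)}\int_{\mathbf A}f\,\overline g\,d\xi,\qquad (f,g)_{\hat\Delta}=\frac1{|W|\,\mathrm{Vol}(\mathbf A)}\int_{\mathbf A}f\,\overline g\,\hat\Delta\,|\delta|^2\,d\xi,\qquad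 \|f\|=(f,f)^{1/2}.$$ Let $\preceq$ be a partial order on $\mathcal P^+$ with all sets $\{\mu:\mu\preceq\lambda\}$ finite that refines the dominance order ($\mu\le\lambda$ if and only if $\lambda-\mu$ is a sum of positive roots). Then there is a unique family of functions $P_\lambda=\sum_{\mu\preceq\lambda}a_{\lambda\mu}m_\mu$ ($\lambda\in\mathcal P^+$), $a_{\lambda\mu}\in\mathbb C$, with $a_{\lambda\lambda}>0$, $(P_\lambda,P_\mu)_{\hat\Delta}=0$ for $\mu\prec\lambda$, and $(P_\lambda,P_\lambda)_{\hat\Delta}=1$ (the Gram–Schmidt polynomials). Define $$\Psi_\lambda=\hat\Delta^{1/2}\,\delta\,P_\lambda,\qquad \Psi^\infty_\lambda(\xi)=\sum_{w\in W}(-1)^w\,\hat S_w^{1/2}(\xi)\,e^{i\langle\rho+\lambda,\xi_w\rangle},$$ where $\hat\Delta^{1/2}>0$ and $\hat S_w^{1/2}(\xi)=\hat{\mathcal C}(\xi_w)/|\hat{\mathcal C}(\xi_w)|$, which is the continuous square root of $\hat S_w$ on $\mathbf E$ with $\hat S_w^{1/2}(0)=1$. On $\mathbf A$ one has $\Psi_\lambda^\infty=\hat\Delta^{1/2}\delta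 P_\lambda^\infty$ with $P_\lambda^\infty(\xi)=\delta(\xi)^{-1}\sum_{w\in W}(-1)^w\hat{\mathcal C}(\xi_w)e^{i\langle\rho+\lambda,\xi_w\rangle}$. Both $\Psi_\lambda$ and $\Psi_\lambda^\infty$ lie in $L^2(\mathbf A)$, and $$\|\Psi_\lambda-\Psi^\infty_\lambda\|=O\bigl(e^{-\epsilon\,m(\lambda)}\bigr)\qquad\text{as } m(\lambda)\to\infty,$$ for a decay rate $\epsilon>0$ that depends only on $\varrho$. -/

import Mathlib

open MeasureTheory Filter Asymptotics

noncomputable section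

namespace WeylAlcove

/-! ### Root systems in a Euclidean space -/

/-- The root pairing `P` (of `E` with itself) is a root system in the Euclidean space `E` in the
classical sense: the duality is the inner product, and the coroots are `α^∨ = 2 α / ⟨α, α⟩`. -/
structure IsEuclidean {ι E : Type*} [NormedAddCommGroup E] [InnerProductSpace ℝ E]
    (P : RootPairing ι ℝ E E) : Prop where
  toLinearMap_apply : ∀ x y : E, P.toLinearMap x y = inner ℝ x y
  coroot_eq : ∀ i, P.coroot i = (2 / inner ℝ (P.root i) (P.root i) : ℝ) • P.root i

/-- `Φ` is (the set of indices of) a choice of positive roots `R⁺`: the roots on the positive side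
of a hyperplane that contains no root. -/
def IsPositiveSystem {ι E : Type*} [NormedAddCommGroup E] [InnerProductSpace ℝ E]
    (P : RootPairing ι ℝ E E) (Φ : Finset ι) : Prop :=
  ∃ v : E, (∀ i, inner ℝ (P.root i) v ≠ 0) ∧ ∀ i, i ∈ Φ ↔ 0 < inner ℝ (P.root i) v

/-- The Weyl group `W ⊂ GL(E)`, generated by the reflections in the roots. -/
def weyl {ι E : Type*} [NormedAddCommGroup E] [InnerProductSpace ℝ E]
    (P : RootPairing ι ℝ E E) : Subgroup (E ≃ₗ[ℝ] E) :=
  Subgroup.closure (Set.range P.reflection)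

theorem weyl_root_mem {ι E : Type*} [NormedAddCommGroup E] [InnerProductSpace ℝ E]
    (P : RootPairing ι ℝ E E) (w : weyl P) (i : ι) : w.1 (P.root i) ∈ Set.range P.root := by
  obtain ⟨w, hw⟩ := w
  have key : ∀ x ∈ Set.range P.root, w x ∈ Set.range P.root := by
    induction hw using Subgroup.closure_induction'' with
    | mem w hw =>
      obtain ⟨j, rfl⟩ := hw
      exact fun x hx => P.mapsTo_reflection_root j hx
    | inv_mem w hw =>
      obtain ⟨j, rfl⟩ := hw
      rw [P.reflection_inv]
      exact fun x hx => P.mapsTo_reflection_root j hx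
    | one => exact fun x hx => hx
    | mul a b _ _ ha hb => exact fun x hx => ha _ (hb _ hx)
  exact key _ ⟨i, rfl⟩

instance {ι E : Type*} [NormedAddCommGroup E] [InnerProductSpace ℝ E] [Finite ι]
    (P : RootPairing ι ℝ E E) [P.IsRootSystem] : Finite (weyl P) := by
  have hinj : Function.Injective
      (fun (w : weyl P) (i : ι) => (⟨_, weyl_root_mem P w i⟩ : Set.range P.root)) := by
    intro w w' h
    apply Subtype.ext
    apply LinearEquiv.toLinearMap_injective
    refine LinearMap.ext_on (RootPairing.IsRootSystem.span_root_eq_top (P := P)) ?_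
    rintro _ ⟨i, rfl⟩
    exact congrArg Subtype.val (congrFun h i)
  exact Finite.of_injective _ hinj

instance {ι E : Type*} [NormedAddCommGroup E] [InnerProductSpace ℝ E] [Finite ι]
    (P : RootPairing ι ℝ E E) [P.IsRootSystem] : Fintype (weyl P) :=
  Fintype.ofFinite _

/-- The sign `(-1)^w = det w` of a Weyl group element. -/
def sgn {ι E : Type*} [NormedAddCommGroup E] [InnerProductSpace ℝ E]
    (P : RootPairing ι ℝ E E) (w : weyl P) : ℂ :=
  ((LinearMap.det (w.1 : E →ₗ[ℝ] E) : ℝ) : ℂ)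

open Classical in
/-- `R₀⁺`: the positive roots `α` such that `2 α` is not a root. -/
def posRoots0 {ι E : Type*} [NormedAddCommGroup E] [InnerProductSpace ℝ E]
    (P : RootPairing ι ℝ E E) (Φ : Finset ι) : Finset ι :=
  Φ.filter fun i => ∀ j, P.root j ≠ (2 : ℝ) • P.root i

open Classical in
/-- `R₁⁺`: the positive roots `α` such that `α / 2` is not a root. -/
def posRoots1 {ι E : Type*} [NormedAddCommGroup E] [InnerProductSpace ℝ E]
    (P : RootPairing ι ℝ E E) (Φ : Finset ι) : Finset ι :=
  Φ.filter fun i => ∀ j, P.root j ≠ (1 / 2 : ℝ) • P.root i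

/-- `ρ`, half the sum of the roots in `R₀⁺`. -/
def rho {ι E : Type*} [NormedAddCommGroup E] [InnerProductSpace ℝ E]
    (P : RootPairing ι ℝ E E) (Φ : Finset ι) : E :=
  (1 / 2 : ℝ) • ∑ i ∈ posRoots0 P Φ, P.root i

/-- The dominant weights `𝒫⁺`. -/
abbrev DomWeight {ι E : Type*} [NormedAddCommGroup E] [InnerProductSpace ℝ E]
    (P : RootPairing ι ℝ E E) (Φ : Finset ι) : Type _ :=
  {lam : E // ∀ i ∈ Φ, ∃ n : ℕ, inner ℝ lam (P.coroot i) = (n : ℝ)}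

/-- `m(λ) = min_{α ∈ R⁺} ⟨λ, α^∨⟩` (an infimum over a finite set). -/
def minPairing {ι E : Type*} [NormedAddCommGroup E] [InnerProductSpace ℝ E]
    (P : RootPairing ι ℝ E E) (Φ : Finset ι) (lam : E) : ℝ :=
  ⨅ i : Φ, inner ℝ lam (P.coroot i)

/-- The dominance partial order: `μ ≤ λ` if and only if `λ - μ` lies in the semigroup `𝒬⁺`
generated by the positive roots. -/
def Dominates {ι E : Type*} [NormedAddCommGroup E] [InnerProductSpace ℝ E]
    (P : RootPairing ι ℝ E E) (Φ : Finset ι) (mu lam : DomWeight P Φ) : Prop :=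
  lam.1 - mu.1 ∈ AddSubmonoid.closure (P.root '' (Φ : Set ι))

/-- `le` is a partial order `⪯` on the dominant weights that refines the dominance order and for
which every `{μ | μ ⪯ λ}` is finite. -/
structure IsAdmissibleOrder {ι E : Type*} [NormedAddCommGroup E] [InnerProductSpace ℝ E]
    (P : RootPairing ι ℝ E E) (Φ : Finset ι) (le : DomWeight P Φ → DomWeight P Φ → Prop) :
    Prop where
  refl : ∀ lam, le lam lam
  antisymm : ∀ lam mu, le lam mu → le mu lam → lam = mu
  trans : ∀ lam mu nu, le lam mu → le mu nu → le lam nu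
  refines : ∀ mu lam, Dominates P Φ mu lam → le mu lam
  finite_le : ∀ lam, {mu | le mu lam}.Finite

/-! ### Functions on the Weyl alcove -/

/-- The Weyl alcove `A`. -/
def alcove {ι E : Type*} [NormedAddCommGroup E] [InnerProductSpace ℝ E]
    (P : RootPairing ι ℝ E E) (Φ : Finset ι) : Set E :=
  {xi | ∀ i ∈ Φ, 0 < inner ℝ xi (P.root i) ∧ inner ℝ xi (P.root i) < 2 * Real.pi}

/-- The plane wave `e^{i ⟨x, ξ⟩}`. -/
def planeWave {E : Type*} [NormedAddCommGroup E] [InnerProductSpace ℝ E] (x xi : E) : ℂ :=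
  Complex.exp (Complex.I * ((inner ℝ x xi : ℝ) : ℂ))

/-- The monomial symmetric function `m_μ`. -/
def monomial {ι E : Type*} [NormedAddCommGroup E] [InnerProductSpace ℝ E] [Finite ι]
    (P : RootPairing ι ℝ E E) [P.IsRootSystem] (mu xi : E) : ℂ :=
  (Nat.card {w : weyl P // w.1 mu = mu} : ℂ)⁻¹ * ∑ w : weyl P, planeWave mu (w.1 xi)

/-- The Weyl denominator `δ`. -/
def weylDenom {ι E : Type*} [NormedAddCommGroup E] [InnerProductSpace ℝ E]
    (P : RootPairing ι ℝ E E) (Φ : Finset ι) (xi : E) : ℂ :=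
  ∏ i ∈ posRoots0 P Φ,
    (planeWave ((1 / 2 : ℝ) • P.root i) xi - planeWave (-(1 / 2 : ℝ) • P.root i) xi)

/-- The conditions on a single `c`-function: analytic and zero-free on the closed disc of radius
`ϱ`, equal to `1` at the origin, real-valued on the real axis. -/
structure IsCFunction (ϱ : ℝ) (c : ℂ → ℂ) : Prop where
  analytic : AnalyticOnNhd ℂ c (Metric.closedBall 0 ϱ)
  ne_zero : ∀ z ∈ Metric.closedBall (0 : ℂ) ϱ, c z ≠ 0
  map_zero : c 0 = 1
  real : ∀ x : ℝ, |x| ≤ ϱ → (c (x : ℂ)).im = 0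

/-- `Ĉ(ξ) = ∏_{α ∈ R₁⁺} ĉ_{|α|}(e^{-i ⟨α, ξ⟩})`. The `c`-function of a root `α` is `c ‖α‖`, so it
depends only on the length of `α`. -/
def bigC {ι E : Type*} [NormedAddCommGroup E] [InnerProductSpace ℝ E]
    (P : RootPairing ι ℝ E E) (Φ : Finset ι) (c : ℝ → ℂ → ℂ) (xi : E) : ℂ :=
  ∏ i ∈ posRoots1 P Φ, c ‖P.root i‖ (planeWave (-P.root i) xi)

/-- The weight function `Δ̂(ξ) = 1 / (Ĉ(ξ) Ĉ(-ξ))`. -/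
def weight {ι E : Type*} [NormedAddCommGroup E] [InnerProductSpace ℝ E]
    (P : RootPairing ι ℝ E E) (Φ : Finset ι) (c : ℝ → ℂ → ℂ) (xi : E) : ℂ :=
  1 / (bigC P Φ c xi * bigC P Φ c (-xi))

/-- `Δ̂^{1/2}`: since `Δ̂` is positive, the principal branch is the positive square root. -/
def sqrtWeight {ι E : Type*} [NormedAddCommGroup E] [InnerProductSpace ℝ E]
    (P : RootPairing ι ℝ E E) (Φ : Finset ι) (c : ℝ → ℂ → ℂ) (xi : E) : ℂ :=
  weight P Φ c xi ^ (1 / 2 : ℂ)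

/-- The normalized inner product of `L²(A, dξ)`:
`(f, g) = (|W| Vol(A))⁻¹ ∫_A f(ξ) conj (g(ξ)) dξ`. -/
def alcoveInner {ι E : Type*} [NormedAddCommGroup E] [InnerProductSpace ℝ E]
    [FiniteDimensional ℝ E] [MeasurableSpace E] [BorelSpace E]
    (P : RootPairing ι ℝ E E) (Φ : Finset ι) (f g : E → ℂ) : ℂ :=
  ((Nat.card (weyl P) : ℂ) * ((volume.real (alcove P Φ) : ℝ) : ℂ))⁻¹ *
    ∫ xi in alcove P Φ, f xi * (starRingEnd ℂ) (g xi)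

/-- The norm of `L²(A, dξ)` that belongs to `alcoveInner`. -/
def alcoveNorm {ι E : Type*} [NormedAddCommGroup E] [InnerProductSpace ℝ E]
    [FiniteDimensional ℝ E] [MeasurableSpace E] [BorelSpace E]
    (P : RootPairing ι ℝ E E) (Φ : Finset ι) (f : E → ℂ) : ℝ :=
  Real.sqrt (alcoveInner P Φ f f).re

/-- The inner product of `L²(A, Δ̂ |δ|² dξ)`:
`(f, g)_Δ̂ = (|W| Vol(A))⁻¹ ∫_A f(ξ) conj (g(ξ)) Δ̂(ξ) |δ(ξ)|² dξ`. -/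
def weightedInner {ι E : Type*} [NormedAddCommGroup E] [InnerProductSpace ℝ E]
    [FiniteDimensional ℝ E] [MeasurableSpace E] [BorelSpace E]
    (P : RootPairing ι ℝ E E) (Φ : Finset ι) (c : ℝ → ℂ → ℂ) (f g : E → ℂ) : ℂ :=
  ((Nat.card (weyl P) : ℂ) * ((volume.real (alcove P Φ) : ℝ) : ℂ))⁻¹ *
    ∫ xi in alcove P Φ, f xi * (starRingEnd ℂ) (g xi) * weight P Φ c xi *
      ((‖weylDenom P Φ xi‖ ^ 2 : ℝ) : ℂ)

/-- `p` is the family `(P_λ)` of trigonometric polynomials that the Gram-Schmidt process with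
respect to `(·, ·)_Δ̂` makes of the monomial basis, partially ordered by `le`:
`P_λ = ∑_{μ ⪯ λ} a_{λμ} m_μ` with `a_{λλ} > 0`, `(P_λ, P_μ)_Δ̂ = 0` for `μ ≺ λ`, and
`(P_λ, P_λ)_Δ̂ = 1`. -/
def IsGramSchmidt {ι E : Type*} [NormedAddCommGroup E] [InnerProductSpace ℝ E]
    [FiniteDimensional ℝ E] [MeasurableSpace E] [BorelSpace E] [Finite ι]
    (P : RootPairing ι ℝ E E) [P.IsRootSystem] (Φ : Finset ι) (c : ℝ → ℂ → ℂ)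
    (le : DomWeight P Φ → DomWeight P Φ → Prop) (p : DomWeight P Φ → E → ℂ) : Prop :=
  (∃ a : DomWeight P Φ → DomWeight P Φ → ℂ,
    (∀ lam, ∃ r : ℝ, 0 < r ∧ a lam lam = (r : ℂ)) ∧
    ∀ lam xi, p lam xi = ∑ᶠ mu : {mu // le mu lam}, a lam mu * monomial P mu.1.1 xi) ∧
  (∀ lam mu, le mu lam → mu ≠ lam → weightedInner P Φ c (p lam) (p mu) = 0) ∧
  ∀ lam, weightedInner P Φ c (p lam) (p lam) = 1

/-! ### The wave functions and their asymptotics -/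

/-- The wave function `Ψ_λ = Δ̂^{1/2} δ P_λ`. -/
def waveFunction {ι E : Type*} [NormedAddCommGroup E] [InnerProductSpace ℝ E]
    (P : RootPairing ι ℝ E E) (Φ : Finset ι) (c : ℝ → ℂ → ℂ)
    (p : DomWeight P Φ → E → ℂ) (lam : DomWeight P Φ) (xi : E) : ℂ :=
  sqrtWeight P Φ c xi * weylDenom P Φ xi * p lam xi

/-- `P_λ^∞ = δ⁻¹ ∑_w (-1)^w Ĉ(ξ_w) e^{i ⟨ρ + λ, ξ_w⟩}`. -/
def asymptoticPoly {ι E : Type*} [NormedAddCommGroup E] [InnerProductSpace ℝ E] [Finite ι]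
    (P : RootPairing ι ℝ E E) [P.IsRootSystem] (Φ : Finset ι) (c : ℝ → ℂ → ℂ)
    (lam : DomWeight P Φ) (xi : E) : ℂ :=
  (weylDenom P Φ xi)⁻¹ *
    ∑ w : weyl P, sgn P w * bigC P Φ c (w.1 xi) * planeWave (rho P Φ + lam.1) (w.1 xi)

/-- The scattering factor `Ŝ_w(ξ) = Ĉ(ξ_w) / Ĉ(-ξ_w)`. -/
def scatter {ι E : Type*} [NormedAddCommGroup E] [InnerProductSpace ℝ E]
    (P : RootPairing ι ℝ E E) (Φ : Finset ι) (c : ℝ → ℂ → ℂ) (w : weyl P) (xi : E) : ℂ :=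
  bigC P Φ c (w.1 xi) / bigC P Φ c (-(w.1 xi))

/-- `Ŝ_w^{1/2}(ξ) = Ĉ(ξ_w) / |Ĉ(ξ_w)|`. As `Ĉ(-ξ)` is the conjugate of `Ĉ(ξ)`, this is a square
root of `Ŝ_w`; it is the one that depends continuously on `ξ` and equals `1` at `ξ = 0`. (The
principal root jumps where `Ŝ_w = -1`.) -/
def sqrtScatter {ι E : Type*} [NormedAddCommGroup E] [InnerProductSpace ℝ E]
    (P : RootPairing ι ℝ E E) (Φ : Finset ι) (c : ℝ → ℂ → ℂ) (w : weyl P) (xi : E) : ℂ :=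
  bigC P Φ c (w.1 xi) / ((‖bigC P Φ c (w.1 xi)‖ : ℝ) : ℂ)

/-- `Ψ_λ^∞(ξ) = ∑_w (-1)^w Ŝ_w^{1/2}(ξ) e^{i ⟨ρ + λ, ξ_w⟩}`. -/
def asymptoticWave {ι E : Type*} [NormedAddCommGroup E] [InnerProductSpace ℝ E] [Finite ι]
    (P : RootPairing ι ℝ E E) [P.IsRootSystem] (Φ : Finset ι) (c : ℝ → ℂ → ℂ)
    (lam : DomWeight P Φ) (xi : E) : ℂ :=
  ∑ w : weyl P, sgn P w * sqrtScatter P Φ c w xi * planeWave (rho P Φ + lam.1) (w.1 xi)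

end WeylAlcove

end

/-! Dressing a symmetric polynomial f as Δ̂^{1/2} δ f turns the weighted inner product into that of
L²(A) (`weightedInner_eq`), so the Ψ_λ are the Gram-Schmidt orthonormalization of the dressed
monomials. Two properties of the functions Ψ^∞_λ force Ψ_λ to be close to them.

Triangularity, exact for every λ. The product of Δ̂^{1/2} with the conjugate of Ŝ_w^{1/2} is 1 /
Ĉ(ξ_w), so the pairing of the dressed m_μ with Ψ^∞_λ unfolds from the alcove to the torus E / 2π𝒬^∨
and becomes the coefficient of e^{i⟨ρ+λ,ξ⟩} in m_μ δ / Ĉ (`alcoveInner_dress_monomial`). As 1/Ĉ is a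
power series in the e^{-i⟨α,ξ⟩}, α > 0, with constant term 1, this coefficient is 1 for μ = λ and 0
unless λ ≤ μ in the dominance order (`isTriangularPair`).

Approximation, which uses m(λ). Replace each factor of Ĉ by its Taylor polynomial of degree M ≤
m(λ); by Cauchy's estimate the error is O(ϱ^{-M}). Let ρ₁ be half the sum of the roots in R₁⁺. Since
λ - Mρ₁ is dominant and the points Mρ₁ - ∑ n_α α with 0 ≤ n_α ≤ M lie in a W-invariant zonotope,
every Weyl image of an exponent stays below ρ + λ. Antisymmetrization then gives alternating sums
with exponents ρ + μ, μ ≤ λ, and leading coefficient 1; by the Weyl character formula in triangular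
form this is δ (m_λ + lower terms) (`exists_truncated_eq`). Thus Ψ^∞_λ is within O(ϱ^{-M}) of a
dressed polynomial with leading term m_λ (`exists_norm_dress_sub_le`).

The rest is Hilbert space geometry (`IsOrthonormalization.norm_sub_le`): a vector that is triangular
against the basis and lies at distance η from m_λ + lower terms is at distance at most 2η from the
Gram-Schmidt vector. This gives the rate ε = log ϱ. -/

noncomputable section

namespace WeylAlcove

/-! ### Reflections, the Weyl group and positive systems. -/

section RootCombinatorics

variable {ι E : Type*} [NormedAddCommGroup E] [InnerProductSpace ℝ E]
  {P : RootPairing ι ℝ E E} {Φ : Finset ι}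

theorem inner_root_self_pos (P : RootPairing ι ℝ E E) (i : ι) :
    0 < inner ℝ (P.root i) (P.root i) :=
  real_inner_self_pos.2 (P.ne_zero i)

theorem inner_coroot (hP : IsEuclidean P) (x : E) (i : ι) :
    inner ℝ x (P.coroot i) = 2 * inner ℝ x (P.root i) / inner ℝ (P.root i) (P.root i) := by
  rw [hP.coroot_eq, real_inner_smul_right]
  ring

theorem inner_coroot_pos_iff (hP : IsEuclidean P) (x : E) (i : ι) :
    0 < inner ℝ x (P.coroot i) ↔ 0 < inner ℝ x (P.root i) := by
  rw [inner_coroot hP, div_pos_iff_of_pos_right (inner_root_self_pos P i)]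
  simp

theorem inner_coroot_nonneg_iff (hP : IsEuclidean P) (x : E) (i : ι) :
    0 ≤ inner ℝ x (P.coroot i) ↔ 0 ≤ inner ℝ x (P.root i) := by
  have h := inner_root_self_pos P i
  rw [inner_coroot hP, mul_div_assoc, mul_div_left_comm]
  exact mul_nonneg_iff_of_pos_right (by positivity)

theorem reflection_eq (hP : IsEuclidean P) (i : ι) (x : E) :
    P.reflection i x = x - inner ℝ x (P.coroot i) • P.root i := by
  rw [P.reflection_apply, ← hP.toLinearMap_apply]
  rfl

theorem reflection_self (i : ι) : P.reflection i (P.root i) = -P.root i :=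
  P.reflection_apply_self i

theorem inner_reflection (hP : IsEuclidean P) (i : ι) (x y : E) :
    inner ℝ (P.reflection i x) (P.reflection i y) = inner ℝ x y := by
  have h := (inner_root_self_pos P i).ne'
  rw [reflection_eq hP, reflection_eq hP, inner_coroot hP, inner_coroot hP]
  simp only [inner_sub_left, inner_sub_right, real_inner_smul_left, real_inner_smul_right]
  rw [real_inner_comm y (P.root i)]
  field_simp
  ring

theorem reflection_reflection (i : ι) (x : E) : P.reflection i (P.reflection i x) = x :=
  P.reflection_same i x

/-- The reflection in a root, as an element of the Weyl group. -/
def simpleRefl (P : RootPairing ι ℝ E E) (i : ι) : weyl P :=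
  ⟨P.reflection i, Subgroup.subset_closure ⟨i, rfl⟩⟩

@[simp]
theorem simpleRefl_apply (i : ι) (x : E) : (simpleRefl P i).1 x = P.reflection i x := rfl

theorem simpleRefl_mul_self (i : ι) : simpleRefl P i * simpleRefl P i = 1 := by
  apply Subtype.ext
  apply LinearEquiv.ext
  intro x
  exact reflection_reflection i x

theorem simpleRefl_inv (i : ι) : (simpleRefl P i)⁻¹ = simpleRefl P i :=
  inv_eq_of_mul_eq_one_left (simpleRefl_mul_self i)

theorem weyl_mul_apply (w u : weyl P) (x : E) : (w * u).1 x = w.1 (u.1 x) := rfl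

theorem weyl_one_apply (x : E) : (1 : weyl P).1 x = x := rfl

theorem weyl_inv_apply_self (w : weyl P) (x : E) : (w⁻¹).1 (w.1 x) = x := by
  rw [← weyl_mul_apply, inv_mul_cancel, weyl_one_apply]

theorem weyl_apply_inv_self (w : weyl P) (x : E) : w.1 ((w⁻¹).1 x) = x := by
  rw [← weyl_mul_apply, mul_inv_cancel, weyl_one_apply]

/-- Induction along left multiplication by reflections. -/
theorem weyl_induction {p : weyl P → Prop} (one : p 1)
    (mul : ∀ i w, p w → p (simpleRefl P i * w)) (w : weyl P) : p w := by
  obtain ⟨w, hw⟩ := w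
  induction hw using Subgroup.closure_induction_left with
  | one => exact one
  | mul_left x hx y hy ih =>
    obtain ⟨i, rfl⟩ := hx
    exact mul i ⟨y, hy⟩ ih
  | inv_mul_cancel x hx y hy ih =>
    obtain ⟨i, rfl⟩ := hx
    have h := mul i ⟨y, hy⟩ ih
    have e : (⟨(P.reflection i)⁻¹ * y, mul_mem (inv_mem (Subgroup.subset_closure ⟨i, rfl⟩)) hy⟩ :
        weyl P) = simpleRefl P i * ⟨y, hy⟩ := by
      apply Subtype.ext
      change (P.reflection i)⁻¹ * y = P.reflection i * y
      rw [P.reflection_inv]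
    exact e ▸ h

theorem inner_weyl (hP : IsEuclidean P) (w : weyl P) (x y : E) :
    inner ℝ (w.1 x) (w.1 y) = inner ℝ x y := by
  induction w using weyl_induction with
  | one => rfl
  | mul i w ih => rw [weyl_mul_apply, weyl_mul_apply, simpleRefl_apply, simpleRefl_apply,
      inner_reflection hP, ih]

theorem inner_weyl_left (hP : IsEuclidean P) (w : weyl P) (x y : E) :
    inner ℝ (w.1 x) y = inner ℝ x ((w⁻¹).1 y) := by
  rw [← inner_weyl hP w x, weyl_apply_inv_self]

theorem inner_weyl_right (hP : IsEuclidean P) (w : weyl P) (x y : E) :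
    inner ℝ x (w.1 y) = inner ℝ ((w⁻¹).1 x) y := by
  rw [← inner_weyl hP w _ y, weyl_apply_inv_self]

theorem norm_weyl (hP : IsEuclidean P) (w : weyl P) (x : E) : ‖w.1 x‖ = ‖x‖ := by
  rw [norm_eq_sqrt_real_inner, norm_eq_sqrt_real_inner, inner_weyl hP]

theorem exists_int_pairing [P.IsCrystallographic] (hP : IsEuclidean P) (i j : ι) :
    ∃ z : ℤ, inner ℝ (P.root i) (P.coroot j) = z := by
  refine ⟨P.pairingIn ℤ i j, ?_⟩
  rw [← hP.toLinearMap_apply, P.root_coroot_eq_pairing, ← P.algebraMap_pairingIn ℤ]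
  rfl

theorem exists_root_eq_weyl (w : weyl P) (i : ι) : ∃ j, P.root j = w.1 (P.root i) :=
  weyl_root_mem P w i

/-- The index of the root `-α`. -/
def negIdx (P : RootPairing ι ℝ E E) (i : ι) : ι := P.reflectionPerm i i

@[simp]
theorem root_negIdx (i : ι) : P.root (negIdx P i) = -P.root i := by
  rw [negIdx, P.root_reflectionPerm, reflection_self]

@[simp]
theorem negIdx_negIdx (i : ι) : negIdx P (negIdx P i) = i := by
  apply P.root.injective
  simp

/-! ### Positive systems -/

/-- A functional that is positive exactly on the positive roots. -/
def height (hΦ : IsPositiveSystem P Φ) (x : E) : ℝ := inner ℝ x hΦ.choose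

theorem height_pos_iff (hΦ : IsPositiveSystem P Φ) (i : ι) : 0 < height hΦ (P.root i) ↔ i ∈ Φ := (hΦ.choose_spec.2 i).symm

theorem height_ne_zero (hΦ : IsPositiveSystem P Φ) (i : ι) : height hΦ (P.root i) ≠ 0 := hΦ.choose_spec.1 i

theorem height_add (hΦ : IsPositiveSystem P Φ) (x y : E) :
    height hΦ (x + y) = height hΦ x + height hΦ y := inner_add_left _ _ _

theorem height_neg (hΦ : IsPositiveSystem P Φ) (x : E) : height hΦ (-x) = -height hΦ x := inner_neg_left _ _

theorem height_sub (hΦ : IsPositiveSystem P Φ) (x y : E) :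
    height hΦ (x - y) = height hΦ x - height hΦ y := inner_sub_left _ _ _

theorem height_smul (hΦ : IsPositiveSystem P Φ) (r : ℝ) (x : E) : height hΦ (r • x) = r * height hΦ x :=
  real_inner_smul_left _ _ _

theorem height_zero (hΦ : IsPositiveSystem P Φ) : height hΦ 0 = 0 := inner_zero_left _

theorem negIdx_mem_iff (hΦ : IsPositiveSystem P Φ) (i : ι) : negIdx P i ∈ Φ ↔ i ∉ Φ := by
  rw [← height_pos_iff hΦ, ← height_pos_iff hΦ, root_negIdx, height_neg]
  have := height_ne_zero hΦ i
  constructor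
  · intro h1 h2; linarith
  · intro h; rcases lt_or_gt_of_ne this with h' | h'
    · linarith
    · exact absurd h' h

theorem mem_of_root_eq_smul (hΦ : IsPositiveSystem P Φ) {i j : ι} (hi : i ∈ Φ) {t : ℝ} (ht : 0 < t)
    (h : P.root j = t • P.root i) : j ∈ Φ := by
  rw [← height_pos_iff hΦ] at hi ⊢
  rw [h, height_smul]
  positivity

theorem pos_of_root_eq_smul (hΦ : IsPositiveSystem P Φ) {i j : ι} (hi : i ∈ Φ) (hj : j ∈ Φ) {t : ℝ}
    (h : P.root j = t • P.root i) : 0 < t := by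
  rw [← height_pos_iff hΦ] at hi hj
  rw [h, height_smul] at hj
  exact pos_of_mul_pos_left hj hi.le

/-- The cone `𝒬⁺` generated by the positive roots. -/
abbrev posCone (P : RootPairing ι ℝ E E) (Φ : Finset ι) : AddSubmonoid E :=
  AddSubmonoid.closure (P.root '' (Φ : Set ι))

theorem root_mem_posCone {i : ι} (hi : i ∈ Φ) : P.root i ∈ posCone P Φ :=
  AddSubmonoid.subset_closure ⟨i, hi, rfl⟩

theorem height_nonneg (hΦ : IsPositiveSystem P Φ) {x : E} (hx : x ∈ posCone P Φ) : 0 ≤ height hΦ x ∧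
    (height hΦ x = 0 → x = 0) := by
  induction hx using AddSubmonoid.closure_induction with
  | mem x hx =>
    obtain ⟨i, hi, rfl⟩ := hx
    have := (height_pos_iff hΦ i).2 hi
    exact ⟨this.le, fun h => absurd h this.ne'⟩
  | zero => exact ⟨(height_zero hΦ).ge, fun _ => rfl⟩
  | add x y _ _ hx hy =>
    rw [height_add]
    refine ⟨add_nonneg hx.1 hy.1, fun h => ?_⟩
    rw [hx.2 (by linarith [hx.1, hy.1]), hy.2 (by linarith [hx.1, hy.1]), add_zero]

/-- The cone is pointed, because the height is positive on its nonzero elements. This makes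
dominance antisymmetric and leading terms well defined. -/
theorem posCone_antisymm (hΦ : IsPositiveSystem P Φ) {x : E} (hx : x ∈ posCone P Φ) (h : -x ∈ posCone P Φ) : x = 0 := by
  have h1 := (height_nonneg hΦ hx).1
  have h2 := (height_nonneg hΦ h).1
  rw [height_neg] at h2
  exact (height_nonneg hΦ hx).2 (by linarith)

end RootCombinatorics

/-! ### Simple roots and the free action of the Weyl group on chambers. -/

section SimpleRoots

variable {ι E : Type*} [NormedAddCommGroup E] [InnerProductSpace ℝ E]
  {P : RootPairing ι ℝ E E} {Φ : Finset ι}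

theorem inner_weyl_coroot (hP : IsEuclidean P) (w : weyl P) {i j : ι}
    (h : P.root j = w.1 (P.root i)) (x : E) :
    inner ℝ (w.1 x) (P.coroot j) = inner ℝ x (P.coroot i) := by
  rw [inner_coroot hP, inner_coroot hP, h, inner_weyl hP, inner_weyl hP]

theorem inner_coroot_of_root_eq_smul (hP : IsEuclidean P) {i j : ι} {t : ℝ}
    (h : P.root j = t • P.root i) (x : E) :
    t * inner ℝ x (P.coroot j) = inner ℝ x (P.coroot i) := by
  have h1 := (inner_root_self_pos P i).ne'
  have ht : t ≠ 0 := by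
    rintro rfl
    exact P.ne_zero j (by rw [h, zero_smul])
  rw [inner_coroot hP, inner_coroot hP, h]
  simp only [real_inner_smul_left, real_inner_smul_right]
  field_simp

/-- Needed for nonreduced systems, where α and 2α give one reflection. -/
theorem reflection_eq_of_root_eq_smul (hP : IsEuclidean P) {i j : ι} {t : ℝ}
    (h : P.root j = t • P.root i) : P.reflection j = P.reflection i := by
  apply LinearEquiv.ext
  intro x
  rw [reflection_eq hP, reflection_eq hP, ← inner_coroot_of_root_eq_smul hP h x, h, smul_smul,
    mul_comm]

theorem simpleRefl_conj (hP : IsEuclidean P) (w : weyl P) {i j : ι}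
    (h : P.root j = w.1 (P.root i)) : simpleRefl P j * w = w * simpleRefl P i := by
  apply Subtype.ext
  apply LinearEquiv.ext
  intro x
  change P.reflection j (w.1 x) = w.1 (P.reflection i x)
  rw [reflection_eq hP, reflection_eq hP, inner_weyl_coroot hP w h, map_sub, map_smul, h]

/-- Difference of two roots with positive pairing. -/
theorem exists_root_sub [Finite ι] [P.IsCrystallographic] (hP : IsEuclidean P) {i j : ι}
    (h : 0 < inner ℝ (P.root i) (P.coroot j)) (hij : i ≠ j) :
    ∃ k, P.root k = P.root i - P.root j := by
  refine P.root_sub_root_mem_of_pairingIn_pos (i := i) (j := j) ?_ hij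
  rw [← hP.toLinearMap_apply, P.root_coroot_eq_pairing, ← P.algebraMap_pairingIn ℤ] at h
  simpa using h

/-- The positive roots that are not sums of two positive roots. -/
def IsSimple (P : RootPairing ι ℝ E E) (Φ : Finset ι) (i : ι) : Prop :=
  i ∈ Φ ∧ ∀ j ∈ Φ, ∀ k ∈ Φ, P.root i ≠ P.root j + P.root k

/-- Well-founded induction along the height. -/
theorem height_induction [Finite ι] (hΦ : IsPositiveSystem P Φ) {p : ι → Prop}
    (h : ∀ i, (∀ j, height hΦ (P.root j) < height hΦ (P.root i) → p j) → p i) (i : ι) : p i := by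
  have wf : WellFounded fun i j => height hΦ (P.root i) < height hΦ (P.root j) := by
    have : IsTrans ι fun i j => height hΦ (P.root i) < height hΦ (P.root j) :=
      ⟨fun _ _ _ => lt_trans⟩
    have : Std.Irrefl fun i j => height hΦ (P.root i) < height hΦ (P.root j) :=
      ⟨fun _ => lt_irrefl _⟩
    exact Finite.wellFounded_of_trans_of_irrefl _
  exact wf.induction i h

theorem positive_induction [Finite ι] (hΦ : IsPositiveSystem P Φ) {p : ι → Prop}
    (simple : ∀ i, IsSimple P Φ i → p i)
    (add : ∀ i j k, P.root i = P.root j + P.root k → p j → p k → p i) :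
    ∀ i ∈ Φ, p i := by
  intro i
  induction i using height_induction hΦ with
  | h i ih =>
    intro hi
    by_cases hs : IsSimple P Φ i
    · exact simple i hs
    · simp only [IsSimple, not_and, not_forall, not_not] at hs
      obtain ⟨j, hj, k, hk, h⟩ := hs hi
      have hj' := (height_pos_iff hΦ j).2 hj
      have hk' := (height_pos_iff hΦ k).2 hk
      have hh : height hΦ (P.root i) = height hΦ (P.root j) + height hΦ (P.root k) := by
        rw [h, height_add]
      exact add i j k h (ih j (by linarith) hj) (ih k (by linarith) hk)

theorem inner_nonneg_of_simple [Finite ι] (hΦ : IsPositiveSystem P Φ) {x : E}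
    (h : ∀ i, IsSimple P Φ i → 0 ≤ inner ℝ x (P.root i)) : ∀ i ∈ Φ, 0 ≤ inner ℝ x (P.root i) :=
  positive_induction hΦ h fun i j k hijk hj hk => by
    rw [hijk, inner_add_right]
    exact add_nonneg hj hk

theorem inner_pos_of_simple [Finite ι] (hΦ : IsPositiveSystem P Φ) {x : E}
    (h : ∀ i, IsSimple P Φ i → 0 < inner ℝ x (P.root i)) : ∀ i ∈ Φ, 0 < inner ℝ x (P.root i) :=
  positive_induction hΦ h fun i j k hijk hj hk => by
    rw [hijk, inner_add_right]
    exact add_pos hj hk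

/-- Pairing such an equation with α^∨ shows that one of the two summands pairs positively with α^∨.
If α is subtracted from it, the result is a positive root, which lowers n, or a negative one, which
would split that summand's complement and contradict simplicity of α. Summands proportional to α are
excluded so that the subtraction yields a root. -/
theorem not_nsmul_simple_eq_add [Finite ι] [P.IsCrystallographic] (hP : IsEuclidean P)
    (hΦ : IsPositiveSystem P Φ) {a : ι} (ha : IsSimple P Φ a) (n : ℕ) :
    ∀ b ∈ Φ, ∀ c ∈ Φ, (∀ t : ℝ, P.root b ≠ t • P.root a) →
      (n : ℝ) • P.root a ≠ P.root b + P.root c := by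
  induction n with
  | zero =>
    intro b hb c hc _ h
    have hb' := (height_pos_iff hΦ b).2 hb
    have hc' := (height_pos_iff hΦ c).2 hc
    have := congrArg (height hΦ) h
    rw [height_smul, height_add] at this
    simp only [Nat.cast_zero, zero_mul] at this
    linarith
  | succ n ih =>
    -- subtracting `α` from a summand with positive pairing
    have key : ∀ b ∈ Φ, ∀ c ∈ Φ, (∀ t : ℝ, P.root b ≠ t • P.root a) →
        ((n + 1 : ℕ) : ℝ) • P.root a = P.root b + P.root c →
        0 < inner ℝ (P.root b) (P.coroot a) → False := by
      intro b hb c hc hba h hpos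
      obtain ⟨d, hd⟩ := exists_root_sub hP hpos
        (fun e => hba 1 (by rw [e, one_smul]))
      by_cases hdΦ : d ∈ Φ
      · refine ih d hdΦ c hc ?_ ?_
        · intro t ht
          apply hba (t + 1)
          rw [add_smul, one_smul, ← ht, hd]
          abel
        · rw [hd, sub_add_eq_add_sub, ← h]
          push_cast
          module
      · refine ha.2 b hb (negIdx P d) ((negIdx_mem_iff hΦ d).2 hdΦ) ?_
        rw [root_negIdx, hd]
        abel
    intro b hb c hc hba h
    have h1 := congrArg (fun x => inner ℝ x (P.coroot a)) h
    simp only [inner_add_left, real_inner_smul_left] at h1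
    have h2 : inner ℝ (P.root a) (P.coroot a) = (2 : ℝ) := by
      rw [← hP.toLinearMap_apply, P.root_coroot_two]
    rw [h2] at h1
    by_cases hb0 : 0 < inner ℝ (P.root b) (P.coroot a)
    · exact key b hb c hc hba h hb0
    · have hc0 : 0 < inner ℝ (P.root c) (P.coroot a) := by
        push_cast at h1
        have : (0 : ℝ) ≤ n := Nat.cast_nonneg n
        linarith
      refine key c hc b hb ?_ (by rw [h, add_comm]) hc0
      intro t ht
      apply hba ((n + 1 : ℕ) - t)
      rw [sub_smul, h, ht]
      abel

/-- If s_α β were negative, then zα = β + γ with γ = -s_α β positive and z = ⟨β, α^∨⟩ a positive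
integer, which is impossible for a simple α. -/
theorem reflectionPerm_simple_mem [Finite ι] [P.IsCrystallographic] (hP : IsEuclidean P)
    (hΦ : IsPositiveSystem P Φ) {a b : ι} (ha : IsSimple P Φ a) (hb : b ∈ Φ)
    (hba : ∀ t : ℝ, P.root b ≠ t • P.root a) : P.reflectionPerm a b ∈ Φ := by
  by_contra hn
  have hc := (negIdx_mem_iff hΦ _).2 hn
  obtain ⟨z, hz⟩ := exists_int_pairing hP b a
  have hr : P.root (negIdx P (P.reflectionPerm a b)) = (z : ℝ) • P.root a - P.root b := by
    rw [root_negIdx, P.root_reflectionPerm, reflection_eq hP, hz]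
    abel
  have h1 := (height_pos_iff hΦ _).2 hc
  have h2 := (height_pos_iff hΦ _).2 hb
  have h3 := (height_pos_iff hΦ _).2 ha.1
  rw [hr, height_sub, height_smul] at h1
  have hz0 : 0 < (z : ℝ) := pos_of_mul_pos_left (by linarith) h3.le
  have hz0' : 0 < z := by exact_mod_cast hz0
  refine not_nsmul_simple_eq_add hP hΦ ha z.toNat b hb _ hc hba ?_
  rw [hr]
  have : ((z.toNat : ℕ) : ℝ) = (z : ℝ) := by
    exact_mod_cast congrArg (Int.cast (R := ℝ)) (Int.toNat_of_nonneg hz0'.le)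
  rw [this]
  abel

/-! ### The Weyl group acts freely on the positive systems -/

/-- The product of the reflections in a list of roots. -/
def word (P : RootPairing ι ℝ E E) (l : List ι) : weyl P := (l.map (simpleRefl P)).prod

theorem word_cons (i : ι) (l : List ι) : word P (i :: l) = simpleRefl P i * word P l := by
  simp [word]

theorem word_append (l l' : List ι) : word P (l ++ l') = word P l * word P l' := by
  simp [word]

/-- Otherwise -β would pair nonnegatively with all simple roots, hence with all positive roots,
including β. -/
theorem exists_simple_inner_pos [Finite ι] (hΦ : IsPositiveSystem P Φ) {i : ι} (hi : i ∈ Φ) :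
    ∃ a, IsSimple P Φ a ∧ 0 < inner ℝ (P.root i) (P.root a) := by
  by_contra! h
  have := inner_nonneg_of_simple (x := -P.root i) hΦ
    (fun a ha => by rw [inner_neg_left]; linarith [h a ha]) i hi
  rw [inner_neg_left] at this
  linarith [inner_root_self_pos P i]

/-- Descent on the height: a simple reflection s_a with ⟨β, a⟩ > 0 lowers β, and s_β is conjugate by
s_a to the reflection in the lower root. The descent ends at a root proportional to a simple one. -/
theorem simpleRefl_mem_closure_simple [Finite ι] [P.IsCrystallographic] (hP : IsEuclidean P)
    (hΦ : IsPositiveSystem P Φ) (i : ι) :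
    simpleRefl P i ∈ Subgroup.closure (simpleRefl P '' {a | IsSimple P Φ a}) := by
  have key : ∀ i ∈ Φ,
      simpleRefl P i ∈ Subgroup.closure (simpleRefl P '' {a | IsSimple P Φ a}) := by
    intro i
    induction i using height_induction hΦ with
    | h i ih =>
      intro hi
      obtain ⟨a, ha, hia⟩ := exists_simple_inner_pos hΦ hi
      have hsa : simpleRefl P a ∈ Subgroup.closure (simpleRefl P '' {a | IsSimple P Φ a}) :=
        Subgroup.subset_closure ⟨a, ha, rfl⟩
      by_cases hp : ∃ t : ℝ, P.root i = t • P.root a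
      · obtain ⟨t, ht⟩ := hp
        have : simpleRefl P i = simpleRefl P a :=
          Subtype.ext (reflection_eq_of_root_eq_smul hP ht)
        rw [this]
        exact hsa
      · push Not at hp
        have hm := reflectionPerm_simple_mem hP hΦ ha hi hp
        have hr := P.root_reflectionPerm a i
        have hlt : height hΦ (P.root (P.reflectionPerm a i)) < height hΦ (P.root i) := by
          rw [hr, reflection_eq hP, height_sub, height_smul]
          have := mul_pos ((inner_coroot_pos_iff hP _ _).2 hia) ((height_pos_iff hΦ a).2 ha.1)
          linarith
        have h1 := ih _ hlt hm
        have h2 : simpleRefl P (P.reflectionPerm a i) * simpleRefl P a =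
            simpleRefl P a * simpleRefl P i := simpleRefl_conj hP (simpleRefl P a) hr
        have h3 : simpleRefl P i =
            simpleRefl P a * (simpleRefl P (P.reflectionPerm a i) * simpleRefl P a) := by
          rw [h2, ← mul_assoc, simpleRefl_mul_self, one_mul]
        rw [h3]
        exact mul_mem hsa (mul_mem h1 hsa)
  by_cases hi : i ∈ Φ
  · exact key i hi
  · have h := key _ ((negIdx_mem_iff hΦ i).2 hi)
    have : simpleRefl P (negIdx P i) = simpleRefl P i :=
      Subtype.ext (reflection_eq_of_root_eq_smul (t := -1) hP (by simp))
    rwa [this] at h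

theorem exists_simple_word [Finite ι] [P.IsCrystallographic] (hP : IsEuclidean P)
    (hΦ : IsPositiveSystem P Φ) (w : weyl P) :
    ∃ l : List ι, (∀ i ∈ l, IsSimple P Φ i) ∧ word P l = w := by
  have hw : w ∈ Subgroup.closure (simpleRefl P '' {a | IsSimple P Φ a}) := by
    induction w using weyl_induction with
    | one => exact one_mem _
    | mul i w ih => exact mul_mem (simpleRefl_mem_closure_simple hP hΦ i) ih
  induction hw using Subgroup.closure_induction_left with
  | one => exact ⟨[], by simp, rfl⟩
  | mul_left x hx y hy ih =>
    obtain ⟨a, ha, rfl⟩ := hx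
    obtain ⟨l, hl, rfl⟩ := ih
    exact ⟨a :: l, by simpa using ⟨ha, hl⟩, word_cons a l⟩
  | inv_mul_cancel x hx y hy ih =>
    obtain ⟨a, ha, rfl⟩ := hx
    obtain ⟨l, hl, rfl⟩ := ih
    exact ⟨a :: l, by simpa using ⟨ha, hl⟩, by rw [word_cons, simpleRefl_inv]⟩

/-- The exchange condition. -/
theorem word_exchange [Finite ι] [P.IsCrystallographic] (hP : IsEuclidean P)
    (hΦ : IsPositiveSystem P Φ) {a : ι} (ha : IsSimple P Φ a) (l : List ι)
    (hl : ∀ i ∈ l, IsSimple P Φ i) (hneg : height hΦ ((word P l).1 (P.root a)) < 0) :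
    ∃ l' : List ι, (∀ i ∈ l', IsSimple P Φ i) ∧ l'.length + 1 = l.length ∧
      word P l' = word P l * simpleRefl P a := by
  induction l with
  | nil => exact absurd hneg (not_lt.2 ((height_pos_iff hΦ a).2 ha.1).le)
  | cons b l ih =>
    simp only [List.mem_cons, forall_eq_or_imp] at hl
    by_cases h : height hΦ ((word P l).1 (P.root a)) < 0
    · obtain ⟨l', h1, h2, h3⟩ := ih hl.2 h
      exact ⟨b :: l', by simpa using ⟨hl.1, h1⟩, by simp [h2],
        by rw [word_cons, h3, word_cons, mul_assoc]⟩
    · obtain ⟨c, hc⟩ := exists_root_eq_weyl (word P l) a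
      have hcΦ : c ∈ Φ := by
        rw [← height_pos_iff hΦ, hc]
        exact lt_of_le_of_ne (not_lt.1 h) (hc ▸ height_ne_zero hΦ c).symm
      -- The root turns negative exactly when the letter b is applied, and s_b makes only positive
      -- multiples of b negative. So c is proportional to b, and conjugation cancels the letter b
      -- against the new letter a.
      have hp : ∃ t : ℝ, P.root c = t • P.root b := by
        by_contra! hp
        have := (height_pos_iff hΦ _).2 (reflectionPerm_simple_mem hP hΦ hl.1 hcΦ hp)
        rw [P.root_reflectionPerm, hc] at this
        rw [word_cons, weyl_mul_apply] at hneg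
        exact absurd this (not_lt.2 hneg.le)
      obtain ⟨t, ht⟩ := hp
      refine ⟨l, hl.2, rfl, ?_⟩
      have e : simpleRefl P b = simpleRefl P c :=
        Subtype.ext (reflection_eq_of_root_eq_smul hP ht).symm
      rw [word_cons, e, simpleRefl_conj hP _ hc, mul_assoc, simpleRefl_mul_self, mul_one]

/-- If the last letter is a and the whole word keeps a positive, the word without that letter makes
a negative. The exchange condition then rewrites the element as a word two letters shorter. -/
theorem word_eq_one_of_pos [Finite ι] [P.IsCrystallographic] (hP : IsEuclidean P)
    (hΦ : IsPositiveSystem P Φ) (n : ℕ) : ∀ l : List ι, l.length = n →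
    (∀ i ∈ l, IsSimple P Φ i) → (∀ i ∈ Φ, 0 < height hΦ ((word P l).1 (P.root i))) →
      word P l = 1 := by
  induction n using Nat.strong_induction_on with
  | h n ih =>
    intro l hn hl hpos
    rcases List.eq_nil_or_concat l with rfl | ⟨l0, a, rfl⟩
    · rfl
    · have ha : IsSimple P Φ a := hl a (by simp)
      have hw : word P (l0 ++ [a]) = word P l0 * simpleRefl P a := by
        rw [word_append]; simp [word]
      have hneg : height hΦ ((word P l0).1 (P.root a)) < 0 := by
        have := hpos a ha.1
        rw [List.concat_eq_append, hw, weyl_mul_apply, simpleRefl_apply, reflection_self, map_neg,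
          height_neg] at this
        linarith
      obtain ⟨l', h1, h2, h3⟩ := word_exchange hP hΦ ha l0
        (fun i hi => hl i (by simp [hi])) hneg
      rw [List.concat_eq_append] at hn hpos ⊢
      rw [hw, ← h3]
      refine ih l'.length ?_ l' rfl h1 ?_
      · simp at hn; omega
      · rw [h3, ← hw]; exact hpos

/-- A Weyl group element that preserves the positive roots is the identity. -/
theorem eq_one_of_pos [Finite ι] [P.IsCrystallographic] (hP : IsEuclidean P)
    (hΦ : IsPositiveSystem P Φ) (w : weyl P)
    (hw : ∀ i ∈ Φ, 0 < height hΦ (w.1 (P.root i))) : w = 1 := by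
  obtain ⟨l, hl, rfl⟩ := exists_simple_word hP hΦ w
  exact word_eq_one_of_pos hP hΦ _ l rfl hl hw

/-- The Weyl group acts freely on the open Weyl chambers. -/
theorem eq_one_of_chamber [Finite ι] [P.IsCrystallographic] (hP : IsEuclidean P)
    (hΦ : IsPositiveSystem P Φ) (w : weyl P) {x : E} (hx : ∀ i ∈ Φ, 0 < inner ℝ x (P.root i))
    (hwx : ∀ i ∈ Φ, 0 ≤ inner ℝ (w.1 x) (P.root i)) : w = 1 := by
  rw [← inv_eq_one]
  apply eq_one_of_pos hP hΦ
  intro i hi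
  obtain ⟨j, hj⟩ := exists_root_eq_weyl w⁻¹ i
  have h1 := hwx i hi
  rw [inner_weyl_left hP, ← hj] at h1
  rw [← hj, height_pos_iff]
  by_contra hn
  have := hx _ ((negIdx_mem_iff hΦ j).2 hn)
  rw [root_negIdx, inner_neg_right] at this
  linarith

/-- An induction that replaces the one on length. With v the vector defining Φ, passing from w to
s_i w increases ⟨wv, v⟩ whenever w⁻¹ makes the positive root i negative; if there is no such root,
w⁻¹ preserves Φ and w = 1. -/
theorem weyl_descent [Finite ι] [P.IsCrystallographic] [P.IsRootSystem] (hP : IsEuclidean P)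
    (hΦ : IsPositiveSystem P Φ) {p : weyl P → Prop} (one : p 1)
    (step : ∀ w, ∀ i ∈ Φ, height hΦ ((w⁻¹).1 (P.root i)) < 0 → p (simpleRefl P i * w) → p w)
    (w : weyl P) : p w := by
  let f : weyl P → ℝ := fun w => height hΦ (w.1 hΦ.choose)
  have wf : WellFounded fun w w' => f w' < f w := by
    have : IsTrans (weyl P) fun w w' => f w' < f w := ⟨fun _ _ _ h h' => lt_trans h' h⟩
    have : Std.Irrefl fun w w' => f w' < f w := ⟨fun _ => lt_irrefl _⟩
    exact Finite.wellFounded_of_trans_of_irrefl _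
  induction w using wf.induction with
  | h w ih =>
    by_cases hw : ∃ i ∈ Φ, height hΦ ((w⁻¹).1 (P.root i)) < 0
    · obtain ⟨i, hi, hneg⟩ := hw
      refine step w i hi hneg (ih _ ?_)
      change height hΦ (w.1 _) < height hΦ (P.reflection i (w.1 _))
      rw [reflection_eq hP, height_sub, height_smul]
      have h1 : inner ℝ (w.1 hΦ.choose) (P.coroot i) < 0 := by
        rw [← neg_pos, ← inner_neg_left, inner_coroot_pos_iff hP, inner_neg_left, neg_pos,
          inner_weyl_left hP, real_inner_comm]
        exact hneg
      have := mul_neg_of_neg_of_pos h1 ((height_pos_iff hΦ i).2 hi)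
      linarith
    · push Not at hw
      have : w⁻¹ = 1 := eq_one_of_pos hP hΦ _ fun i hi => by
        obtain ⟨j, hj⟩ := exists_root_eq_weyl w⁻¹ i
        refine lt_of_le_of_ne (hw i hi) ?_
        rw [← hj]
        exact (height_ne_zero hΦ j).symm
      rw [inv_eq_one.1 this]
      exact one

end SimpleRoots

/-! ### Half sums over one root per ray, zonotopes and dominant weights. -/

section HalfSums

variable {ι E : Type*} [NormedAddCommGroup E] [InnerProductSpace ℝ E]
  {P : RootPairing ι ℝ E E} {Φ : Finset ι} {q : ι → Prop}

/-- `q` selects exactly one root on each ray through a root, in a Weyl-invariant way. -/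
structure IsRootChoice (P : RootPairing ι ℝ E E) (q : ι → Prop) : Prop where
  perm : ∀ i j, q j → q (P.reflectionPerm i j)
  eq_of_smul : ∀ i j, q i → q j → ∀ t : ℝ, 0 < t → P.root j = t • P.root i → j = i
  exists_smul : ∀ i, ∃ j, q j ∧ ∃ t : ℝ, 0 < t ∧ P.root j = t • P.root i

theorem inner_root_coroot_self (hP : IsEuclidean P) (i : ι) :
    inner ℝ (P.root i) (P.coroot i) = (2 : ℝ) := by
  rw [← hP.toLinearMap_apply, P.root_coroot_two]

/-- Proportional roots have ratio `1/2`, `1` or `2`. -/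
theorem ratio_cases [P.IsCrystallographic] (hP : IsEuclidean P) {i j : ι} {t : ℝ} (ht : 0 < t)
    (h : P.root j = t • P.root i) : t = 1 / 2 ∨ t = 1 ∨ t = 2 := by
  obtain ⟨m, hm⟩ := exists_int_pairing hP j i
  obtain ⟨n, hn⟩ := exists_int_pairing hP i j
  have h1 : (m : ℝ) = t * 2 := by
    rw [← hm, h, real_inner_smul_left, inner_root_coroot_self hP]
  have h2 : t * n = 2 := by
    rw [← hn, inner_coroot_of_root_eq_smul hP h, inner_root_coroot_self hP]
  -- The two Cartan integers of proportional roots multiply to 4, so m = 2t is a positive divisor of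
  -- 4.
  have h3 : m * n = 4 := by
    have : (m : ℝ) * n = 4 := by rw [h1]; linarith
    exact_mod_cast this
  have hm0 : 0 < m := by
    have : (0 : ℝ) < m := by rw [h1]; linarith
    exact_mod_cast this
  have hm4 : m ≤ 4 := Int.le_of_dvd (by norm_num) ⟨n, h3.symm⟩
  have hm3 : m ≠ 3 := by rintro rfl; omega
  have : m = 1 ∨ m = 2 ∨ m = 4 := by omega
  rcases this with rfl | rfl | rfl
  · left; push_cast at h1; linarith
  · right; left; push_cast at h1; linarith
  · right; right; push_cast at h1; linarith

theorem root_eq_smul_of_reflectionPerm {i j k : ι} {t : ℝ}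
    (h : P.root k = t • P.root (P.reflectionPerm i j)) :
    P.root (P.reflectionPerm i k) = t • P.root j := by
  rw [P.root_reflectionPerm, h, map_smul, P.root_reflectionPerm, reflection_reflection]

/-- This choice takes the longest root on each ray: if 2α is a root, 4α is not, as ratios never
exceed 2. -/
theorem isRootChoice_zero [P.IsCrystallographic] (hP : IsEuclidean P) :
    IsRootChoice P fun i => ∀ j, P.root j ≠ (2 : ℝ) • P.root i where
  perm i j hj k hk := hj _ (root_eq_smul_of_reflectionPerm hk)
  eq_of_smul i j hi hj t ht h := by
    rcases ratio_cases hP ht h with rfl | rfl | rfl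
    · refine absurd ?_ (hj i)
      rw [h, smul_smul]; norm_num
    · exact P.root.injective (by rw [h, one_smul])
    · exact absurd h (hi j)
  exists_smul i := by
    by_cases h : ∀ j, P.root j ≠ (2 : ℝ) • P.root i
    · exact ⟨i, h, 1, one_pos, by rw [one_smul]⟩
    · push Not at h
      obtain ⟨j, hj⟩ := h
      refine ⟨j, fun k hk => ?_, 2, two_pos, hj⟩
      rw [hj, smul_smul] at hk
      rcases ratio_cases hP (by norm_num) hk with h | h | h <;> norm_num at h

/-- This choice takes the shortest root on each ray. -/
theorem isRootChoice_one [P.IsCrystallographic] (hP : IsEuclidean P) :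
    IsRootChoice P fun i => ∀ j, P.root j ≠ (1 / 2 : ℝ) • P.root i where
  perm i j hj k hk := hj _ (root_eq_smul_of_reflectionPerm hk)
  eq_of_smul i j hi hj t ht h := by
    rcases ratio_cases hP ht h with rfl | rfl | rfl
    · exact absurd h (hi j)
    · exact P.root.injective (by rw [h, one_smul])
    · refine absurd ?_ (hj i)
      rw [h, smul_smul]; norm_num
  exists_smul i := by
    by_cases h : ∀ j, P.root j ≠ (1 / 2 : ℝ) • P.root i
    · exact ⟨i, h, 1, one_pos, by rw [one_smul]⟩
    · push Not at h
      obtain ⟨j, hj⟩ := h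
      refine ⟨j, fun k hk => ?_, 1 / 2, by norm_num, hj⟩
      rw [hj, smul_smul] at hk
      rcases ratio_cases hP (by norm_num) hk with h | h | h <;> norm_num at h

theorem IsRootChoice.neg (hq : IsRootChoice P q) {i : ι} (hi : q i) : q (negIdx P i) :=
  hq.perm i i hi

theorem IsRootChoice.weyl (hq : IsRootChoice P q) (w : weyl P) : ∀ {i j : ι}, q i →
    P.root j = w.1 (P.root i) → q j := by
  induction w using weyl_induction with
  | one =>
    intro i j hi h
    rwa [P.root.injective h]
  | mul k w ih =>
    intro i j hi h
    have h' : P.root (P.reflectionPerm k j) = w.1 (P.root i) := by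
      rw [P.root_reflectionPerm, h, weyl_mul_apply, simpleRefl_apply, reflection_reflection]
    have := hq.perm k _ (ih hi h')
    rwa [P.reflectionPerm_self] at this

open Classical in
/-- The positive root among `± s_j α_i`. -/
def flipIdx (P : RootPairing ι ℝ E E) (Φ : Finset ι) (j i : ι) : ι :=
  if P.reflectionPerm j i ∈ Φ then P.reflectionPerm j i else negIdx P (P.reflectionPerm j i)

theorem flipIdx_mem (hΦ : IsPositiveSystem P Φ) (j i : ι) : flipIdx P Φ j i ∈ Φ := by
  unfold flipIdx
  split_ifs with h
  · exact h
  · exact (negIdx_mem_iff hΦ _).2 h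

theorem reflectionPerm_negIdx (j i : ι) :
    P.reflectionPerm j (negIdx P i) = negIdx P (P.reflectionPerm j i) := by
  apply P.root.injective
  simp

theorem flipIdx_flipIdx (hΦ : IsPositiveSystem P Φ) (j : ι) {i : ι} (hi : i ∈ Φ) :
    flipIdx P Φ j (flipIdx P Φ j i) = i := by
  by_cases h : P.reflectionPerm j i ∈ Φ
  · have h1 : flipIdx P Φ j i = P.reflectionPerm j i := if_pos h
    rw [h1]
    unfold flipIdx
    rw [P.reflectionPerm_self, if_pos hi]
  · have h1 : flipIdx P Φ j i = negIdx P (P.reflectionPerm j i) := if_neg h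
    rw [h1]
    unfold flipIdx
    rw [reflectionPerm_negIdx, P.reflectionPerm_self, negIdx_negIdx,
      if_neg (fun hn => (negIdx_mem_iff hΦ i).1 hn hi)]

theorem reflectionPerm_flipIdx_mem_iff (hΦ : IsPositiveSystem P Φ) (j : ι) {i : ι} (hi : i ∈ Φ) :
    P.reflectionPerm j (flipIdx P Φ j i) ∈ Φ ↔ P.reflectionPerm j i ∈ Φ := by
  by_cases h : P.reflectionPerm j i ∈ Φ
  · have h1 : flipIdx P Φ j i = P.reflectionPerm j i := if_pos h
    rw [h1, P.reflectionPerm_self]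
    simp [h, hi]
  · have h1 : flipIdx P Φ j i = negIdx P (P.reflectionPerm j i) := if_neg h
    rw [h1, reflectionPerm_negIdx, P.reflectionPerm_self, negIdx_mem_iff hΦ]
    simp [h, hi]

theorem IsRootChoice.flipIdx (hq : IsRootChoice P q) (j : ι) {i : ι} (hi : q i) :
    q (flipIdx P Φ j i) := by
  unfold WeylAlcove.flipIdx
  split_ifs
  · exact hq.perm _ _ hi
  · exact hq.neg (hq.perm _ _ hi)

open Classical in
/-- The positive roots selected by `q`. -/
def posPart (Φ : Finset ι) (q : ι → Prop) : Finset ι := Φ.filter q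

theorem mem_posPart {i : ι} : i ∈ posPart Φ q ↔ i ∈ Φ ∧ q i := by
  classical
  exact Finset.mem_filter

theorem sum_flipIdx {M : Type*} [AddCommMonoid M] (hΦ : IsPositiveSystem P Φ)
    (hq : IsRootChoice P q) (j : ι) (f : ι → M) :
    ∑ i ∈ posPart Φ q, f (flipIdx P Φ j i) = ∑ i ∈ posPart Φ q, f i := by
  have hmem : ∀ i ∈ posPart Φ q, flipIdx P Φ j i ∈ posPart Φ q := fun i hi =>
    mem_posPart.2 ⟨flipIdx_mem hΦ j i, hq.flipIdx j (mem_posPart.1 hi).2⟩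
  exact Finset.sum_nbij' (flipIdx P Φ j) (flipIdx P Φ j) hmem hmem
    (fun i hi => flipIdx_flipIdx hΦ j (mem_posPart.1 hi).1)
    (fun i hi => flipIdx_flipIdx hΦ j (mem_posPart.1 hi).1) (fun _ _ => rfl)

/-- Half the sum of the positive roots selected by `q`. -/
def halfSum (P : RootPairing ι ℝ E E) (Φ : Finset ι) (q : ι → Prop) : E :=
  (1 / 2 : ℝ) • ∑ i ∈ posPart Φ q, P.root i

/-- The points `M ρ_q - ∑ nᵢ αᵢ` with `0 ≤ nᵢ ≤ M`. -/
def zonotope (P : RootPairing ι ℝ E E) (Φ : Finset ι) (q : ι → Prop) (M : ℕ) : Set E :=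
  {x | ∃ n : ι → ℕ, (∀ i ∈ posPart Φ q, n i ≤ M) ∧
    x = (M : ℝ) • halfSum P Φ q - ∑ i ∈ posPart Φ q, (n i : ℝ) • P.root i}

/-- In this form the coefficients fill a range symmetric about 0, so sign changes of roots are
harmless. -/
theorem zonotope_eq (M : ℕ) (n : ι → ℕ) :
    (M : ℝ) • halfSum P Φ q - ∑ i ∈ posPart Φ q, (n i : ℝ) • P.root i =
      ∑ i ∈ posPart Φ q, ((M : ℝ) / 2 - n i) • P.root i := by
  simp only [sub_smul, Finset.sum_sub_distrib, halfSum, smul_smul, ← Finset.smul_sum]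
  congr 2
  ring

/-- A reflection permutes the pairs ± α of selected roots. Where a positive root goes to a negative
one, the coefficient M/2 - n changes sign, which amounts to replacing n by M - n. -/
theorem reflection_zonotope (hΦ : IsPositiveSystem P Φ) (hq : IsRootChoice P q) {M : ℕ} (j : ι)
    {x : E} (hx : x ∈ zonotope P Φ q M) : P.reflection j x ∈ zonotope P Φ q M := by
  classical
  obtain ⟨n, hn, rfl⟩ := hx
  refine ⟨fun k => if P.reflectionPerm j k ∈ Φ then n (flipIdx P Φ j k)
    else M - n (flipIdx P Φ j k), ?_, ?_⟩
  · intro k hk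
    have := hn (flipIdx P Φ j k)
      (mem_posPart.2 ⟨flipIdx_mem hΦ j k, hq.flipIdx j (mem_posPart.1 hk).2⟩)
    dsimp only
    split_ifs
    · exact this
    · exact Nat.sub_le _ _
  · rw [zonotope_eq, zonotope_eq, map_sum]
    rw [← sum_flipIdx hΦ hq j (fun k => ((M : ℝ) / 2 - _) • P.root k)]
    refine Finset.sum_congr rfl fun i hi => ?_
    have hi' := (mem_posPart.1 hi).1
    rw [map_smul, ← P.root_reflectionPerm, flipIdx_flipIdx hΦ j hi']
    by_cases h : P.reflectionPerm j i ∈ Φ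
    · rw [if_pos ((reflectionPerm_flipIdx_mem_iff hΦ j hi').2 h)]
      congr 2
      exact (if_pos h).symm
    · rw [if_neg (fun h' => h ((reflectionPerm_flipIdx_mem_iff hΦ j hi').1 h'))]
      have : flipIdx P Φ j i = negIdx P (P.reflectionPerm j i) := if_neg h
      rw [this, root_negIdx, Nat.cast_sub (hn i hi)]
      module

theorem weyl_zonotope (hΦ : IsPositiveSystem P Φ) (hq : IsRootChoice P q) {M : ℕ} (w : weyl P)
    {x : E} (hx : x ∈ zonotope P Φ q M) : w.1 x ∈ zonotope P Φ q M := by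
  induction w using weyl_induction with
  | one => exact hx
  | mul i w ih => exact reflection_zonotope hΦ hq i ih

theorem sum_mem_posCone (s : Finset ι) (hs : s ⊆ Φ) (n : ι → ℕ) :
    ∑ i ∈ s, (n i : ℝ) • P.root i ∈ posCone P Φ := by
  refine sum_mem fun i hi => ?_
  rw [Nat.cast_smul_eq_nsmul]
  exact nsmul_mem (root_mem_posCone (hs hi)) _

theorem posPart_subset : posPart Φ q ⊆ Φ := fun _ hi => (mem_posPart.1 hi).1

theorem sub_mem_of_zonotope {M : ℕ} {x : E} (hx : x ∈ zonotope P Φ q M) :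
    (M : ℝ) • halfSum P Φ q - x ∈ posCone P Φ := by
  obtain ⟨n, -, rfl⟩ := hx
  rw [sub_sub_cancel]
  exact sum_mem_posCone _ posPart_subset n

/-- The half sum is the point n = 0 of the invariant zonotope with M = 1. -/
theorem halfSum_sub_weyl_mem (hΦ : IsPositiveSystem P Φ) (hq : IsRootChoice P q) (w : weyl P) :
    halfSum P Φ q - w.1 (halfSum P Φ q) ∈ posCone P Φ := by
  have h : halfSum P Φ q ∈ zonotope P Φ q 1 := ⟨0, by simp, by simp⟩
  simpa using sub_mem_of_zonotope (weyl_zonotope hΦ hq w h)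

/-! ### The pairing of half sums with simple coroots -/

/-- The reflection in a permutes the selected positive roots off the ray of a and negates the
selected root b on that ray. It therefore lowers the half sum by exactly b, whether b is a itself or
its double. -/
theorem inner_halfSum_simple [Finite ι] [P.IsCrystallographic] (hP : IsEuclidean P)
    (hΦ : IsPositiveSystem P Φ) (hq : IsRootChoice P q) {a b : ι} (ha : IsSimple P Φ a)
    (hb : q b) {t : ℝ} (ht : 0 < t) (hab : P.root b = t • P.root a) :
    inner ℝ (halfSum P Φ q) (P.coroot b) = (1 : ℝ) := by
  classical
  have hbΦ : b ∈ posPart Φ q := mem_posPart.2 ⟨mem_of_root_eq_smul hΦ ha.1 ht hab, hb⟩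
  have hrb : P.reflection a (P.root b) = -P.root b := by
    rw [hab, map_smul, reflection_self, smul_neg]
  have h1 : P.reflection a (∑ i ∈ posPart Φ q, P.root i) =
      (∑ i ∈ posPart Φ q, P.root i) - (2 : ℝ) • P.root b := by
    rw [map_sum, ← sum_flipIdx hΦ hq a fun i => P.root i, eq_comm, sub_eq_iff_eq_add',
      ← sub_eq_iff_eq_add, ← Finset.sum_sub_distrib]
    rw [Finset.sum_eq_single_of_mem b hbΦ]
    · have hn : P.reflectionPerm a b ∉ Φ := by
        have e : P.reflectionPerm a b = negIdx P b := P.root.injective (by simp [hrb])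
        rw [e, negIdx_mem_iff hΦ]
        simpa using (mem_posPart.1 hbΦ).1
      have e : flipIdx P Φ a b = negIdx P (P.reflectionPerm a b) := if_neg hn
      rw [e, root_negIdx, P.root_reflectionPerm, hrb]
      module
    · intro i hi hib
      have hm : P.reflectionPerm a i ∈ Φ := by
        refine reflectionPerm_simple_mem hP hΦ ha (mem_posPart.1 hi).1 fun s hs => hib ?_
        have hs0 := pos_of_root_eq_smul hΦ ha.1 (mem_posPart.1 hi).1 hs
        refine hq.eq_of_smul b i hb (mem_posPart.1 hi).2 (s / t) (by positivity) ?_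
        rw [hs, hab, smul_smul, div_mul_cancel₀ _ ht.ne']
      have e : flipIdx P Φ a i = P.reflectionPerm a i := if_pos hm
      rw [e, P.root_reflectionPerm, sub_self]
  have h2 : P.reflection b (halfSum P Φ q) = halfSum P Φ q - P.root b := by
    rw [reflection_eq_of_root_eq_smul hP hab, halfSum, map_smul, h1]
    module
  rw [reflection_eq hP, sub_right_inj] at h2
  have h3 : (inner ℝ (halfSum P Φ q) (P.coroot b) - 1) • P.root b = 0 := by
    rw [sub_smul, h2, one_smul, sub_self]
  rcases smul_eq_zero.1 h3 with h | h
  · linarith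
  · exact absurd h (P.ne_zero b)

theorem inner_halfSum_pos [Finite ι] [P.IsCrystallographic] (hP : IsEuclidean P)
    (hΦ : IsPositiveSystem P Φ) (hq : IsRootChoice P q) :
    ∀ i ∈ Φ, 0 < inner ℝ (halfSum P Φ q) (P.root i) := by
  refine inner_pos_of_simple hΦ fun a ha => ?_
  obtain ⟨b, hb, t, ht, hab⟩ := hq.exists_smul a
  rw [← inner_coroot_pos_iff hP, ← inner_coroot_of_root_eq_smul hP hab,
    inner_halfSum_simple hP hΦ hq ha hb ht hab]
  linarith

theorem halfSum_weyl_eq [Finite ι] [P.IsCrystallographic] (hP : IsEuclidean P)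
    (hΦ : IsPositiveSystem P Φ) (hq : IsRootChoice P q) (w : weyl P)
    (h : w.1 (halfSum P Φ q) = halfSum P Φ q) : w = 1 := by
  have := inner_halfSum_pos hP hΦ hq
  exact eq_one_of_chamber hP hΦ w this fun i hi => by rw [h]; exact (this i hi).le

theorem coroot_negIdx (hP : IsEuclidean P) (i : ι) : P.coroot (negIdx P i) = -P.coroot i := by
  rw [hP.coroot_eq, hP.coroot_eq, root_negIdx]
  simp

/-- Descent on the height. Since s_a moves the half sum by the simple root a, the pairings of the
half sum with β^∨ and with (s_a β)^∨ differ by a Cartan integer. -/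
theorem exists_int_inner_halfSum [Finite ι] [P.IsCrystallographic] (hP : IsEuclidean P)
    (hΦ : IsPositiveSystem P Φ) (hq : IsRootChoice P q) (hs : ∀ a, IsSimple P Φ a → q a) (i : ι) :
    i ∈ posPart Φ q → ∃ z : ℤ, inner ℝ (halfSum P Φ q) (P.coroot i) = z := by
  induction i using height_induction hΦ with
  | h i ih =>
    intro hi
    obtain ⟨hiΦ, hiq⟩ := mem_posPart.1 hi
    obtain ⟨a, ha, hia⟩ := exists_simple_inner_pos hΦ hiΦ
    have haa := inner_halfSum_simple hP hΦ hq ha (hs a ha) one_pos (one_smul ℝ _).symm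
    by_cases hp : ∃ t : ℝ, P.root i = t • P.root a
    · obtain ⟨t, ht⟩ := hp
      rw [hq.eq_of_smul a i (hs a ha) hiq t (pos_of_root_eq_smul hΦ ha.1 hiΦ ht) ht]
      exact ⟨1, by rw [haa]; simp⟩
    · push Not at hp
      have hm := reflectionPerm_simple_mem hP hΦ ha hiΦ hp
      have hr := P.root_reflectionPerm a i
      have hlt : height hΦ (P.root (P.reflectionPerm a i)) < height hΦ (P.root i) := by
        rw [hr, reflection_eq hP, height_sub, height_smul]
        have := mul_pos ((inner_coroot_pos_iff hP _ _).2 hia) ((height_pos_iff hΦ a).2 ha.1)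
        linarith
      obtain ⟨z, hz⟩ := ih _ hlt (mem_posPart.2 ⟨hm, hq.perm a i hiq⟩)
      obtain ⟨y, hy⟩ := exists_int_pairing hP a (P.reflectionPerm a i)
      refine ⟨z - y, ?_⟩
      have h1 := inner_weyl_coroot hP (simpleRefl P a) hr (halfSum P Φ q)
      rw [← h1, simpleRefl_apply, reflection_eq hP, haa, inner_sub_left, one_smul, hz, hy]
      push_cast
      rfl

/-! ### Dominant vectors -/

/-- Each step of the descent from w to 1 contributes a nonnegative integer multiple of a positive
root. Integrality is asked only on the selected roots, one per ray: Mρ₁, to which this is applied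
below, can have half-integral pairing with the coroot of a doubled root. -/
theorem sub_weyl_mem_posCone [Finite ι] [P.IsCrystallographic] [P.IsRootSystem]
    (hP : IsEuclidean P) (hΦ : IsPositiveSystem P Φ) (hq : IsRootChoice P q) {x : E}
    (hx : ∀ i ∈ posPart Φ q, ∃ n : ℕ, inner ℝ x (P.coroot i) = n) (w : weyl P) :
    x - w.1 x ∈ posCone P Φ := by
  induction w using weyl_descent hP hΦ with
  | one => simp
  | step w i hi hneg ih =>
    obtain ⟨j, hj, t, ht, hij⟩ := hq.exists_smul i
    have hjΦ := mem_of_root_eq_smul hΦ hi ht hij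
    obtain ⟨k, hk⟩ := exists_root_eq_weyl w⁻¹ j
    have hkΦ : k ∉ Φ := by
      rw [← height_pos_iff hΦ, hk, hij, map_smul, height_smul]
      exact not_lt.2 (mul_neg_of_pos_of_neg ht hneg).le
    obtain ⟨n, hn⟩ := hx (negIdx P k)
      (mem_posPart.2 ⟨(negIdx_mem_iff hΦ k).2 hkΦ, hq.neg (hq.weyl _ hj hk)⟩)
    have h1 := inner_weyl_coroot hP w⁻¹ hk (w.1 x)
    rw [weyl_inv_apply_self] at h1
    rw [coroot_negIdx hP, inner_neg_right, h1] at hn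
    have h2 : x - w.1 x = (x - (simpleRefl P i * w).1 x) + (n : ℝ) • P.root j := by
      rw [weyl_mul_apply, simpleRefl_apply, ← reflection_eq_of_root_eq_smul hP hij,
        reflection_eq hP, ← hn]
      module
    rw [h2, Nat.cast_smul_eq_nsmul]
    exact add_mem ih (nsmul_mem (root_mem_posCone hjΦ) n)

/-- The point of greatest height in a Weyl orbit is dominant, since a reflection in a positive root
of negative pairing would raise it. -/
theorem exists_weyl_dominant [Finite ι] [P.IsRootSystem] (hP : IsEuclidean P)
    (hΦ : IsPositiveSystem P Φ) (x : E) :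
    ∃ w : weyl P, ∀ i ∈ Φ, 0 ≤ inner ℝ (w.1 x) (P.root i) := by
  obtain ⟨w, hw⟩ := Finite.exists_max fun w : weyl P => height hΦ (w.1 x)
  refine ⟨w, fun i hi => ?_⟩
  have h := hw (simpleRefl P i * w)
  rw [weyl_mul_apply, simpleRefl_apply, reflection_eq hP, height_sub, height_smul] at h
  rw [← inner_coroot_nonneg_iff hP]
  have hi' := (height_pos_iff hΦ i).2 hi
  by_contra! hn
  have := mul_neg_of_neg_of_pos hn hi'
  linarith

/-- The vectors whose pairings with all coroots are integers. -/
def weightLattice (P : RootPairing ι ℝ E E) : AddSubgroup E where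
  carrier := {x | ∀ i, ∃ z : ℤ, inner ℝ x (P.coroot i) = z}
  zero_mem' i := ⟨0, by simp⟩
  add_mem' {x y} hx hy i := by
    obtain ⟨z, hz⟩ := hx i
    obtain ⟨z', hz'⟩ := hy i
    exact ⟨z + z', by rw [inner_add_left, hz, hz']; push_cast; rfl⟩
  neg_mem' {x} hx i := by
    obtain ⟨z, hz⟩ := hx i
    exact ⟨-z, by rw [inner_neg_left, hz]; push_cast; rfl⟩

theorem posCone_le_weightLattice [P.IsCrystallographic] (hP : IsEuclidean P) :
    posCone P Φ ≤ (weightLattice P).toAddSubmonoid :=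
  AddSubmonoid.closure_le.2 fun x hx => by
    obtain ⟨i, -, rfl⟩ := hx
    exact exists_int_pairing hP i

theorem weyl_mem_weightLattice (hP : IsEuclidean P) (w : weyl P) {x : E}
    (hx : x ∈ weightLattice P) : w.1 x ∈ weightLattice P := fun i => by
  obtain ⟨j, hj⟩ := exists_root_eq_weyl w⁻¹ i
  obtain ⟨z, hz⟩ := hx j
  refine ⟨z, ?_⟩
  rw [← hz, ← inner_weyl_coroot hP w (j := i) (i := j) (by rw [hj, weyl_apply_inv_self])]

theorem domWeight_mem_weightLattice (hP : IsEuclidean P) (hΦ : IsPositiveSystem P Φ)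
    (lam : DomWeight P Φ) : lam.1 ∈ weightLattice P := fun i => by
  by_cases hi : i ∈ Φ
  · obtain ⟨n, hn⟩ := lam.2 i hi
    exact ⟨n, by rw [hn]; simp⟩
  · obtain ⟨n, hn⟩ := lam.2 _ ((negIdx_mem_iff hΦ i).2 hi)
    rw [coroot_negIdx hP, inner_neg_right] at hn
    exact ⟨-n, by push_cast; linarith⟩

theorem rho_eq (P : RootPairing ι ℝ E E) (Φ : Finset ι) :
    rho P Φ = halfSum P Φ fun i => ∀ j, P.root j ≠ (2 : ℝ) • P.root i := rfl

/-- On the R₀-root of a simple ray, ρ pairs to 1 and x to a positive number, so the integer pairing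
of x - ρ exceeds -1. This is where the choice of R₀ in the definition of ρ enters: its coroots are
the shortest on their rays. -/
theorem dominant_sub_rho [Finite ι] [P.IsCrystallographic] (hP : IsEuclidean P)
    (hΦ : IsPositiveSystem P Φ) {x : E} (hx : ∀ i ∈ Φ, 0 < inner ℝ x (P.root i))
    (hi : x - rho P Φ ∈ weightLattice P) :
    ∀ i ∈ Φ, ∃ n : ℕ, inner ℝ (x - rho P Φ) (P.coroot i) = n := by
  have hq := isRootChoice_zero hP
  have key : ∀ i ∈ Φ, 0 ≤ inner ℝ (x - rho P Φ) (P.root i) := by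
    refine inner_nonneg_of_simple hΦ fun a ha => ?_
    obtain ⟨b, hb, t, ht, hab⟩ := hq.exists_smul a
    rw [← inner_coroot_nonneg_iff hP, ← inner_coroot_of_root_eq_smul hP hab]
    refine mul_nonneg ht.le ?_
    have h1 := inner_halfSum_simple hP hΦ hq ha hb ht hab
    rw [← rho_eq] at h1
    obtain ⟨z, hz⟩ := hi b
    have h2 := (inner_coroot_pos_iff hP _ _).2 (hx b (mem_of_root_eq_smul hΦ ha.1 ht hab))
    rw [hz]
    rw [inner_sub_left, h1] at hz
    have : (-1 : ℝ) < z := by linarith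
    have : -1 < z := by exact_mod_cast this
    exact_mod_cast (by omega : 0 ≤ z)
  intro i hiΦ
  obtain ⟨z, hz⟩ := hi i
  have h := (inner_coroot_nonneg_iff hP _ _).2 (key i hiΦ)
  rw [hz] at h ⊢
  have h' : 0 ≤ z := by exact_mod_cast h
  exact ⟨z.toNat, by exact_mod_cast congrArg (Int.cast (R := ℝ)) (Int.toNat_of_nonneg h').symm⟩

theorem simple_indivisible (hΦ : IsPositiveSystem P Φ) {a : ι} (ha : IsSimple P Φ a) (j : ι) :
    P.root j ≠ (1 / 2 : ℝ) • P.root a := fun h => by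
  have hj : j ∈ Φ := mem_of_root_eq_smul hΦ ha.1 (by norm_num) h
  refine ha.2 j hj j hj ?_
  rw [h]
  module

/-- The exponents `κ ∈ ρ + 𝒫` whose Weyl orbit lies below `ρ + μ`. -/
def expSet (P : RootPairing ι ℝ E E) (Φ : Finset ι) (mu : E) : Set E :=
  {x | x - rho P Φ ∈ weightLattice P ∧ ∀ w : weyl P, rho P Φ + mu - w.1 x ∈ posCone P Φ}

theorem weyl_mem_expSet [P.IsCrystallographic] (hP : IsEuclidean P) (hΦ : IsPositiveSystem P Φ)
    {mu x : E} (hx : x ∈ expSet P Φ mu) (w : weyl P) : w.1 x ∈ expSet P Φ mu := by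
  refine ⟨?_, fun u => ?_⟩
  · have h1 := posCone_le_weightLattice hP (halfSum_sub_weyl_mem hΦ (isRootChoice_zero hP) w)
    have h2 := sub_mem (weyl_mem_weightLattice hP w hx.1) h1
    rw [← rho_eq, map_sub] at h2
    convert h2 using 1
    abel
  · exact hx.2 (u * w)

/-- The truncated exponents belong to `expSet`. -/
theorem sub_weyl_truncated_mem [Finite ι] [P.IsCrystallographic] [P.IsRootSystem]
    (hP : IsEuclidean P) (hΦ : IsPositiveSystem P Φ) (lam : DomWeight P Φ) {M : ℕ}
    (hM : ∀ i ∈ Φ, (M : ℝ) ≤ inner ℝ lam.1 (P.coroot i)) {n : ι → ℕ}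
    (hn : ∀ i ∈ posRoots1 P Φ, n i ≤ M) (w : weyl P) :
    ∃ y ∈ posCone P Φ, rho P Φ + lam.1 -
      w.1 (rho P Φ + lam.1 - ∑ i ∈ posRoots1 P Φ, (n i : ℝ) • P.root i) =
        (rho P Φ - w.1 (rho P Φ)) + y := by
  have hq := isRootChoice_one hP
  let r1 := halfSum P Φ fun i => ∀ j, P.root j ≠ (1 / 2 : ℝ) • P.root i
  -- λ - Mρ₁ is dominant: ρ₁ pairs to 1 with every simple coroot, and M does not exceed the pairings
  -- of λ.
  have hx : ∀ i ∈ posPart Φ fun i => ∀ j, P.root j ≠ (1 / 2 : ℝ) • P.root i,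
      ∃ n : ℕ, inner ℝ (lam.1 - (M : ℝ) • r1) (P.coroot i) = n := by
    have hnn : ∀ i ∈ Φ, 0 ≤ inner ℝ (lam.1 - (M : ℝ) • r1) (P.root i) := by
      refine inner_nonneg_of_simple hΦ fun a ha => ?_
      rw [← inner_coroot_nonneg_iff hP, inner_sub_left, real_inner_smul_left,
        inner_halfSum_simple hP hΦ hq ha (simple_indivisible hΦ ha) one_pos (one_smul ℝ _).symm]
      linarith [hM a ha.1]
    intro i hi
    obtain ⟨k, hk⟩ := lam.2 i (mem_posPart.1 hi).1
    obtain ⟨z, hz⟩ := exists_int_inner_halfSum hP hΦ hq (fun a ha => simple_indivisible hΦ ha) i hi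
    have h := (inner_coroot_nonneg_iff hP _ _).2 (hnn i (mem_posPart.1 hi).1)
    rw [inner_sub_left, real_inner_smul_left, hk, hz] at h ⊢
    have h' : 0 ≤ (k : ℤ) - M * z := by exact_mod_cast h
    refine ⟨((k : ℤ) - M * z).toNat, ?_⟩
    have e := congrArg (Int.cast (R := ℝ)) (Int.toNat_of_nonneg h')
    push_cast at e
    exact e.symm
  have h1 := sub_weyl_mem_posCone hP hΦ hq hx w
  -- The rest of the exponent, apart from ρ, is a point of the Weyl-invariant zonotope. The bound n
  -- ≤ M is what keeps it there.
  have hz : (M : ℝ) • r1 - ∑ i ∈ posRoots1 P Φ, (n i : ℝ) • P.root i ∈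
    zonotope P Φ (fun i => ∀ j, P.root j ≠ (1 / 2 : ℝ) • P.root i) M := ⟨n, hn, rfl⟩
  have h2 := sub_mem_of_zonotope (weyl_zonotope hΦ hq w hz)
  refine ⟨_, add_mem h1 h2, ?_⟩
  simp only [map_sub, map_add]
  change _ = _ + ((_ - (_ - _)) + ((M : ℝ) • r1 - _))
  abel

theorem truncated_mem_expSet [Finite ι] [P.IsCrystallographic] [P.IsRootSystem]
    (hP : IsEuclidean P) (hΦ : IsPositiveSystem P Φ) (lam : DomWeight P Φ) {M : ℕ}
    (hM : ∀ i ∈ Φ, (M : ℝ) ≤ inner ℝ lam.1 (P.coroot i)) {n : ι → ℕ}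
    (hn : ∀ i ∈ posRoots1 P Φ, n i ≤ M) :
    rho P Φ + lam.1 - ∑ i ∈ posRoots1 P Φ, (n i : ℝ) • P.root i ∈ expSet P Φ lam.1 := by
  refine ⟨?_, fun w => ?_⟩
  · have h1 := domWeight_mem_weightLattice hP hΦ lam
    have h2 := posCone_le_weightLattice (Φ := Φ) hP
      (sum_mem_posCone (P := P) (posRoots1 P Φ) posPart_subset n)
    convert sub_mem h1 h2 using 1
    abel
  · obtain ⟨y, hy, h⟩ := sub_weyl_truncated_mem hP hΦ lam hM hn w
    rw [h]
    exact add_mem (halfSum_sub_weyl_mem hΦ (isRootChoice_zero hP) w) hy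

/-- Both ρ - wρ and the remaining part lie in a pointed cone. If they sum to 0 then wρ = ρ, which
forces w = 1 because ρ is regular. -/
theorem weyl_truncated_ne [Finite ι] [P.IsCrystallographic] [P.IsRootSystem]
    (hP : IsEuclidean P) (hΦ : IsPositiveSystem P Φ) (lam : DomWeight P Φ) {M : ℕ}
    (hM : ∀ i ∈ Φ, (M : ℝ) ≤ inner ℝ lam.1 (P.coroot i)) {n : ι → ℕ}
    (hn : ∀ i ∈ posRoots1 P Φ, n i ≤ M) {w : weyl P} (hw : w ≠ 1) :
    rho P Φ + lam.1 -
      w.1 (rho P Φ + lam.1 - ∑ i ∈ posRoots1 P Φ, (n i : ℝ) • P.root i) ≠ 0 := by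
  obtain ⟨y, hy, h⟩ := sub_weyl_truncated_mem hP hΦ lam hM hn w
  rw [h]
  intro h0
  have h1 := halfSum_sub_weyl_mem hΦ (isRootChoice_zero hP) w
  rw [← rho_eq] at h1
  have h2 := posCone_antisymm hΦ h1 (by rwa [neg_eq_of_add_eq_zero_right h0])
  exact hw (halfSum_weyl_eq hP hΦ (isRootChoice_zero hP) w (sub_eq_zero.1 h2).symm)

end HalfSums

/-! ### Signs, plane waves and antisymmetry of the Weyl denominator. -/

section Signs

variable {ι E : Type*} [NormedAddCommGroup E] [InnerProductSpace ℝ E]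
  {P : RootPairing ι ℝ E E} {Φ : Finset ι}

theorem sgn_one : sgn P 1 = 1 := by
  simp [sgn]

theorem sgn_mul (w u : weyl P) : sgn P (w * u) = sgn P w * sgn P u := by
  simp [sgn]

theorem sgn_simpleRefl [FiniteDimensional ℝ E] (hP : IsEuclidean P) (i : ι) :
    sgn P (simpleRefl P i) = -1 := by
  have h : ((simpleRefl P i).1 : E →ₗ[ℝ] E) =
      ((ℝ ∙ P.root i)ᗮ.reflection.toLinearEquiv : E →ₗ[ℝ] E) := by
    ext x
    change P.reflection i x = (ℝ ∙ P.root i)ᗮ.reflection x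
    rw [Submodule.reflection_orthogonal_apply, Submodule.reflection_singleton_apply,
      reflection_eq hP, inner_coroot hP, real_inner_self_eq_norm_sq, real_inner_comm]
    simp only [RCLike.ofReal_real_eq_id, id]
    rw [mul_div_assoc, two_mul, two_smul, add_smul]
    abel
  have h2 := (ℝ ∙ P.root i)ᗮ.det_reflection
  rw [Submodule.orthogonal_orthogonal, finrank_span_singleton (P.ne_zero i)] at h2
  rw [sgn, h]
  have e : ((ℝ ∙ P.root i)ᗮ.reflection.toLinearEquiv : E →ₗ[ℝ] E) =
    (ℝ ∙ P.root i)ᗮ.reflection.toLinearMap := rfl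
  rw [e, h2]
  simp

theorem sgn_mul_self [FiniteDimensional ℝ E] (hP : IsEuclidean P) (w : weyl P) :
    sgn P w * sgn P w = 1 := by
  induction w using weyl_induction with
  | one => simp [sgn_one]
  | mul i w ih =>
    rw [sgn_mul, sgn_simpleRefl hP, mul_mul_mul_comm, ih]
    norm_num

theorem sgn_inv [FiniteDimensional ℝ E] (hP : IsEuclidean P) (w : weyl P) :
    sgn P w⁻¹ = sgn P w := by
  have h1 : sgn P w⁻¹ * sgn P w = 1 := by rw [← sgn_mul, inv_mul_cancel, sgn_one]
  calc sgn P w⁻¹ = sgn P w⁻¹ * (sgn P w * sgn P w) := by rw [sgn_mul_self hP, mul_one]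
    _ = sgn P w := by rw [← mul_assoc, h1, one_mul]

theorem norm_sgn [FiniteDimensional ℝ E] (hP : IsEuclidean P) (w : weyl P) : ‖sgn P w‖ = 1 := by
  have := congrArg norm (sgn_mul_self hP w)
  rw [norm_mul, norm_one] at this
  nlinarith [norm_nonneg (sgn P w)]

theorem conj_sgn (w : weyl P) : (starRingEnd ℂ) (sgn P w) = sgn P w := Complex.conj_ofReal _

/-! ### Plane waves -/

theorem planeWave_add (x y xi : E) : planeWave (x + y) xi = planeWave x xi * planeWave y xi := by
  rw [planeWave, planeWave, planeWave, ← Complex.exp_add, inner_add_left]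
  push_cast
  ring_nf

theorem planeWave_zero (xi : E) : planeWave 0 xi = 1 := by simp [planeWave]

theorem planeWave_add_right (x xi t : E) :
    planeWave x (xi + t) = planeWave x xi * planeWave x t := by
  rw [planeWave, planeWave, planeWave, ← Complex.exp_add, inner_add_right]
  push_cast
  ring_nf

theorem norm_planeWave (x xi : E) : ‖planeWave x xi‖ = 1 := by
  rw [planeWave, mul_comm, Complex.norm_exp_ofReal_mul_I]

theorem conj_planeWave (x xi : E) : (starRingEnd ℂ) (planeWave x xi) = planeWave (-x) xi := by
  rw [planeWave, planeWave, ← Complex.exp_conj, inner_neg_left]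
  simp

theorem planeWave_neg_right (x xi : E) : planeWave x (-xi) = planeWave (-x) xi := by
  rw [planeWave, planeWave, inner_neg_left, inner_neg_right]

theorem planeWave_weyl (hP : IsEuclidean P) (w : weyl P) (x xi : E) :
    planeWave x (w.1 xi) = planeWave ((w⁻¹).1 x) xi := by
  rw [planeWave, planeWave, inner_weyl_right hP]

theorem continuous_planeWave (x : E) : Continuous (planeWave x) := by
  unfold planeWave
  fun_prop

/-! ### The Weyl denominator is antisymmetric -/

/-- The factors are odd in the root, so the reflection in j permutes them up to signs. The R₀-root b
on the line of j contributes -1; the other signs cancel in pairs under the involution `flipIdx`. -/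
theorem weylDenom_reflection [FiniteDimensional ℝ E] [P.IsCrystallographic]
    (hP : IsEuclidean P) (hΦ : IsPositiveSystem P Φ) (j : ι) (xi : E) :
    weylDenom P Φ (P.reflection j xi) = -weylDenom P Φ xi := by
  classical
  have hq := isRootChoice_zero hP
  let H : E → ℂ := fun x => planeWave ((1 / 2 : ℝ) • x) xi - planeWave (-(1 / 2 : ℝ) • x) xi
  have hH : ∀ x, H (-x) = -H x := by
    intro x
    simp only [H, smul_neg, neg_smul, neg_neg, neg_sub]
  let e : ι → ℂ := fun i => if P.reflectionPerm j i ∈ Φ then 1 else -1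
  have h1 : weylDenom P Φ (P.reflection j xi) =
      ∏ i ∈ posRoots0 P Φ, e i * H (P.root (flipIdx P Φ j i)) := by
    refine Finset.prod_congr rfl fun i hi => ?_
    have h := planeWave_weyl hP (simpleRefl P j)
    simp only [simpleRefl_apply, simpleRefl_inv] at h
    rw [h, h, map_smul, map_smul, ← P.root_reflectionPerm]
    change H _ = _
    by_cases hm : P.reflectionPerm j i ∈ Φ
    · have e1 : flipIdx P Φ j i = P.reflectionPerm j i := if_pos hm
      simp only [e, if_pos hm, e1, one_mul]
    · have e1 : flipIdx P Φ j i = negIdx P (P.reflectionPerm j i) := if_neg hm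
      simp only [e, if_neg hm, e1, root_negIdx, hH]
      ring
  have hmem : ∀ i ∈ posRoots0 P Φ, flipIdx P Φ j i ∈ posRoots0 P Φ := fun i hi =>
    mem_posPart.2 ⟨flipIdx_mem hΦ j i, hq.flipIdx j (mem_posPart.1 hi).2⟩
  have h2 : ∏ i ∈ posRoots0 P Φ, H (P.root (flipIdx P Φ j i)) = weylDenom P Φ xi :=
    Finset.prod_nbij' (flipIdx P Φ j) (flipIdx P Φ j) hmem hmem
      (fun i hi => flipIdx_flipIdx hΦ j (mem_posPart.1 hi).1)
      (fun i hi => flipIdx_flipIdx hΦ j (mem_posPart.1 hi).1) (fun _ _ => rfl)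
  obtain ⟨b, hb, t, ht, hbt⟩ : ∃ b ∈ posRoots0 P Φ, ∃ t : ℝ, t ≠ 0 ∧
      P.root b = t • P.root j := by
    obtain ⟨b, hb, t, ht, hbt⟩ := hq.exists_smul j
    by_cases hbΦ : b ∈ Φ
    · exact ⟨b, mem_posPart.2 ⟨hbΦ, hb⟩, t, ht.ne', hbt⟩
    · refine ⟨negIdx P b, mem_posPart.2 ⟨(negIdx_mem_iff hΦ b).2 hbΦ, hq.neg hb⟩, -t,
        neg_ne_zero.2 ht.ne', ?_⟩
      rw [root_negIdx, hbt, neg_smul]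
  have h3 : ∏ i ∈ posRoots0 P Φ, e i = -1 := by
    rw [← Finset.mul_prod_erase _ _ hb]
    have hnb : P.reflectionPerm j b = negIdx P b := by
      apply P.root.injective
      rw [root_negIdx, P.root_reflectionPerm, hbt, map_smul, reflection_self, smul_neg]
    have heb : e b = -1 := if_neg fun h => by
      rw [hnb] at h
      exact (negIdx_mem_iff hΦ b).1 h (mem_posPart.1 hb).1
    have hfb : flipIdx P Φ j b = b := by
      have : flipIdx P Φ j b = negIdx P (P.reflectionPerm j b) := if_neg fun h => by
        rw [hnb] at h
        exact (negIdx_mem_iff hΦ b).1 h (mem_posPart.1 hb).1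
      rw [this, hnb, negIdx_negIdx]
    rw [heb, Finset.prod_involution (fun i _ => flipIdx P Φ j i), mul_one]
    · intro i hi
      have hi' := (mem_posPart.1 (Finset.mem_of_mem_erase hi)).1
      have := reflectionPerm_flipIdx_mem_iff hΦ j hi'
      by_cases h : P.reflectionPerm j i ∈ Φ
      · simp [e, h, this]
      · simp [e, h, this]
    -- A fixed point of the involution with sign -1 satisfies s_j α = -α, so it is proportional to j
    -- and must be b, which has been removed.
    · intro i hi hei hfix
      have h : P.reflectionPerm j i ∉ Φ := fun h => hei (if_pos h)
      have e1 : flipIdx P Φ j i = negIdx P (P.reflectionPerm j i) := if_neg h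
      rw [e1] at hfix
      have h4 := congrArg P.root hfix
      rw [root_negIdx, P.root_reflectionPerm, reflection_eq hP, neg_sub, sub_eq_iff_eq_add] at h4
      have h5 : P.root i = (inner ℝ (P.root i) (P.coroot j) / (2 * t)) • P.root b := by
        have h6 : (inner ℝ (P.root i) (P.coroot j) / (2 * t)) • P.root b =
            (1 / 2 : ℝ) • (inner ℝ (P.root i) (P.coroot j) • P.root j) := by
          rw [hbt, smul_smul, smul_smul]
          congr 1
          field_simp
        rw [h6, h4]
        module
      have hi' := mem_posPart.1 (Finset.mem_of_mem_erase hi)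
      have hb' := mem_posPart.1 hb
      exact Finset.ne_of_mem_erase hi
        (hq.eq_of_smul b i hb'.2 hi'.2 _ (pos_of_root_eq_smul hΦ hb'.1 hi'.1 h5) h5)
    · intro i hi
      refine Finset.mem_erase.2 ⟨fun h => ?_, hmem i (Finset.mem_of_mem_erase hi)⟩
      apply Finset.ne_of_mem_erase hi
      have := flipIdx_flipIdx hΦ j (mem_posPart.1 (Finset.mem_of_mem_erase hi)).1
      rw [← this, h, hfb]
    · intro i hi
      exact flipIdx_flipIdx hΦ j (mem_posPart.1 (Finset.mem_of_mem_erase hi)).1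
  rw [h1, Finset.prod_mul_distrib, h2, h3, neg_one_mul]

theorem weylDenom_weyl [FiniteDimensional ℝ E] [P.IsCrystallographic]
    (hP : IsEuclidean P) (hΦ : IsPositiveSystem P Φ) (w : weyl P) (xi : E) :
    weylDenom P Φ (w.1 xi) = sgn P w * weylDenom P Φ xi := by
  induction w using weyl_induction with
  | one => rw [sgn_one, one_mul, weyl_one_apply]
  | mul i w ih =>
    rw [weyl_mul_apply, simpleRefl_apply, weylDenom_reflection hP hΦ, ih, sgn_mul,
      sgn_simpleRefl hP]
    ring

end Signs

/-! ### The lattice 2π𝒬^∨ and the star around the origin. -/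

section Lattice

variable {ι E : Type*} [NormedAddCommGroup E] [InnerProductSpace ℝ E]
  {P : RootPairing ι ℝ E E} {Φ : Finset ι}

/-- The union of the closures of the alcoves at the origin (up to a null set). -/
def weylStar (P : RootPairing ι ℝ E E) : Set E :=
  {xi | ∀ i, |inner ℝ xi (P.root i)| < 2 * Real.pi}

theorem weyl_mem_star (hP : IsEuclidean P) (w : weyl P) {xi : E} (h : xi ∈ weylStar P) :
    w.1 xi ∈ weylStar P := fun i => by
  obtain ⟨j, hj⟩ := exists_root_eq_weyl w⁻¹ i
  rw [inner_weyl_left hP, ← hj]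
  exact h j

theorem eq_zero_of_inner_root [P.IsRootSystem] {x : E} (h : ∀ i, inner ℝ x (P.root i) = 0) :
    x = 0 := by
  have hx : x ∈ Submodule.span ℝ (Set.range P.root) := by
    rw [RootPairing.IsRootSystem.span_root_eq_top]; trivial
  have : ∀ y ∈ Submodule.span ℝ (Set.range P.root), inner ℝ x y = 0 := by
    intro y hy
    induction hy using Submodule.span_induction with
    | mem y hy => obtain ⟨i, rfl⟩ := hy; exact h i
    | zero => exact inner_zero_right _
    | add y z _ _ hy hz => rw [inner_add_right, hy, hz, add_zero]
    | smul r y _ hy => rw [real_inner_smul_right, hy, mul_zero]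
  exact inner_self_eq_zero.1 (this x hx)

/-- A nonzero sum `q` of coroots satisfies `⟨η, q⟩ < π |q|²` for all `η` in the star: `2 π q`
cannot translate `η` closer to the origin. -/
theorem inner_lt_of_mem_star [P.IsCrystallographic] (hP : IsEuclidean P) (n : ℕ) :
    ∀ s : Multiset ι, s.card = n → ∀ eta ∈ weylStar P, (s.map P.coroot).sum ≠ 0 →
      inner ℝ eta (s.map P.coroot).sum <
        Real.pi * inner ℝ (s.map P.coroot).sum (s.map P.coroot).sum := by
  classical
  induction n with
  | zero =>
    intro s hs eta _ h
    rw [Multiset.card_eq_zero.1 hs] at h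
    simp at h
  | succ n ih =>
    intro s hs eta heta hq
    set q := (s.map P.coroot).sum with hqdef
    -- |q|² is the sum of the pairings of q with the coroots composing it, so one of these is
    -- positive.
    obtain ⟨j, hj, hjpos⟩ : ∃ j ∈ s, 0 < inner ℝ q (P.coroot j) := by
      by_contra! hneg
      have h1 : inner ℝ q q = (s.map fun j => inner ℝ q (P.coroot j)).sum := by
        have := map_multiset_sum (innerSL ℝ q) (s.map P.coroot)
        rw [Multiset.map_map] at this
        exact this
      have h2 : (s.map fun j => inner ℝ q (P.coroot j)).sum ≤ 0 := by
        have h3 := Multiset.sum_map_le_sum_map (s := s) (fun j => inner ℝ q (P.coroot j))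
          (fun _ => (0 : ℝ)) hneg
        simpa using h3
      rw [← h1] at h2
      exact hq (inner_self_eq_zero.1 (le_antisymm h2 real_inner_self_nonneg))
    obtain ⟨c, hc⟩ : ∃ c : ℤ, inner ℝ q (P.root j) = c := by
      rw [hqdef]
      clear_value q
      clear hq hjpos hqdef hs ih hj
      induction s using Multiset.induction with
      | empty => exact ⟨0, by simp⟩
      | cons a s ih =>
        obtain ⟨c, hc⟩ := ih
        obtain ⟨z, hz⟩ := exists_int_pairing hP j a
        refine ⟨z + c, ?_⟩
        rw [Multiset.map_cons, Multiset.sum_cons, inner_add_left, hc, real_inner_comm, hz]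
        push_cast
        rfl
    have hcpos : 0 < c := by
      have := (inner_coroot_pos_iff hP q j).1 hjpos
      rw [hc] at this
      exact_mod_cast this
    set s' := s.erase j
    have hs' : s'.card = n := by
      rw [Multiset.card_erase_of_mem hj, hs]; rfl
    have hqs : (s'.map P.coroot).sum = q - P.coroot j := by
      rw [hqdef, ← Multiset.cons_erase hj, Multiset.map_cons, Multiset.sum_cons]
      abel
    have hA := inner_root_self_pos P j
    set A := inner ℝ (P.root j) (P.root j) with hAdef
    have hcc := hP.coroot_eq j
    rw [← hAdef] at hcc
    have hqc : inner ℝ q (P.coroot j) = 2 * c / A := by rw [inner_coroot hP, hc]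
    -- If c = 1, removing the coroot j from q is the same as reflecting q in j: the norm is kept,
    -- and η is reflected within the star. If c ≥ 2, the removal lowers π|q|² by at least 4π/A,
    -- which covers the loss ⟨η, α_j^∨⟩ < 4π/A.
    rcases (by omega : c = 1 ∨ 2 ≤ c) with rfl | hc2
    · have hr : P.reflection j q = q - P.coroot j := by
        rw [reflection_eq hP, hqc, hcc]
        simp
      have h0 : (s'.map P.coroot).sum ≠ 0 := by
        rw [hqs, ← hr]
        exact fun h => hq ((map_eq_zero_iff _ (P.reflection j).injective).1 h)
      have h1 := ih s' hs' _ (weyl_mem_star hP (simpleRefl P j) heta) h0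
      rw [hqs, ← hr, simpleRefl_apply, inner_reflection hP, inner_reflection hP] at h1
      exact h1
    · have h1 : inner ℝ eta (q - P.coroot j) ≤
          Real.pi * inner ℝ (q - P.coroot j) (q - P.coroot j) := by
        by_cases h0 : (s'.map P.coroot).sum = 0
        · rw [hqs] at h0
          simp [h0]
        · have := ih s' hs' eta heta h0
          rw [hqs] at this
          exact this.le
      have h2 : inner ℝ eta (P.coroot j) < 4 * Real.pi / A := by
        rw [inner_coroot hP, ← hAdef]
        rw [div_lt_div_iff_of_pos_right hA]
        linarith [(abs_lt.1 (heta j)).2]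
      have h3 : inner ℝ (P.coroot j) (P.coroot j) = 4 / A := by
        rw [hcc, real_inner_smul_left, real_inner_smul_right, ← hAdef]
        field_simp
        norm_num
      have h4 : inner ℝ (q - P.coroot j) (q - P.coroot j) =
          inner ℝ q q - 4 / A * (c - 1) := by
        rw [real_inner_sub_sub_self, hqc, h3]
        ring
      rw [h4, inner_sub_right] at h1
      have h5 : (2 : ℝ) ≤ c := by exact_mod_cast hc2
      have h6 : 4 * Real.pi / A ≤ Real.pi * (4 / A * (c - 1)) := by
        have : 0 ≤ 4 * Real.pi / A * (c - 2) :=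
          mul_nonneg (by positivity) (by linarith)
        have e : Real.pi * (4 / A * (c - 1)) = 4 * Real.pi / A + 4 * Real.pi / A * (c - 2) := by
          ring
        linarith
      linarith

/-- The lattice `2 π 𝒬^∨`. -/
def corootLattice (P : RootPairing ι ℝ E E) : AddSubgroup E :=
  AddSubgroup.closure (Set.range fun i => (2 * Real.pi) • P.coroot i)

/-- No signs are needed, as the negative of a coroot is a coroot. -/
theorem exists_multiset_of_mem (hP : IsEuclidean P) {l : E} (hl : l ∈ corootLattice P) :
    ∃ s : Multiset ι, l = (2 * Real.pi) • (s.map P.coroot).sum := by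
  induction hl using AddSubgroup.closure_induction with
  | mem x hx =>
    obtain ⟨i, rfl⟩ := hx
    exact ⟨{i}, by simp⟩
  | zero => exact ⟨0, by simp⟩
  | add x y _ _ hx hy =>
    obtain ⟨s, rfl⟩ := hx
    obtain ⟨t, rfl⟩ := hy
    exact ⟨s + t, by simp [smul_add]⟩
  | neg x _ hx =>
    obtain ⟨s, rfl⟩ := hx
    refine ⟨s.map (negIdx P), ?_⟩
    rw [Multiset.map_map, ← smul_neg, ← Multiset.sum_map_neg']
    congr 2
    rw [Multiset.map_map]
    refine Multiset.map_congr rfl fun i _ => ?_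
    simp [coroot_negIdx hP]

theorem exists_int_inner_lattice {l : E}
    (hl : l ∈ corootLattice P) {x : E} (hx : x ∈ weightLattice P) :
    ∃ z : ℤ, inner ℝ x l = z * (2 * Real.pi) := by
  induction hl using AddSubgroup.closure_induction with
  | mem y hy =>
    obtain ⟨i, rfl⟩ := hy
    obtain ⟨z, hz⟩ := hx i
    exact ⟨z, by simp only [real_inner_smul_right, hz]; ring⟩
  | zero => exact ⟨0, by simp⟩
  | add y z _ _ hy hz =>
    obtain ⟨a, ha⟩ := hy
    obtain ⟨b, hb⟩ := hz
    exact ⟨a + b, by rw [inner_add_right, ha, hb]; push_cast; ring⟩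
  | neg y _ hy =>
    obtain ⟨a, ha⟩ := hy
    exact ⟨-a, by rw [inner_neg_right, ha]; push_cast; ring⟩

theorem root_mem_weightLattice [P.IsCrystallographic] (hP : IsEuclidean P) (i : ι) :
    P.root i ∈ weightLattice P := exists_int_pairing hP i

theorem planeWave_add_lattice {l : E}
    (hl : l ∈ corootLattice P) {x : E} (hx : x ∈ weightLattice P) (xi : E) :
    planeWave x (l + xi) = planeWave x xi := by
  obtain ⟨z, hz⟩ := exists_int_inner_lattice hl hx
  rw [add_comm, planeWave_add_right]
  have : planeWave x l = 1 := by
    rw [planeWave, hz, Complex.exp_eq_one_iff]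
    exact ⟨z, by push_cast; ring⟩
  rw [this, mul_one]

/-- With l = 2πq, the inequality for the star at l + x with q and at x with -q adds up to 2π|q|² <
2π|q|². -/
theorem disjoint_star [P.IsCrystallographic] (hP : IsEuclidean P) {l : E}
    (hl : l ∈ corootLattice P) {x : E} (hx : x ∈ weylStar P) (hlx : l + x ∈ weylStar P) : l = 0 := by
  by_contra h
  obtain ⟨s, hs⟩ := exists_multiset_of_mem hP hl
  obtain ⟨t, ht⟩ := exists_multiset_of_mem hP (neg_mem hl)
  set q := (s.map P.coroot).sum
  have hpi := Real.pi_pos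
  have htq : (t.map P.coroot).sum = -q := by
    rw [hs, ← smul_neg] at ht
    exact (smul_right_injective E (by positivity : (2 * Real.pi) ≠ 0) ht).symm
  have hq : q ≠ 0 := fun h0 => h (by rw [hs, h0, smul_zero])
  have h1 := inner_lt_of_mem_star hP _ s rfl _ hlx hq
  have h2 := inner_lt_of_mem_star hP _ t rfl _ hx (by rw [htq]; exact neg_ne_zero.2 hq)
  rw [htq, inner_neg_neg, inner_neg_right] at h2
  change inner ℝ (l + x) q < Real.pi * inner ℝ q q at h1
  rw [inner_add_left, hs, real_inner_smul_left] at h1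
  linarith

/-- The pairings with the roots, divided by 2π, are bounded integers and determine the lattice
vector. -/
theorem lattice_finite [Finite ι] [P.IsRootSystem] [P.IsCrystallographic] (hP : IsEuclidean P)
    (r : ℝ) : {l | l ∈ corootLattice P ∧ ‖l‖ ≤ r}.Finite := by
  choose! z hz using fun (l : E) (hl : l ∈ corootLattice P) (i : ι) =>
    exists_int_inner_lattice hl (root_mem_weightLattice hP i)
  have hpi := Real.pi_pos
  refine Set.Finite.of_injOn (f := z)
    (t := {f | ∀ i, f i ∈ Set.Icc (-⌈‖P.root i‖ * r⌉) ⌈‖P.root i‖ * r⌉}) ?_ ?_ ?_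
  · rintro l ⟨hl, hlr⟩ i
    have h1 := abs_real_inner_le_norm (P.root i) l
    rw [hz l hl i, abs_mul, abs_of_pos (by positivity : 0 < 2 * Real.pi)] at h1
    have h2 : ‖P.root i‖ * ‖l‖ ≤ ‖P.root i‖ * r := by gcongr
    have h3 : |(z l i : ℝ)| ≤ |(z l i : ℝ)| * (2 * Real.pi) :=
      le_mul_of_one_le_right (abs_nonneg _) (by linarith [Real.pi_gt_three])
    have h4 : |(z l i : ℝ)| ≤ ⌈‖P.root i‖ * r⌉ := by linarith [Int.le_ceil (‖P.root i‖ * r)]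
    exact abs_le.1 (by exact_mod_cast h4)
  · rintro l ⟨hl, -⟩ l' ⟨hl', -⟩ h
    rw [← sub_eq_zero]
    apply eq_zero_of_inner_root (P := P)
    intro i
    rw [real_inner_comm, inner_sub_right, hz l hl, hz l' hl', h, sub_self]
  · exact Set.Finite.pi' fun i => Set.finite_Icc _ _

theorem countable_corootLattice [Finite ι] [P.IsRootSystem] [P.IsCrystallographic]
    (hP : IsEuclidean P) : Countable (corootLattice P) := by
  have : (corootLattice P : Set E) =
      ⋃ n : ℕ, {l | l ∈ corootLattice P ∧ ‖l‖ ≤ n} := by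
    ext l
    simp only [SetLike.mem_coe, Set.mem_iUnion, Set.mem_ofPred_eq, exists_and_left]
    exact ⟨fun h => ⟨h, exists_nat_ge _⟩, fun h => h.1⟩
  have h : (corootLattice P : Set E).Countable := by
    rw [this]
    exact Set.countable_iUnion fun n => (lattice_finite hP n).countable
  exact h.to_subtype

/-- A shortest representative works: that translation by -2πα^∨ does not shorten it says precisely
that its pairing with α is at most 2π. -/
theorem exists_translate_le [Finite ι] [P.IsRootSystem] [P.IsCrystallographic]
    (hP : IsEuclidean P) (xi : E) :
    ∃ l ∈ corootLattice P, ∀ i, |inner ℝ (l + xi) (P.root i)| ≤ 2 * Real.pi := by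
  have hfin : {l | l ∈ corootLattice P ∧ ‖l + xi‖ ≤ ‖xi‖}.Finite := by
    refine (lattice_finite hP (2 * ‖xi‖)).subset fun l hl => ⟨hl.1, ?_⟩
    have : ‖l‖ ≤ ‖l + xi‖ + ‖xi‖ := by simpa using norm_sub_le (l + xi) xi
    linarith [hl.2]
  obtain ⟨l, ⟨hl, hlx⟩, hmin⟩ := Set.exists_min_image _ (fun l => ‖l + xi‖) hfin
    ⟨0, zero_mem _, by simp⟩
  have hmin' : ∀ l' ∈ corootLattice P, ‖l + xi‖ ≤ ‖l' + xi‖ := by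
    intro l' hl'
    by_cases h : ‖l' + xi‖ ≤ ‖xi‖
    · exact hmin l' ⟨hl', h⟩
    · linarith
  have key : ∀ i, inner ℝ (l + xi) (P.root i) ≤ 2 * Real.pi := by
    intro i
    have hA := inner_root_self_pos P i
    have h1 := hmin' (l - (2 * Real.pi) • P.coroot i)
      (sub_mem hl (AddSubgroup.subset_closure ⟨i, rfl⟩))
    have h2 := pow_le_pow_left₀ (norm_nonneg _) h1 2
    rw [← real_inner_self_eq_norm_sq, ← real_inner_self_eq_norm_sq,
      show l - (2 * Real.pi) • P.coroot i + xi = (l + xi) - (2 * Real.pi) • P.coroot i by abel,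
      real_inner_sub_sub_self, real_inner_smul_right, real_inner_smul_right, real_inner_smul_left,
      inner_coroot hP, hP.coroot_eq, real_inner_smul_left, real_inner_smul_right] at h2
    have hpi := Real.pi_pos
    set A := inner ℝ (P.root i) (P.root i)
    set y := inner ℝ (l + xi) (P.root i)
    have h3 : 0 ≤ (8 * Real.pi / A) * (2 * Real.pi - y) := by
      have e : (8 * Real.pi / A) * (2 * Real.pi - y) = -(2 * (2 * Real.pi * (2 * y / A))) +
          2 * Real.pi * (2 * Real.pi * (2 / A * (2 / A * A))) := by
        field_simp
        ring
      rw [e]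
      linarith
    have h4 : 0 < 8 * Real.pi / A := by positivity
    have := nonneg_of_mul_nonneg_right h3 h4
    linarith
  refine ⟨l, hl, fun i => abs_le.2 ⟨?_, key i⟩⟩
  have := key (negIdx P i)
  rw [root_negIdx, inner_neg_right] at this
  linarith

end Lattice

/-! ### Openness and boundedness of the star and the alcove. -/

section Topology

variable {ι E : Type*} [NormedAddCommGroup E] [InnerProductSpace ℝ E]
  {P : RootPairing ι ℝ E E} {Φ : Finset ι}

theorem isOpen_weylStar [Finite ι] (P : RootPairing ι ℝ E E) : IsOpen (weylStar P) := by
  have : weylStar P = ⋂ i, {xi | |inner ℝ xi (P.root i)| < 2 * Real.pi} := by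
    ext; simp [weylStar]
  rw [this]
  exact isOpen_iInter_of_finite fun i => isOpen_lt (by fun_prop) continuous_const

theorem isOpen_alcove (P : RootPairing ι ℝ E E) (Φ : Finset ι) : IsOpen (alcove P Φ) := by
  have : alcove P Φ = ⋂ i ∈ Φ,
      {xi | 0 < inner ℝ xi (P.root i) ∧ inner ℝ xi (P.root i) < 2 * Real.pi} := by
    ext; simp [alcove]
  rw [this]
  refine isOpen_biInter_finset fun i _ => IsOpen.and ?_ ?_
  · exact isOpen_lt continuous_const (by fun_prop)
  · exact isOpen_lt (by fun_prop) continuous_const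

theorem alcove_subset_weylStar (hΦ : IsPositiveSystem P Φ) : alcove P Φ ⊆ weylStar P := by
  intro xi hxi i
  rw [abs_lt]
  have hpi := Real.pi_pos
  by_cases hi : i ∈ Φ
  · exact ⟨by linarith [(hxi i hi).1], (hxi i hi).2⟩
  · have := hxi _ ((negIdx_mem_iff hΦ i).2 hi)
    rw [root_negIdx, inner_neg_right] at this
    exact ⟨by linarith [this.2], by linarith [this.1]⟩

theorem alcove_nonempty (hΦ : IsPositiveSystem P Φ) : (alcove P Φ).Nonempty := by
  have hpi := Real.pi_pos
  let C := ∑ i ∈ Φ, height hΦ (P.root i)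
  have hC : 0 ≤ C := Finset.sum_nonneg fun i hi => ((height_pos_iff hΦ i).2 hi).le
  refine ⟨(1 / (1 + C)) • hΦ.choose, fun i hi => ?_⟩
  have h1 := (height_pos_iff hΦ i).2 hi
  have h2 : height hΦ (P.root i) ≤ C :=
    Finset.single_le_sum (f := fun i => height hΦ (P.root i))
      (fun i hi => ((height_pos_iff hΦ i).2 hi).le) hi
  rw [real_inner_smul_left, real_inner_comm]
  change 0 < 1 / (1 + C) * height hΦ (P.root i) ∧ 1 / (1 + C) * height hΦ (P.root i) < _
  refine ⟨by positivity, ?_⟩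
  rw [div_mul_eq_mul_div, one_mul, div_lt_iff₀ (by positivity)]
  nlinarith [Real.pi_gt_three]

/-- A Weyl group element as a linear isometry. -/
def weylIsometry (hP : IsEuclidean P) (w : weyl P) : E ≃ₗᵢ[ℝ] E :=
  ⟨w.1, norm_weyl hP w⟩

theorem continuous_weyl (hP : IsEuclidean P) (w : weyl P) : Continuous fun x => w.1 x :=
  (weylIsometry hP w).continuous

theorem isBounded_weylStar [FiniteDimensional ℝ E] [Finite ι] [P.IsRootSystem] : Bornology.IsBounded (weylStar P) := by
  have := Fintype.ofFinite ι
  let T : E →ₗ[ℝ] (ι → ℝ) := LinearMap.pi fun i => (innerSL ℝ (P.root i)).toLinearMap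
  have hT : LinearMap.ker T = ⊥ := by
    rw [LinearMap.ker_eq_bot']
    intro x hx
    apply eq_zero_of_inner_root (P := P)
    intro i
    rw [real_inner_comm]
    exact congrFun hx i
  obtain ⟨K, -, hK⟩ := T.exists_antilipschitzWith hT
  have hb : Bornology.IsBounded (Metric.closedBall (0 : ι → ℝ) (2 * Real.pi)) :=
    Metric.isBounded_closedBall
  refine (hK.isBounded_preimage hb).subset fun x hx => ?_
  rw [Set.mem_preimage, mem_closedBall_zero_iff, pi_norm_le_iff_of_nonneg (by positivity)]
  intro i
  change |inner ℝ (P.root i) x| ≤ _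
  rw [real_inner_comm]
  exact (hx i).le

end Topology

/-! ### Integration over the torus and over the alcove. -/

section Measure

open scoped Pointwise

variable {ι E : Type*} [NormedAddCommGroup E] [InnerProductSpace ℝ E] [FiniteDimensional ℝ E]
  [MeasurableSpace E] [BorelSpace E]
  {P : RootPairing ι ℝ E E} {Φ : Finset ι}

theorem volume_weylStar_lt_top [Finite ι] [P.IsRootSystem] : volume (weylStar P) < ⊤ :=
  isBounded_weylStar.measure_lt_top

theorem volume_alcove_lt_top [Finite ι] [P.IsRootSystem] (hΦ : IsPositiveSystem P Φ) :
    volume (alcove P Φ) < ⊤ :=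
  (measure_mono (alcove_subset_weylStar hΦ)).trans_lt volume_weylStar_lt_top

theorem volume_real_alcove_pos [Finite ι] [P.IsRootSystem] (hΦ : IsPositiveSystem P Φ) :
    0 < volume.real (alcove P Φ) :=
  ENNReal.toReal_pos ((isOpen_alcove P Φ).measure_pos volume (alcove_nonempty hΦ)).ne'
    (volume_alcove_lt_top hΦ).ne

theorem volume_hyperplane {a : E} (ha : a ≠ 0) (c : ℝ) :
    volume {xi : E | inner ℝ xi a = c} = 0 := by
  have haa : inner ℝ a a ≠ 0 := inner_self_ne_zero.2 ha
  let K : Submodule ℝ E := LinearMap.ker (innerSL ℝ a).toLinearMap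
  have hK : volume (K : Set E) = 0 := by
    refine Measure.addHaar_submodule _ _ fun h => haa ?_
    have : a ∈ K := h ▸ Submodule.mem_top
    exact this
  have : {xi : E | inner ℝ xi a = c} = (fun x => (-(c / inner ℝ a a)) • a + x) ⁻¹' (K : Set E) := by
    ext xi
    change _ ↔ inner ℝ a ((-(c / inner ℝ a a)) • a + xi) = 0
    rw [inner_add_right, real_inner_smul_right, neg_mul, div_mul_cancel₀ _ haa, real_inner_comm,
      neg_add_eq_zero]
    exact ⟨fun h => h.symm, fun h => h.symm⟩
  rw [this, measure_preimage_add, hK]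

theorem ae_inner_root_ne [Finite ι] (P : RootPairing ι ℝ E E) :
    ∀ᵐ xi : E, ∀ i, ∀ z : ℤ, inner ℝ xi (P.root i) ≠ z * (2 * Real.pi) := by
  rw [ae_all_iff]
  intro i
  rw [ae_all_iff]
  intro z
  rw [ae_iff]
  simpa using volume_hyperplane (P.ne_zero i) (z * (2 * Real.pi))

/-- Shortest representatives cover up to the walls ⟨ξ, α⟩ ∈ 2πℤ, a null set. The star thus replaces
the affine Weyl group tiling. -/
theorem isAddFundamentalDomain_weylStar [Finite ι] [P.IsRootSystem] [P.IsCrystallographic]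
    (hP : IsEuclidean P) : IsAddFundamentalDomain (corootLattice P) (weylStar P) volume where
  nullMeasurableSet := (isOpen_weylStar P).measurableSet.nullMeasurableSet
  ae_covers := by
    filter_upwards [ae_inner_root_ne P] with xi hxi
    obtain ⟨l, hl, h⟩ := exists_translate_le hP xi
    refine ⟨⟨l, hl⟩, fun i => lt_of_le_of_ne (h i) fun he => ?_⟩
    change |inner ℝ (l + xi) (P.root i)| = _ at he
    obtain ⟨z, hz⟩ := exists_int_inner_lattice hl (root_mem_weightLattice hP i)
    rw [inner_add_left, real_inner_comm, hz] at he
    rcases abs_eq (by positivity) |>.1 he with he | he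
    · exact hxi i (1 - z) (by push_cast; linarith)
    · exact hxi i (-1 - z) (by push_cast; linarith)
  aedisjoint := by
    intro g g' hgg
    apply Disjoint.aedisjoint
    rw [Set.disjoint_left]
    rintro _ ⟨x, hx, rfl⟩ ⟨y, hy, hxy⟩
    apply hgg
    have hxy' : g'.1 + y = g.1 + x := hxy
    have h := disjoint_star hP (sub_mem g.2 g'.2) hx (l := g.1 - g'.1) (by
      have : g.1 - g'.1 + x = y := by rw [sub_add_eq_add_sub, ← hxy', add_sub_cancel_left]
      rwa [this])
    exact Subtype.ext (sub_eq_zero.1 h)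

theorem integrableOn_weylStar [Finite ι] [P.IsRootSystem] {G : E → ℂ} (hG : Continuous G) :
    IntegrableOn G (weylStar P) :=
  (hG.continuousOn.integrableOn_compact isBounded_weylStar.isCompact_closure).mono_set
    subset_closure

/-- The wave is periodic, so its integral over the fundamental domain survives the shift by t =
πx/|x|². This shift also multiplies the wave by -1. -/
theorem setIntegral_planeWave_weylStar [Finite ι] [P.IsRootSystem] [P.IsCrystallographic]
    (hP : IsEuclidean P) {x : E} (hx : x ∈ weightLattice P) (h0 : x ≠ 0) :
    ∫ xi in weylStar P, planeWave x xi = 0 := by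
  have := countable_corootLattice hP
  have hD := isAddFundamentalDomain_weylStar (P := P) hP
  let t : E := (Real.pi / inner ℝ x x) • x
  have ht : planeWave x t = -1 := by
    have h : inner ℝ x x ≠ 0 := inner_self_ne_zero.2 h0
    rw [planeWave, real_inner_smul_right, div_mul_cancel₀ _ h, mul_comm, Complex.exp_pi_mul_I]
  have hD' : IsAddFundamentalDomain (corootLattice P) (t +ᵥ weylStar P) volume :=
    hD.vadd_of_comm t
  have h1 := hD.setIntegral_eq hD' (f := planeWave x)
    fun g xi => planeWave_add_lattice g.2 hx xi
  have h2 : ∫ xi in t +ᵥ weylStar P, planeWave x xi =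
      ∫ xi in weylStar P, planeWave x (t + xi) :=
    (measurePreserving_add_left volume t).setIntegral_image_emb
      (measurableEmbedding_addLeft t) _ _
  have h3 : ∫ xi in weylStar P, planeWave x (t + xi) = -∫ xi in weylStar P, planeWave x xi := by
    rw [← integral_neg]
    congr 1
    ext xi
    rw [add_comm, planeWave_add_right, ht, mul_neg_one]
  rw [h2, h3] at h1
  exact self_eq_neg.1 h1

/-- Up to walls the star is the disjoint union of the Weyl images of the alcove: disjoint because W
acts freely on chambers, covering because every orbit meets the dominant chamber. -/
theorem setIntegral_weylStar [Finite ι] [P.IsRootSystem] [P.IsCrystallographic]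
    (hP : IsEuclidean P) (hΦ : IsPositiveSystem P Φ) {G : E → ℂ} (hG : Continuous G) :
    ∫ xi in alcove P Φ, ∑ w : weyl P, G (w.1 xi) = ∫ xi in weylStar P, G xi := by
  let B : weyl P → Set E := fun w => {xi | (w⁻¹).1 xi ∈ alcove P Φ}
  have hBo : ∀ w, MeasurableSet (B w) := fun w =>
    ((isOpen_alcove P Φ).preimage (continuous_weyl hP w⁻¹)).measurableSet
  have hBsub : ∀ w, B w ⊆ weylStar P := fun w xi hxi => by
    have := weyl_mem_star hP w (alcove_subset_weylStar hΦ hxi)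
    rwa [weyl_apply_inv_self] at this
  have hdisj : Pairwise (Function.onFun Disjoint B) := by
    intro w u hwu
    apply Set.disjoint_left.2
    intro xi hw hu
    apply hwu
    have h : u⁻¹ * w = 1 := by
      refine eq_one_of_chamber hP hΦ _ (x := (w⁻¹).1 xi) (fun i hi => (hw i hi).1) fun i hi => ?_
      rw [weyl_mul_apply, weyl_apply_inv_self]
      exact (hu i hi).1.le
    exact (inv_mul_eq_one.1 h).symm
  have hcover : (weylStar P : Set E) =ᵐ[volume] ⋃ w, B w := by
    filter_upwards [ae_inner_root_ne P] with xi hxi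
    apply propext
    constructor
    · intro h
      obtain ⟨w, hw⟩ := exists_weyl_dominant hP hΦ xi
      refine Set.mem_iUnion.2 ⟨w⁻¹, ?_⟩
      change ((w⁻¹)⁻¹).1 xi ∈ alcove P Φ
      rw [inv_inv]
      intro i hi
      refine ⟨lt_of_le_of_ne (hw i hi) fun he => ?_, (abs_lt.1 (weyl_mem_star hP w h i)).2⟩
      obtain ⟨j, hj⟩ := exists_root_eq_weyl w⁻¹ i
      rw [inner_weyl_left hP, ← hj] at he
      exact hxi j 0 (by simpa using he.symm)
    · intro h
      obtain ⟨w, hw⟩ := Set.mem_iUnion.1 h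
      exact hBsub w hw
  rw [setIntegral_congr_set hcover, integral_iUnion_fintype hBo hdisj
    fun w => (integrableOn_weylStar hG).mono_set (hBsub w)]
  have hint : ∀ w : weyl P, IntegrableOn (fun xi => G (w.1 xi)) (alcove P Φ) := fun w =>
    (integrableOn_weylStar (P := P) (hG.comp (continuous_weyl hP w))).mono_set
      (alcove_subset_weylStar hΦ)
  rw [integral_finsetSum _ fun w _ => hint w]
  refine Finset.sum_congr rfl fun w _ => ?_
  have h := (weylIsometry hP w).measurePreserving.setIntegral_preimage_emb
    (weylIsometry hP w).toHomeomorph.measurableEmbedding G (B w)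
  rw [← h]
  congr 2
  ext xi
  change _ ↔ (w⁻¹).1 (w.1 xi) ∈ alcove P Φ
  rw [weyl_inv_apply_self]

/-- The normalization constant of the inner products. -/
def normConst (P : RootPairing ι ℝ E E) (Φ : Finset ι) : ℂ :=
  ((Nat.card (weyl P) : ℂ) * ((volume.real (alcove P Φ) : ℝ) : ℂ))⁻¹

/-- The mean over the torus `E / 2 π 𝒬^∨`. -/
def torusMean (P : RootPairing ι ℝ E E) (Φ : Finset ι) (G : E → ℂ) : ℂ :=
  normConst P Φ * ∫ xi in weylStar P, G xi

/-- The star has volume |W| Vol(A), so the normalization of the inner product is that of a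
probability measure on the torus. -/
theorem torusMean_one [Finite ι] [P.IsRootSystem] [P.IsCrystallographic]
    (hP : IsEuclidean P) (hΦ : IsPositiveSystem P Φ) : torusMean P Φ (fun _ => 1) = 1 := by
  have h := setIntegral_weylStar hP hΦ (G := fun _ => 1) continuous_const
  have hv := (volume_real_alcove_pos hΦ).ne'
  have hc : (Nat.card (weyl P) : ℂ) ≠ 0 := Nat.cast_ne_zero.2 Nat.card_pos.ne'
  rw [torusMean, ← h, normConst]
  simp only [Finset.sum_const, Finset.card_univ, ← Nat.card_eq_fintype_card, nsmul_eq_mul, mul_one]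
  rw [setIntegral_const, Complex.real_smul, mul_comm (Nat.card (weyl P) : ℂ)]
  exact inv_mul_cancel₀ (mul_ne_zero (Complex.ofReal_ne_zero.2 hv) hc)

theorem torusMean_planeWave [Finite ι] [P.IsRootSystem] [P.IsCrystallographic]
    (hP : IsEuclidean P) {x : E} (hx : x ∈ weightLattice P) (h0 : x ≠ 0) :
    torusMean P Φ (planeWave x) = 0 := by
  rw [torusMean, setIntegral_planeWave_weylStar hP hx h0, mul_zero]

theorem torusMean_eq [Finite ι] [P.IsRootSystem] [P.IsCrystallographic]
    (hP : IsEuclidean P) (hΦ : IsPositiveSystem P Φ) {G : E → ℂ} (hG : Continuous G) :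
    normConst P Φ * ∫ xi in alcove P Φ, ∑ w : weyl P, G (w.1 xi) = torusMean P Φ G := by
  rw [setIntegral_weylStar hP hΦ hG, torusMean]

end Measure

/-! ### The c-functions in one complex variable. -/

section OneVariable

/-- Taylor polynomials of a function analytic on the closed disc of radius `ϱ > 1` converge
geometrically on the closed unit disc. -/
theorem exists_taylor_bound {ϱ : ℝ} (hϱ : 1 < ϱ) {f : ℂ → ℂ}
    (hf : DifferentiableOn ℂ f (Metric.closedBall 0 ϱ)) :
    ∃ a : ℕ → ℂ, a 0 = f 0 ∧ ∃ C : ℝ, 0 ≤ C ∧ ∀ N : ℕ, ∀ z : ℂ, ‖z‖ ≤ 1 →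
      ‖∑ n ∈ Finset.range (N + 1), a n * z ^ n - f z‖ ≤ C * ϱ⁻¹ ^ N := by
  have h0 : 0 < ϱ := by linarith
  let R : NNReal := ⟨ϱ, h0.le⟩
  have hR : 0 < R := h0
  -- The Cauchy contour is the circle of radius ϱ itself, as f is differentiable on the closed disc.
  -- Hence the rate ϱ⁻¹ is reached without loss.
  have hs := DifferentiableOn.hasFPowerSeriesOnBall (R := R) hf hR
  set p := cauchyPowerSeries f 0 R
  set B : ℝ := (2 * Real.pi)⁻¹ * ∫ θ in (0 : ℝ)..2 * Real.pi, ‖f (circleMap 0 R θ)‖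
  have hB : ∀ n, ‖p.coeff n‖ ≤ B * ϱ⁻¹ ^ n := by
    intro n
    have := norm_cauchyPowerSeries_le f 0 R n
    rw [FormalMultilinearSeries.norm_apply_eq_norm_coef] at this
    rwa [show |(R : ℝ)| = ϱ from abs_of_pos h0] at this
  have hB0 : 0 ≤ B := by simpa using (norm_nonneg _).trans (hB 0)
  have hr : ϱ⁻¹ < 1 := inv_lt_one_of_one_lt₀ hϱ
  have hr0 : 0 < ϱ⁻¹ := by positivity
  refine ⟨p.coeff, ?_, B / (1 - ϱ⁻¹), div_nonneg hB0 (by linarith), fun N z hz => ?_⟩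
  · have := hs.coeff_zero (fun _ => 0)
    rw [← this, FormalMultilinearSeries.apply_eq_prod_smul_coeff]
    simp
  · have hsum := hs.hasSum (y := z) (by
      rw [Metric.mem_eball, edist_zero_right]
      have : ‖z‖₊ < R := lt_of_le_of_lt (b := 1) hz hϱ
      exact_mod_cast this)
    rw [zero_add] at hsum
    have hb : ∀ n, ‖p n fun _ => z‖ ≤ B * ϱ⁻¹ ^ n := by
      intro n
      rw [FormalMultilinearSeries.apply_eq_pow_smul_coeff, smul_eq_mul, norm_mul, norm_pow]
      have : ‖z‖ ^ n ≤ 1 := pow_le_one₀ (norm_nonneg _) hz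
      calc ‖z‖ ^ n * ‖p.coeff n‖ ≤ 1 * ‖p.coeff n‖ := by gcongr
        _ ≤ _ := by rw [one_mul]; exact hB n
    have h := norm_sub_le_of_geometric_bound_of_hasSum hr hb hsum (N + 1)
    simp only [FormalMultilinearSeries.apply_eq_pow_smul_coeff, smul_eq_mul] at h
    simp only [mul_comm (p.coeff _)]
    refine h.trans ?_
    rw [div_mul_eq_mul_div]
    have h1 : 0 < 1 - ϱ⁻¹ := by linarith
    rw [div_le_div_iff_of_pos_right h1]
    -- The tail starts at degree N + 1; the extra factor ϱ⁻¹ is given away.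
    exact mul_le_mul_of_nonneg_left (pow_le_pow_of_le_one hr0.le hr.le (Nat.le_succ N)) hB0

variable {ϱ : ℝ} {c : ℂ → ℂ}

/-- Schwarz reflection: c and its conjugate mirror image agree on the real axis near 0, hence on the
whole disc by the identity theorem. -/
theorem IsCFunction.conj (hϱ : 1 < ϱ) (hc : IsCFunction ϱ c) {z : ℂ} (hz : ‖z‖ ≤ 1) :
    c ((starRingEnd ℂ) z) = (starRingEnd ℂ) (c z) := by
  have hana : AnalyticOnNhd ℂ c (Metric.ball 0 ϱ) := hc.analytic.mono Metric.ball_subset_closedBall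
  have hana' : AnalyticOnNhd ℂ (fun z => (starRingEnd ℂ) (c ((starRingEnd ℂ) z)))
      (Metric.ball 0 ϱ) := by
    refine DifferentiableOn.analyticOnNhd (fun z hz => ?_) Metric.isOpen_ball
    apply DifferentiableAt.differentiableWithinAt
    have : DifferentiableAt ℂ c ((starRingEnd ℂ) z) :=
      (hana _ (by simpa using hz)).differentiableAt
    have h := this.conj_conj
    rw [Complex.conj_conj] at h
    exact h
  have hconn : IsPreconnected (Metric.ball (0 : ℂ) ϱ) := (convex_ball 0 ϱ).isPreconnected
  have h0 : (0 : ℂ) ∈ Metric.ball (0 : ℂ) ϱ := Metric.mem_ball_self (by linarith)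
  have hfreq : ∃ᶠ z in nhdsWithin (0 : ℂ) {0}ᶜ,
      c z = (starRingEnd ℂ) (c ((starRingEnd ℂ) z)) := by
    have ht : Tendsto (fun x : ℝ => (x : ℂ)) (nhdsWithin 0 {0}ᶜ) (nhdsWithin (0 : ℂ) {0}ᶜ) := by
      refine tendsto_nhdsWithin_of_tendsto_nhds_of_eventually_within _ ?_ ?_
      · have := Complex.continuous_ofReal.tendsto (0 : ℝ)
        rw [Complex.ofReal_zero] at this
        exact this.mono_left nhdsWithin_le_nhds
      · filter_upwards [self_mem_nhdsWithin] with x hx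
        simpa using hx
    refine ht.frequently (Eventually.frequently ?_)
    have hb : ∀ᶠ x : ℝ in nhds 0, |x| ≤ ϱ := by
      have : Metric.closedBall (0 : ℝ) ϱ ∈ nhds 0 := Metric.closedBall_mem_nhds 0 (by linarith)
      filter_upwards [this] with x hx
      simpa using hx
    filter_upwards [nhdsWithin_le_nhds hb] with x hx
    rw [Complex.conj_ofReal]
    exact (Complex.conj_eq_iff_im.2 (hc.real x hx)).symm
  have h := hana.eqOn_of_preconnected_of_frequently_eq hana' hconn h0 hfreq
  have hz' : (starRingEnd ℂ) z ∈ Metric.ball (0 : ℂ) ϱ := by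
    rw [mem_ball_zero_iff, RCLike.norm_conj]
    linarith
  simpa using h hz'

theorem IsCFunction.ne_zero_of_norm_le (hϱ : 1 < ϱ) (hc : IsCFunction ϱ c) {z : ℂ}
    (hz : ‖z‖ ≤ 1) : c z ≠ 0 :=
  hc.ne_zero z (by rw [mem_closedBall_zero_iff]; linarith)

theorem IsCFunction.continuousOn (hc : IsCFunction ϱ c) :
    ContinuousOn c (Metric.closedBall 0 ϱ) := hc.analytic.continuousOn

/-- On [0, 1] the function is real, continuous and zero-free, and it starts at 1, so it stays
positive. -/
theorem IsCFunction.map_one (hϱ : 1 < ϱ) (hc : IsCFunction ϱ c) :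
    ∃ r : ℝ, 0 < r ∧ c 1 = r := by
  have him : ∀ x ∈ Set.Icc (0 : ℝ) 1, c x = ((c x).re : ℂ) := by
    intro x hx
    apply Complex.ext
    · simp
    · simpa using hc.real x (by rw [abs_of_nonneg hx.1]; linarith [hx.2])
  have hcont : ContinuousOn (fun x : ℝ => (c x).re) (Set.Icc 0 1) := by
    refine Complex.continuous_re.comp_continuousOn (hc.continuousOn.comp
      Complex.continuous_ofReal.continuousOn fun x hx => ?_)
    rw [mem_closedBall_zero_iff, Complex.norm_real, Real.norm_of_nonneg hx.1]
    linarith [hx.2]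
  refine ⟨(c 1).re, ?_, by simpa using him 1 ⟨zero_le_one, le_rfl⟩⟩
  by_contra! hneg
  obtain ⟨x, hx, hx0⟩ := intermediate_value_Icc' zero_le_one hcont
    (show (0 : ℝ) ∈ Set.Icc _ _ from ⟨by simpa using hneg, by simp [hc.map_zero]⟩)
  apply hc.ne_zero_of_norm_le hϱ (z := x)
  · rw [Complex.norm_real, Real.norm_of_nonneg hx.1]
    exact hx.2
  · rw [him x hx, show (c x).re = 0 from hx0, Complex.ofReal_zero]

end OneVariable

/-! ### The product Ĉ, the weight and the scattering factors. -/

section BigC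

variable {ι E : Type*} [NormedAddCommGroup E] [InnerProductSpace ℝ E]
  {P : RootPairing ι ℝ E E} {Φ : Finset ι} {ϱ : ℝ} {c : ℝ → ℂ → ℂ}

theorem bigC_ne_zero (hϱ : 1 < ϱ) (hc : ∀ i ∈ posRoots1 P Φ, IsCFunction ϱ (c ‖P.root i‖))
    (xi : E) : bigC P Φ c xi ≠ 0 :=
  Finset.prod_ne_zero_iff.2 fun i hi =>
    (hc i hi).ne_zero_of_norm_le hϱ (norm_planeWave _ _).le

theorem continuous_bigC (hϱ : 1 < ϱ) (hc : ∀ i ∈ posRoots1 P Φ, IsCFunction ϱ (c ‖P.root i‖)) :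
    Continuous (bigC P Φ c) :=
  continuous_finsetProd _ fun i hi =>
    (hc i hi).continuousOn.comp_continuous (continuous_planeWave _) fun x => by
      rw [mem_closedBall_zero_iff, norm_planeWave]
      exact hϱ.le

theorem bigC_neg (hϱ : 1 < ϱ) (hc : ∀ i ∈ posRoots1 P Φ, IsCFunction ϱ (c ‖P.root i‖)) (xi : E) :
    bigC P Φ c (-xi) = (starRingEnd ℂ) (bigC P Φ c xi) := by
  rw [bigC, bigC, map_prod]
  refine Finset.prod_congr rfl fun i hi => ?_
  rw [← (hc i hi).conj hϱ (norm_planeWave _ _).le, conj_planeWave, planeWave_neg_right]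

/-- A reflection permutes the roots of R₁ up to sign and keeps their lengths. A sign change
conjugates the argument of c on the unit circle, which does not affect the absolute value. -/
theorem norm_bigC_reflection [P.IsCrystallographic] (hP : IsEuclidean P)
    (hΦ : IsPositiveSystem P Φ) (hϱ : 1 < ϱ)
    (hc : ∀ i ∈ posRoots1 P Φ, IsCFunction ϱ (c ‖P.root i‖)) (j : ι) (xi : E) :
    ‖bigC P Φ c (P.reflection j xi)‖ = ‖bigC P Φ c xi‖ := by
  classical
  have hq := isRootChoice_one hP
  rw [bigC, bigC, norm_prod, norm_prod]
  let F : ι → ℝ := fun i => ‖c ‖P.root i‖ (planeWave (-P.root i) xi)‖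
  have h1 : ∀ i ∈ posRoots1 P Φ,
      ‖c ‖P.root i‖ (planeWave (-P.root i) (P.reflection j xi))‖ = F (flipIdx P Φ j i) := by
    intro i hi
    have h := planeWave_weyl hP (simpleRefl P j)
    simp only [simpleRefl_apply, simpleRefl_inv] at h
    have hn : ‖P.root (P.reflectionPerm j i)‖ = ‖P.root i‖ := by
      rw [P.root_reflectionPerm]
      exact norm_weyl hP (simpleRefl P j) _
    rw [h, map_neg, ← P.root_reflectionPerm, ← hn]
    by_cases hm : P.reflectionPerm j i ∈ Φ
    · have e1 : flipIdx P Φ j i = P.reflectionPerm j i := if_pos hm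
      simp only [F, e1]
    · have e1 : flipIdx P Φ j i = negIdx P (P.reflectionPerm j i) := if_neg hm
      have hci := (hc i hi).conj hϱ (norm_planeWave (-P.root (P.reflectionPerm j i)) xi).le
      simp only [F, e1, root_negIdx, norm_neg]
      rw [hn, ← conj_planeWave (-P.root (P.reflectionPerm j i)), hci, RCLike.norm_conj]
  rw [Finset.prod_congr rfl h1]
  have hmem : ∀ i ∈ posRoots1 P Φ, flipIdx P Φ j i ∈ posRoots1 P Φ := fun i hi =>
    mem_posPart.2 ⟨flipIdx_mem hΦ j i, hq.flipIdx j (mem_posPart.1 hi).2⟩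
  exact Finset.prod_nbij' (flipIdx P Φ j) (flipIdx P Φ j) hmem hmem
    (fun i hi => flipIdx_flipIdx hΦ j (mem_posPart.1 hi).1)
    (fun i hi => flipIdx_flipIdx hΦ j (mem_posPart.1 hi).1) (fun _ _ => rfl)

theorem norm_bigC_weyl [P.IsCrystallographic] (hP : IsEuclidean P)
    (hΦ : IsPositiveSystem P Φ) (hϱ : 1 < ϱ)
    (hc : ∀ i ∈ posRoots1 P Φ, IsCFunction ϱ (c ‖P.root i‖)) (w : weyl P) (xi : E) :
    ‖bigC P Φ c (w.1 xi)‖ = ‖bigC P Φ c xi‖ := by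
  induction w using weyl_induction with
  | one => rfl
  | mul i w ih => rw [weyl_mul_apply, simpleRefl_apply, norm_bigC_reflection hP hΦ hϱ hc, ih]

theorem weight_eq (hϱ : 1 < ϱ) (hc : ∀ i ∈ posRoots1 P Φ, IsCFunction ϱ (c ‖P.root i‖)) (xi : E) :
    weight P Φ c xi = (((‖bigC P Φ c xi‖⁻¹) ^ 2 : ℝ) : ℂ) := by
  rw [weight, bigC_neg hϱ hc, Complex.mul_conj']
  push_cast
  rw [one_div, inv_pow]

theorem sqrtWeight_eq (hϱ : 1 < ϱ) (hc : ∀ i ∈ posRoots1 P Φ, IsCFunction ϱ (c ‖P.root i‖))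
    (xi : E) : sqrtWeight P Φ c xi = ((‖bigC P Φ c xi‖⁻¹ : ℝ) : ℂ) := by
  rw [sqrtWeight, weight_eq hϱ hc, show (1 / 2 : ℂ) = ((1 / 2 : ℝ) : ℂ) by push_cast; rfl,
    ← Complex.ofReal_cpow (by positivity), ← Real.sqrt_eq_rpow, Real.sqrt_sq (by positivity)]

theorem continuous_sqrtScatter (hP : IsEuclidean P) [FiniteDimensional ℝ E] (hϱ : 1 < ϱ)
    (hc : ∀ i ∈ posRoots1 P Φ, IsCFunction ϱ (c ‖P.root i‖)) (w : weyl P) :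
    Continuous (sqrtScatter P Φ c w) := by
  have h := (continuous_bigC hϱ hc).comp (continuous_weyl hP w)
  refine h.div (Complex.continuous_ofReal.comp h.norm) fun x => ?_
  simpa using bigC_ne_zero hϱ hc (w.1 x)

/-- All arguments of the c-functions are 1 at the origin, where their values are positive. -/
theorem sqrtScatter_zero (hϱ : 1 < ϱ)
    (hc : ∀ i ∈ posRoots1 P Φ, IsCFunction ϱ (c ‖P.root i‖)) (w : weyl P) :
    sqrtScatter P Φ c w 0 = 1 := by
  have h : ∃ r : ℝ, 0 < r ∧ bigC P Φ c 0 = r := by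
    choose! r hr0 hr using fun i (hi : i ∈ posRoots1 P Φ) => (hc i hi).map_one hϱ
    refine ⟨∏ i ∈ posRoots1 P Φ, r i, Finset.prod_pos hr0, ?_⟩
    rw [bigC, Complex.ofReal_prod]
    refine Finset.prod_congr rfl fun i hi => ?_
    rw [← hr i hi, planeWave, inner_zero_right]
    simp
  obtain ⟨r, hr0, hr⟩ := h
  rw [sqrtScatter, map_zero, hr, Complex.norm_real, Real.norm_of_nonneg hr0.le]
  exact div_self (Complex.ofReal_ne_zero.2 hr0.ne')

theorem sqrtScatter_sq (hϱ : 1 < ϱ)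
    (hc : ∀ i ∈ posRoots1 P Φ, IsCFunction ϱ (c ‖P.root i‖)) (w : weyl P) (xi : E) :
    sqrtScatter P Φ c w xi ^ 2 = scatter P Φ c w xi := by
  have h := bigC_ne_zero hϱ hc (w.1 xi)
  have h' : (starRingEnd ℂ) (bigC P Φ c (w.1 xi)) ≠ 0 := by simpa using h
  rw [sqrtScatter, scatter, bigC_neg hϱ hc, div_pow, ← Complex.mul_conj']
  field_simp

theorem weylDenom_ne_zero {xi : E} (h : xi ∈ alcove P Φ) : weylDenom P Φ xi ≠ 0 := by
  refine Finset.prod_ne_zero_iff.2 fun i hi h0 => ?_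
  have hx := h i (posPart_subset hi)
  rw [sub_eq_zero] at h0
  have h1 : planeWave (P.root i) xi = 1 := by
    have e : P.root i = (1 / 2 : ℝ) • P.root i + (1 / 2 : ℝ) • P.root i := by module
    rw [e, planeWave_add]
    nth_rw 1 [h0]
    rw [← planeWave_add, neg_smul, neg_add_cancel, planeWave_zero]
  rw [planeWave, Complex.exp_eq_one_iff] at h1
  obtain ⟨n, hn⟩ := h1
  have h2 : inner ℝ (P.root i) xi = n * (2 * Real.pi) := by
    have : Complex.I * ((inner ℝ (P.root i) xi : ℝ) : ℂ) =
        Complex.I * ((n * (2 * Real.pi) : ℝ) : ℂ) := by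
      rw [hn]; push_cast; ring
    exact_mod_cast mul_left_cancel₀ Complex.I_ne_zero this
  rw [real_inner_comm, h2] at hx
  have hpi := Real.pi_pos
  have h3 : (0 : ℝ) < n := pos_of_mul_pos_left hx.1 (by positivity)
  have h4 : (n : ℝ) < 1 := by
    by_contra! h4
    have : 1 * (2 * Real.pi) ≤ n * (2 * Real.pi) := by gcongr
    linarith [hx.2]
  have h5 : 0 < n := by exact_mod_cast h3
  have h6 : n < 1 := by exact_mod_cast h4
  omega

theorem asymptoticWave_eq [Finite ι] [P.IsRootSystem] [P.IsCrystallographic] (hP : IsEuclidean P)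
    (hΦ : IsPositiveSystem P Φ) (hϱ : 1 < ϱ)
    (hc : ∀ i ∈ posRoots1 P Φ, IsCFunction ϱ (c ‖P.root i‖)) (lam : DomWeight P Φ) {xi : E}
    (h : xi ∈ alcove P Φ) :
    asymptoticWave P Φ c lam xi =
      sqrtWeight P Φ c xi * weylDenom P Φ xi * asymptoticPoly P Φ c lam xi := by
  rw [asymptoticPoly, mul_assoc, mul_inv_cancel_left₀ (weylDenom_ne_zero h), sqrtWeight_eq hϱ hc,
    Finset.mul_sum, asymptoticWave]
  refine Finset.sum_congr rfl fun w _ => ?_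
  rw [sqrtScatter, norm_bigC_weyl hP hΦ hϱ hc]
  push_cast
  ring

end BigC

/-! ### Exponential polynomials and their leading terms. -/

section WaveSpan

variable {ι E : Type*} [NormedAddCommGroup E] [InnerProductSpace ℝ E]
  {P : RootPairing ι ℝ E E} {Φ : Finset ι}

/-- Finite combinations of plane waves with wave vectors in `A`. -/
def waveSpan (A : Set E) : Submodule ℂ (E → ℂ) := Submodule.span ℂ (planeWave '' A)

theorem planeWave_mem_waveSpan {A : Set E} {x : E} (hx : x ∈ A) : planeWave x ∈ waveSpan A :=
  Submodule.subset_span ⟨x, hx, rfl⟩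

theorem waveSpan_mono {A B : Set E} (h : A ⊆ B) : waveSpan A ≤ waveSpan B :=
  Submodule.span_mono (Set.image_mono h)

theorem planeWave_mul (x y : E) : planeWave x * planeWave y = planeWave (x + y) := by
  ext xi
  exact (planeWave_add x y xi).symm

theorem mul_mem_waveSpan {A B C : Set E} {f g : E → ℂ} (hf : f ∈ waveSpan A)
    (hg : g ∈ waveSpan B) (h : ∀ a ∈ A, ∀ b ∈ B, a + b ∈ C) : f * g ∈ waveSpan C := by
  have h1 := Submodule.mul_mem_mul hf hg
  rw [waveSpan, waveSpan, Submodule.span_mul_span] at h1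
  refine Submodule.span_mono ?_ h1
  rintro _ ⟨_, ⟨a, ha, rfl⟩, _, ⟨b, hb, rfl⟩, rfl⟩
  exact ⟨a + b, h a ha b hb, (planeWave_mul a b).symm⟩

theorem continuous_of_mem_waveSpan {A : Set E} {f : E → ℂ} (hf : f ∈ waveSpan A) :
    Continuous f := by
  induction hf using Submodule.span_induction with
  | mem f hf => obtain ⟨x, -, rfl⟩ := hf; exact continuous_planeWave x
  | zero => exact continuous_const
  | add f g _ _ hf hg => exact hf.add hg
  | smul r f _ hf => exact hf.const_smul r

theorem comp_weyl_mem_waveSpan (hP : IsEuclidean P) (w : weyl P) {A B : Set E} {f : E → ℂ}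
    (hf : f ∈ waveSpan A) (h : ∀ a ∈ A, (w⁻¹).1 a ∈ B) :
    (fun xi => f (w.1 xi)) ∈ waveSpan B := by
  induction hf using Submodule.span_induction with
  | mem f hf =>
    obtain ⟨x, hx, rfl⟩ := hf
    have : (fun xi => planeWave x (w.1 xi)) = planeWave ((w⁻¹).1 x) :=
      funext fun xi => planeWave_weyl hP w x xi
    rw [this]
    exact planeWave_mem_waveSpan (h x hx)
  | zero => exact zero_mem _
  | add f g _ _ hf hg => exact add_mem hf hg
  | smul r f _ hf => exact Submodule.smul_mem _ r hf

/-- The wave vectors `κ - 𝒬⁺`. -/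
def below (P : RootPairing ι ℝ E E) (Φ : Finset ι) (k : E) : Set E := {x | k - x ∈ posCone P Φ}

/-- `f = a e^{i κ} + (lower terms)`. -/
def IsLead (P : RootPairing ι ℝ E E) (Φ : Finset ι) (k : E) (a : ℂ) (f : E → ℂ) : Prop :=
  f - a • planeWave k ∈ waveSpan (below P Φ k \ {k})

theorem IsLead.exists_eq {k : E} {a : ℂ} {f : E → ℂ} (hf : IsLead P Φ k a f) :
    ∃ g ∈ waveSpan (below P Φ k \ {k}), f = a • planeWave k + g :=
  ⟨_, hf, by abel⟩

theorem self_mem_below (k : E) : k ∈ below P Φ k := by simp [below]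

theorem IsLead.mem {k : E} {a : ℂ} {f : E → ℂ} (hf : IsLead P Φ k a f) :
    f ∈ waveSpan (below P Φ k) := by
  obtain ⟨g, hg, rfl⟩ := hf.exists_eq
  exact add_mem (Submodule.smul_mem _ _ (planeWave_mem_waveSpan (self_mem_below k)))
    (waveSpan_mono Set.sdiff_subset hg)

theorem isLead_planeWave (k : E) : IsLead P Φ k 1 (planeWave k) := by
  rw [IsLead, one_smul, sub_self]
  exact zero_mem _

/-- A sum of exponents reaches k + l only if both are extremal, since the cone is pointed. -/
theorem IsLead.mul (hΦ : IsPositiveSystem P Φ) {k l : E} {a b : ℂ} {f g : E → ℂ}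
    (hf : IsLead P Φ k a f) (hg : IsLead P Φ l b g) : IsLead P Φ (k + l) (a * b) (f * g) := by
  obtain ⟨f', hf', rfl⟩ := hf.exists_eq
  obtain ⟨g', hg', rfl⟩ := hg.exists_eq
  have e : (a • planeWave k + f') * (b • planeWave l + g') - (a * b) • planeWave (k + l) =
      (a • planeWave k) * g' + f' * (b • planeWave l + g') := by
    rw [← planeWave_mul]
    simp only [add_mul, mul_add, smul_mul_smul_comm]
    abel
  rw [IsLead, e]
  refine add_mem ?_ ?_
  · refine mul_mem_waveSpan (A := {k})
      (Submodule.smul_mem _ _ (planeWave_mem_waveSpan rfl)) hg' ?_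
    rintro _ rfl y ⟨hy, hyl⟩
    refine ⟨?_, fun h => hyl (add_left_cancel h)⟩
    change _ + l - (_ + y) ∈ posCone P Φ
    rw [add_sub_add_left_eq_sub]
    exact hy
  · refine mul_mem_waveSpan hf' hg.mem ?_
    rintro x ⟨hx, hxk⟩ y hy
    refine ⟨?_, fun h => hxk ?_⟩
    · change k + l - (x + y) ∈ posCone P Φ
      rw [add_sub_add_comm]
      exact add_mem hx hy
    · have h1 : k + l - (x + y) = 0 := by rw [show x + y = k + l from h, sub_self]
      rw [add_sub_add_comm] at h1
      have h2 := posCone_antisymm hΦ hx (by rw [neg_eq_of_add_eq_zero_right h1]; exact hy)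
      exact (sub_eq_zero.1 h2).symm

theorem IsLead.prod (hΦ : IsPositiveSystem P Φ) (s : Finset ι) {k : ι → E} {f : ι → E → ℂ}
    (hf : ∀ i ∈ s, IsLead P Φ (k i) 1 (f i)) : IsLead P Φ (∑ i ∈ s, k i) 1 (∏ i ∈ s, f i) := by
  classical
  induction s using Finset.induction_on with
  | empty =>
    have : (1 : E → ℂ) = planeWave 0 := funext fun xi => (planeWave_zero xi).symm
    rw [Finset.sum_empty, Finset.prod_empty, this]
    exact isLead_planeWave 0
  | insert i s hi ih =>
    rw [Finset.sum_insert hi, Finset.prod_insert hi, ← one_mul (1 : ℂ)]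
    exact (hf i (Finset.mem_insert_self i s)).mul hΦ
      (ih fun j hj => hf j (Finset.mem_insert_of_mem hj))

theorem prod_mem_waveSpan (s : Finset ι) (k : ι → E) (f : ι → E → ℂ) (M : ℕ)
    (hf : ∀ i ∈ s, f i ∈ waveSpan {x | ∃ n ≤ M, x = k i - (n : ℝ) • P.root i}) :
    ∏ i ∈ s, f i ∈ waveSpan {x | ∃ n : ι → ℕ, (∀ i ∈ s, n i ≤ M) ∧
      x = ∑ i ∈ s, k i - ∑ i ∈ s, (n i : ℝ) • P.root i} := by
  classical
  induction s using Finset.induction_on with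
  | empty =>
    have : (1 : E → ℂ) = planeWave 0 := funext fun xi => (planeWave_zero xi).symm
    rw [Finset.prod_empty, this]
    exact planeWave_mem_waveSpan ⟨0, by simp, by simp⟩
  | insert j s hj ih =>
    rw [Finset.prod_insert hj]
    refine mul_mem_waveSpan (hf j (Finset.mem_insert_self j s))
      (ih fun i hi => hf i (Finset.mem_insert_of_mem hi)) ?_
    rintro _ ⟨n, hn, rfl⟩ _ ⟨m, hm, rfl⟩
    refine ⟨fun i => if i = j then n else m i, ?_, ?_⟩
    · intro i hi
      dsimp only
      split_ifs with h
      · exact hn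
      · exact hm i ((Finset.mem_insert.1 hi).resolve_left h)
    · rw [Finset.sum_insert hj, Finset.sum_insert hj]
      dsimp only
      rw [if_pos rfl]
      have : ∑ i ∈ s, ((if i = j then n else m i : ℕ) : ℝ) • P.root i =
          ∑ i ∈ s, (m i : ℝ) • P.root i := Finset.sum_congr rfl fun i hi => by
        rw [if_neg (ne_of_mem_of_not_mem hi hj)]
      rw [this]
      abel

/-! ### The building blocks -/

/-- The Weyl denominator as a product of functions. -/
theorem weylDenom_eq_prod : weylDenom P Φ = ∏ i ∈ posRoots0 P Φ,
    (planeWave ((1 / 2 : ℝ) • P.root i) - planeWave (-(1 / 2 : ℝ) • P.root i)) := by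
  ext xi
  rw [Finset.prod_apply]
  rfl

theorem isLead_weylDenom (hΦ : IsPositiveSystem P Φ) :
    IsLead P Φ (rho P Φ) 1 (weylDenom P Φ) := by
  rw [weylDenom_eq_prod, rho, Finset.smul_sum]
  refine IsLead.prod hΦ _ fun i hi => ?_
  rw [IsLead, one_smul, sub_sub_cancel_left]
  refine neg_mem (planeWave_mem_waveSpan ⟨?_, ?_⟩)
  · change _ - _ ∈ posCone P Φ
    have : (1 / 2 : ℝ) • P.root i - -(1 / 2 : ℝ) • P.root i = P.root i := by module
    rw [this]
    exact root_mem_posCone (posPart_subset hi)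
  · intro h
    apply P.ne_zero i
    have : (1 / 2 : ℝ) • P.root i - -(1 / 2 : ℝ) • P.root i = P.root i := by module
    rw [← this, show -(1 / 2 : ℝ) • P.root i = (1 / 2 : ℝ) • P.root i from h, sub_self]

theorem weylDenom_mem_waveSpan : weylDenom P Φ ∈
    waveSpan (zonotope P Φ (fun i => ∀ j, P.root j ≠ (2 : ℝ) • P.root i) 1) := by
  rw [weylDenom_eq_prod]
  refine waveSpan_mono ?_ (prod_mem_waveSpan (P := P) _ (fun i => (1 / 2 : ℝ) • P.root i) _ 1
    fun i _ => sub_mem ?_ ?_)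
  · rintro x ⟨n, hn, rfl⟩
    refine ⟨n, hn, ?_⟩
    rw [Nat.cast_one, one_smul, halfSum, Finset.smul_sum]
    rfl
  · exact planeWave_mem_waveSpan ⟨0, zero_le_one, by simp⟩
  · exact planeWave_mem_waveSpan ⟨1, le_rfl, by rw [Nat.cast_one]; module⟩

theorem continuous_weylDenom : Continuous (weylDenom P Φ) :=
  continuous_of_mem_waveSpan weylDenom_mem_waveSpan

section Monomial

variable [Finite ι] [P.IsRootSystem]

theorem monomial_eq (hP : IsEuclidean P) (mu : E) : monomial P mu =
    (Nat.card {w : weyl P // w.1 mu = mu} : ℂ)⁻¹ • ∑ w : weyl P, planeWave (w.1 mu) := by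
  ext xi
  rw [monomial, Pi.smul_apply, Finset.sum_apply, smul_eq_mul]
  congr 1
  rw [← Equiv.sum_comp (Equiv.inv (weyl P)) fun w => planeWave (w.1 mu) xi]
  exact Finset.sum_congr rfl fun w _ => planeWave_weyl hP w mu xi

theorem monomial_mem_waveSpan (hP : IsEuclidean P) (mu : E) :
    monomial P mu ∈ waveSpan (Set.range fun w : weyl P => w.1 mu) := by
  rw [monomial_eq hP]
  exact Submodule.smul_mem _ _ (sum_mem fun w _ => planeWave_mem_waveSpan ⟨w, rfl⟩)

theorem continuous_monomial (hP : IsEuclidean P) (mu : E) : Continuous (monomial P mu) :=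
  continuous_of_mem_waveSpan (monomial_mem_waveSpan hP mu)

theorem monomial_weyl (mu xi : E) (w : weyl P) : monomial P mu (w.1 xi) = monomial P mu xi := by
  rw [monomial, monomial]
  congr 1
  exact Equiv.sum_comp (Equiv.mulRight w) fun u => planeWave mu (u.1 xi)

theorem domWeight_sub_weyl_mem [P.IsCrystallographic] (hP : IsEuclidean P)
    (hΦ : IsPositiveSystem P Φ) (lam : DomWeight P Φ) (w : weyl P) :
    lam.1 - w.1 lam.1 ∈ posCone P Φ :=
  sub_weyl_mem_posCone hP hΦ (isRootChoice_one hP)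
    (fun i hi => lam.2 i (posPart_subset hi)) w

theorem isLead_monomial [P.IsCrystallographic] (hP : IsEuclidean P) (hΦ : IsPositiveSystem P Φ)
    (mu : DomWeight P Φ) : IsLead P Φ mu.1 1 (monomial P mu.1) := by
  classical
  rw [IsLead, monomial_eq hP, one_smul]
  have hc : (Nat.card {w : weyl P // w.1 mu.1 = mu.1} : ℂ) ≠ 0 := by
    have : Nonempty {w : weyl P // w.1 mu.1 = mu.1} := ⟨⟨1, rfl⟩⟩
    exact Nat.cast_ne_zero.2 Nat.card_pos.ne'
  have h1 : ∑ w : weyl P with w.1 mu.1 = mu.1, planeWave (w.1 mu.1) =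
      (Nat.card {w : weyl P // w.1 mu.1 = mu.1} : ℂ) • planeWave mu.1 := by
    rw [Finset.sum_congr rfl (fun w hw => by rw [(Finset.mem_filter.1 hw).2]),
      Finset.sum_const, Nat.card_eq_fintype_card, Fintype.card_subtype, Nat.cast_smul_eq_nsmul]
  rw [← Finset.sum_filter_add_sum_filter_not Finset.univ (fun w : weyl P => w.1 mu.1 = mu.1), h1,
    smul_add, inv_smul_smul₀ hc, add_sub_cancel_left]
  refine Submodule.smul_mem _ _ (sum_mem fun w hw => planeWave_mem_waveSpan ⟨?_, ?_⟩)
  · exact domWeight_sub_weyl_mem hP hΦ mu w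
  · exact (Finset.mem_filter.1 hw).2

end Monomial

/-- The product of the polynomials `∑_{n ≤ N} aᵢₙ zⁿ` at `z = e^{-i ⟨αᵢ, ξ⟩}`. -/
def truncProd (P : RootPairing ι ℝ E E) (Φ : Finset ι) (a : ι → ℕ → ℂ) (N : ℕ) : E → ℂ :=
  ∏ i ∈ posRoots1 P Φ, ∑ n ∈ Finset.range (N + 1), a i n • planeWave (-P.root i) ^ n

theorem planeWave_pow (x : E) (n : ℕ) : planeWave x ^ n = planeWave ((n : ℝ) • x) := by
  induction n with
  | zero =>
    ext xi
    simp [planeWave_zero]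
  | succ n ih =>
    rw [pow_succ, ih, planeWave_mul]
    congr 1
    push_cast
    module

theorem truncProd_mem_waveSpan (a : ι → ℕ → ℂ) (N : ℕ) : truncProd P Φ a N ∈
    waveSpan {x | ∃ n : ι → ℕ, (∀ i ∈ posRoots1 P Φ, n i ≤ N) ∧
      x = -∑ i ∈ posRoots1 P Φ, (n i : ℝ) • P.root i} := by
  refine waveSpan_mono ?_ (prod_mem_waveSpan (P := P) _ (fun _ => 0) _ N
    fun i _ => sum_mem fun n hn => Submodule.smul_mem _ _ ?_)
  · rintro x ⟨n, hn, rfl⟩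
    exact ⟨n, hn, by simp⟩
  · rw [planeWave_pow]
    exact planeWave_mem_waveSpan ⟨n, Nat.lt_succ_iff.1 (Finset.mem_range.1 hn), by simp⟩

theorem isLead_truncProd (hΦ : IsPositiveSystem P Φ) {a : ι → ℕ → ℂ}
    (ha : ∀ i ∈ posRoots1 P Φ, a i 0 = 1) (N : ℕ) : IsLead P Φ 0 1 (truncProd P Φ a N) := by
  have h : ∑ i ∈ posRoots1 P Φ, (0 : E) = 0 := Finset.sum_const_zero
  rw [← h]
  refine IsLead.prod hΦ _ fun i hi => ?_
  rw [IsLead, Finset.sum_range_succ', ha i hi]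
  simp only [planeWave_pow, Nat.cast_zero, zero_smul, one_smul, add_sub_cancel_right]
  refine sum_mem fun n _ => Submodule.smul_mem _ _ (planeWave_mem_waveSpan ⟨?_, ?_⟩)
  · change 0 - _ ∈ posCone P Φ
    rw [smul_neg, sub_neg_eq_add, zero_add, Nat.cast_smul_eq_nsmul]
    exact nsmul_mem (root_mem_posCone (posPart_subset hi)) _
  · intro h0
    rcases smul_eq_zero.1 (show ((n + 1 : ℕ) : ℝ) • -P.root i = 0 from h0) with h1 | h1
    · exact absurd h1 (Nat.cast_ne_zero.2 n.succ_ne_zero)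
    · exact P.ne_zero i (neg_eq_zero.1 h1)

theorem continuous_truncProd (a : ι → ℕ → ℂ) (N : ℕ) : Continuous (truncProd P Φ a N) :=
  continuous_of_mem_waveSpan (truncProd_mem_waveSpan a N)

/-- Telescoping with bounded factors keeps the geometric rate; the bound on the limit product is
carried along for the induction. -/
theorem norm_prod_sub_prod_le {X : Type*} (s : Finset ι) {r : ℝ} (hr0 : 0 ≤ r) (hr1 : r ≤ 1)
    (f : ι → ℕ → X → ℂ) (g : ι → X → ℂ)
    (hg : ∀ i ∈ s, ∃ K : ℝ, 0 ≤ K ∧ ∀ x, ‖g i x‖ ≤ K)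
    (hf : ∀ i ∈ s, ∃ C : ℝ, 0 ≤ C ∧ ∀ N x, ‖f i N x - g i x‖ ≤ C * r ^ N) :
    ∃ K : ℝ, 0 ≤ K ∧ (∀ x, ‖∏ i ∈ s, g i x‖ ≤ K) ∧ ∃ C : ℝ, 0 ≤ C ∧
      ∀ N x, ‖∏ i ∈ s, f i N x - ∏ i ∈ s, g i x‖ ≤ C * r ^ N := by
  classical
  induction s using Finset.induction_on with
  | empty => exact ⟨1, zero_le_one, by simp, 0, le_rfl, by simp⟩
  | insert j s hj ih =>
    obtain ⟨K, hK0, hK, C, hC0, hC⟩ := ih (fun i hi => hg i (Finset.mem_insert_of_mem hi))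
      (fun i hi => hf i (Finset.mem_insert_of_mem hi))
    obtain ⟨K', hK0', hK'⟩ := hg j (Finset.mem_insert_self j s)
    obtain ⟨C', hC0', hC'⟩ := hf j (Finset.mem_insert_self j s)
    refine ⟨K' * K, by positivity, fun x => ?_, C' * (C + K) + K' * C, by positivity,
      fun N x => ?_⟩
    · rw [Finset.prod_insert hj, norm_mul]
      exact mul_le_mul (hK' x) (hK x) (norm_nonneg _) hK0'
    · rw [Finset.prod_insert hj, Finset.prod_insert hj]
      set F := ∏ i ∈ s, f i N x
      set G := ∏ i ∈ s, g i x
      have hrN : r ^ N ≤ 1 := pow_le_one₀ hr0 hr1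
      have hrN0 : 0 ≤ r ^ N := pow_nonneg hr0 N
      have hF : ‖F‖ ≤ C + K := by
        calc ‖F‖ = ‖(F - G) + G‖ := by rw [sub_add_cancel]
          _ ≤ ‖F - G‖ + ‖G‖ := norm_add_le _ _
          _ ≤ C * r ^ N + K := add_le_add (hC N x) (hK x)
          _ ≤ C + K := by nlinarith
      calc ‖f j N x * F - g j x * G‖ = ‖(f j N x - g j x) * F + g j x * (F - G)‖ := by ring_nf
        _ ≤ ‖f j N x - g j x‖ * ‖F‖ + ‖g j x‖ * ‖F - G‖ := by
          refine (norm_add_le _ _).trans ?_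
          rw [norm_mul, norm_mul]
        _ ≤ (C' * r ^ N) * (C + K) + K' * (C * r ^ N) :=
          add_le_add (mul_le_mul (hC' N x) hF (norm_nonneg _) (by positivity))
            (mul_le_mul (hK' x) (hC N x) (norm_nonneg _) hK0')
        _ = _ := by ring

/-- Geometric approximation of a product of one-variable functions by exponential polynomials. -/
theorem exists_truncProd_bound {ϱ : ℝ} (hϱ : 1 < ϱ) (g : ι → ℂ → ℂ)
    (hg : ∀ i ∈ posRoots1 P Φ, DifferentiableOn ℂ (g i) (Metric.closedBall 0 ϱ))
    (hg0 : ∀ i ∈ posRoots1 P Φ, g i 0 = 1) :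
    ∃ a : ι → ℕ → ℂ, (∀ i ∈ posRoots1 P Φ, a i 0 = 1) ∧ ∃ C : ℝ, 0 ≤ C ∧ ∀ N xi,
      ‖truncProd P Φ a N xi - ∏ i ∈ posRoots1 P Φ, g i (planeWave (-P.root i) xi)‖ ≤
        C * ϱ⁻¹ ^ N := by
  have h0 : 0 < ϱ := by linarith
  choose! a ha0 C hC0 hC using fun i (hi : i ∈ posRoots1 P Φ) => exists_taylor_bound hϱ (hg i hi)
  have hb : ∀ i ∈ posRoots1 P Φ, ∃ K : ℝ, 0 ≤ K ∧
      ∀ xi : E, ‖g i (planeWave (-P.root i) xi)‖ ≤ K := by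
    intro i hi
    obtain ⟨K, hK⟩ := (isCompact_closedBall (0 : ℂ) 1).exists_bound_of_continuousOn
      ((hg i hi).continuousOn.mono (Metric.closedBall_subset_closedBall hϱ.le))
    refine ⟨max K 0, le_max_right _ _, fun x => (hK _ ?_).trans (le_max_left _ _)⟩
    rw [mem_closedBall_zero_iff, norm_planeWave]
  obtain ⟨-, -, -, C', hC0', hC'⟩ := norm_prod_sub_prod_le (posRoots1 P Φ)
    (inv_nonneg.2 h0.le) (inv_le_one_of_one_le₀ hϱ.le)
    (fun i N xi => ∑ n ∈ Finset.range (N + 1), a i n * planeWave (-P.root i) xi ^ n)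
    (fun i (xi : E) => g i (planeWave (-P.root i) xi)) hb
    (fun i hi => ⟨C i, hC0 i hi, fun N xi => hC i hi N _ (norm_planeWave _ _).le⟩)
  refine ⟨a, fun i hi => by rw [ha0 i hi, hg0 i hi], C', hC0', fun N xi => ?_⟩
  have := hC' N xi
  rw [truncProd, Finset.prod_apply]
  simpa only [Finset.sum_apply, Pi.smul_apply, Pi.pow_apply, smul_eq_mul] using this

end WaveSpan

/-! ### Fourier coefficients on the torus. -/

section Coefficients

variable {ι E : Type*} [NormedAddCommGroup E] [InnerProductSpace ℝ E] [FiniteDimensional ℝ E]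
  [MeasurableSpace E] [BorelSpace E] {P : RootPairing ι ℝ E E} {Φ : Finset ι}

theorem torusMean_smul (r : ℂ) (f : E → ℂ) :
    torusMean P Φ (r • f) = r * torusMean P Φ f := by
  rw [torusMean, torusMean, mul_left_comm]
  congr 1
  exact integral_const_mul r f

/-- The coefficient of `e^{i ⟨k, ξ⟩}`. -/
def waveCoeff (P : RootPairing ι ℝ E E) (Φ : Finset ι) (k : E) (f : E → ℂ) : ℂ :=
  torusMean P Φ (f * planeWave (-k))

theorem waveCoeff_smul (k : E) (r : ℂ) (f : E → ℂ) :
    waveCoeff P Φ k (r • f) = r * waveCoeff P Φ k f := by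
  rw [waveCoeff, smul_mul_assoc, torusMean_smul]
  rfl

variable [Finite ι] [P.IsRootSystem]

theorem torusMean_add {f g : E → ℂ} (hf : Continuous f) (hg : Continuous g) :
    torusMean P Φ (f + g) = torusMean P Φ f + torusMean P Φ g := by
  rw [torusMean, torusMean, torusMean, ← mul_add]
  congr 1
  exact integral_add (integrableOn_weylStar hf) (integrableOn_weylStar hg)

theorem exists_norm_torusMean_sub_le (P : RootPairing ι ℝ E E) [P.IsRootSystem] (Φ : Finset ι) :
    ∃ K : ℝ, 0 ≤ K ∧ ∀ f g : E → ℂ, Continuous f → Continuous g → ∀ B : ℝ,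
      (∀ x, ‖f x - g x‖ ≤ B) → ‖torusMean P Φ f - torusMean P Φ g‖ ≤ K * B := by
  refine ⟨‖normConst P Φ‖ * volume.real (weylStar P), by positivity, fun f g hf hg B hB => ?_⟩
  rw [torusMean, torusMean, ← mul_sub,
    ← integral_sub (integrableOn_weylStar hf) (integrableOn_weylStar hg), norm_mul, mul_assoc,
    mul_comm (volume.real _)]
  exact mul_le_mul_of_nonneg_left
    (norm_setIntegral_le_of_norm_le_const volume_weylStar_lt_top fun x _ => hB x) (norm_nonneg _)

theorem waveCoeff_add (k : E) {f g : E → ℂ} (hf : Continuous f) (hg : Continuous g) :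
    waveCoeff P Φ k (f + g) = waveCoeff P Φ k f + waveCoeff P Φ k g := by
  rw [waveCoeff, add_mul, torusMean_add (hf.mul (continuous_planeWave _))
    (hg.mul (continuous_planeWave _))]
  rfl

variable [P.IsCrystallographic]

/-- Only differences of exponents have to be weights, so integrality of ρ itself plays no role. -/
theorem waveCoeff_eq_zero (hP : IsEuclidean P) {k : E} {A : Set E} {f : E → ℂ}
    (hf : f ∈ waveSpan A) (hA : ∀ x ∈ A, x - k ∈ weightLattice P ∧ x ≠ k) :
    waveCoeff P Φ k f = 0 := by
  induction hf using Submodule.span_induction with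
  | mem f hf =>
    obtain ⟨x, hx, rfl⟩ := hf
    rw [waveCoeff, planeWave_mul, ← sub_eq_add_neg]
    exact torusMean_planeWave hP (hA x hx).1 (sub_ne_zero.2 (hA x hx).2)
  | zero => simp [waveCoeff, torusMean]
  | add f g hf hg hf' hg' =>
    rw [waveCoeff_add k (continuous_of_mem_waveSpan hf) (continuous_of_mem_waveSpan hg), hf', hg',
      add_zero]
  | smul r f _ hf => rw [waveCoeff_smul, hf, mul_zero]

theorem waveCoeff_planeWave_self (hP : IsEuclidean P) (hΦ : IsPositiveSystem P Φ) (k : E) :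
    waveCoeff P Φ k (planeWave k) = 1 := by
  rw [waveCoeff, planeWave_mul, add_neg_cancel, ← torusMean_one hP hΦ]
  congr 1
  exact funext planeWave_zero

theorem IsLead.waveCoeff_eq (hP : IsEuclidean P) (hΦ : IsPositiveSystem P Φ) {k : E} {a : ℂ}
    {f : E → ℂ} (hf : IsLead P Φ k a f) : waveCoeff P Φ k f = a := by
  obtain ⟨g, hg, rfl⟩ := hf.exists_eq
  rw [waveCoeff_add k ((continuous_planeWave k).const_smul a) (continuous_of_mem_waveSpan hg),
    waveCoeff_smul, waveCoeff_planeWave_self hP hΦ, mul_one, waveCoeff_eq_zero hP hg, add_zero]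
  rintro x ⟨hx, hxk⟩
  refine ⟨?_, hxk⟩
  rw [← neg_sub]
  exact neg_mem (posCone_le_weightLattice hP hx)

theorem waveCoeff_eq_zero_of_below (hP : IsEuclidean P) {k l : E} {f : E → ℂ}
    (hf : f ∈ waveSpan (below P Φ l)) (hkl : l - k ∈ weightLattice P) (h : l - k ∉ posCone P Φ) :
    waveCoeff P Φ k f = 0 := by
  refine waveCoeff_eq_zero hP hf fun x hx => ⟨?_, fun hxk => h (hxk ▸ hx)⟩
  rw [show x - k = l - k - (l - x) by abel]
  exact sub_mem hkl (posCone_le_weightLattice hP hx)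

end Coefficients

/-! ### Triangular pairing of dressed monomials with asymptotic waves. -/

section Pairing

variable {ι E : Type*} [NormedAddCommGroup E] [InnerProductSpace ℝ E] [FiniteDimensional ℝ E]
  [MeasurableSpace E] [BorelSpace E] [Finite ι]
  {P : RootPairing ι ℝ E E} [P.IsRootSystem] [P.IsCrystallographic] {Φ : Finset ι}
  {ϱ : ℝ} {c : ℝ → ℂ → ℂ}

/-- `f ↦ Δ̂^{1/2} δ f`. -/
def dress (P : RootPairing ι ℝ E E) (Φ : Finset ι) (c : ℝ → ℂ → ℂ) : (E → ℂ) →ₗ[ℂ] (E → ℂ) where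
  toFun f := fun xi => sqrtWeight P Φ c xi * weylDenom P Φ xi * f xi
  map_add' _ _ := funext fun _ => mul_add _ _ _
  map_smul' _ _ := funext fun _ => mul_left_comm _ _ _

/-- The sign of w is absorbed by the antisymmetry of δ, and |Ĉ|⁻¹ times the conjugate of Ĉ/|Ĉ|
equals 1/Ĉ. Every summand is thereby one function evaluated at ξ_w, and the sum over W unfolds the
alcove to the torus. -/
theorem alcoveInner_dress_monomial (hP : IsEuclidean P) (hΦ : IsPositiveSystem P Φ) (hϱ : 1 < ϱ)
    (hc : ∀ i ∈ posRoots1 P Φ, IsCFunction ϱ (c ‖P.root i‖)) (mu : E) (lam : DomWeight P Φ) :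
    alcoveInner P Φ (dress P Φ c (monomial P mu)) (asymptoticWave P Φ c lam) =
      torusMean P Φ (monomial P mu * weylDenom P Φ * (bigC P Φ c)⁻¹ *
        planeWave (-(rho P Φ + lam.1))) := by
  rw [← torusMean_eq hP hΦ ((((continuous_monomial hP mu).mul continuous_weylDenom).mul
    ((continuous_bigC hϱ hc).inv₀ (bigC_ne_zero hϱ hc))).mul (continuous_planeWave _))]
  rw [alcoveInner, normConst]
  congr 2
  ext xi
  rw [asymptoticWave, map_sum, Finset.mul_sum]
  refine Finset.sum_congr rfl fun w _ => ?_
  have hC := bigC_ne_zero hϱ hc (w.1 xi)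
  have hC' : (starRingEnd ℂ) (bigC P Φ c (w.1 xi)) ≠ 0 := by simpa using hC
  have hn : ((‖bigC P Φ c (w.1 xi)‖ : ℝ) : ℂ) ≠ 0 := by simpa using hC
  simp only [dress, LinearMap.coe_mk, AddHom.coe_mk, Pi.mul_apply, Pi.inv_apply, sqrtScatter, map_mul, map_div₀,
    conj_sgn, Complex.conj_ofReal, conj_planeWave, monomial_weyl, weylDenom_weyl hP hΦ,
    sqrtWeight_eq hϱ hc]
  rw [← norm_bigC_weyl hP hΦ hϱ hc w xi]
  have h2 := Complex.mul_conj' (bigC P Φ c (w.1 xi))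
  push_cast
  field_simp
  rw [← h2]
  ring

/-- 1/Ĉ is analytic in the e^{-i⟨α,ξ⟩} because the c-functions have no zeros, hence a uniform limit
of truncations with constant term 1. A coefficient shared by all truncations passes to the limit. -/
theorem alcoveInner_eq_of_waveCoeff (hP : IsEuclidean P) (hΦ : IsPositiveSystem P Φ) (hϱ : 1 < ϱ)
    (hc : ∀ i ∈ posRoots1 P Φ, IsCFunction ϱ (c ‖P.root i‖)) (mu : E) (lam : DomWeight P Φ)
    (b : ℂ) (hb : ∀ a : ι → ℕ → ℂ, (∀ i ∈ posRoots1 P Φ, a i 0 = 1) → ∀ N,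
      waveCoeff P Φ (rho P Φ + lam.1)
        (monomial P mu * weylDenom P Φ * truncProd P Φ a N) = b) :
    alcoveInner P Φ (dress P Φ c (monomial P mu)) (asymptoticWave P Φ c lam) = b := by
  rw [alcoveInner_dress_monomial hP hΦ hϱ hc]
  obtain ⟨a, ha, C, hC0, hC⟩ := exists_truncProd_bound (P := P) (Φ := Φ) hϱ
    (fun i z => (c ‖P.root i‖ z)⁻¹)
    (fun i hi => (hc i hi).analytic.differentiableOn.inv (hc i hi).ne_zero)
    (fun i hi => by simp [(hc i hi).map_zero])
  have hprod : ∀ xi, ∏ i ∈ posRoots1 P Φ, (c ‖P.root i‖ (planeWave (-P.root i) xi))⁻¹ =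
      (bigC P Φ c xi)⁻¹ := fun xi => by rw [bigC, Finset.prod_inv_distrib]
  obtain ⟨K, hK0, hK⟩ := exists_norm_torusMean_sub_le P Φ
  have hmd := (continuous_monomial (P := P) hP mu).mul (continuous_weylDenom (P := P) (Φ := Φ))
  obtain ⟨B, hB⟩ : ∃ B : ℝ, ∀ xi, ‖(monomial P mu * weylDenom P Φ) xi‖ ≤ B := by
    have hb : ∀ {A : Set E} {f : E → ℂ}, f ∈ waveSpan A → ∃ B : ℝ, ∀ xi, ‖f xi‖ ≤ B := by
      intro A f hf
      induction hf using Submodule.span_induction with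
      | mem f hf =>
        obtain ⟨x, -, rfl⟩ := hf
        exact ⟨1, fun xi => (norm_planeWave x xi).le⟩
      | zero => exact ⟨0, by simp⟩
      | add f g _ _ hf hg =>
        obtain ⟨B, hB⟩ := hf
        obtain ⟨B', hB'⟩ := hg
        exact ⟨B + B', fun xi => (norm_add_le _ _).trans (add_le_add (hB xi) (hB' xi))⟩
      | smul r f _ hf =>
        obtain ⟨B, hB⟩ := hf
        exact ⟨‖r‖ * B, fun xi => by
          rw [Pi.smul_apply, norm_smul]
          exact mul_le_mul_of_nonneg_left (hB xi) (norm_nonneg r)⟩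
    exact hb (mul_mem_waveSpan (C := Set.univ) (monomial_mem_waveSpan hP mu)
      weylDenom_mem_waveSpan fun _ _ _ _ => trivial)
  have key : ∀ N, ‖torusMean P Φ (monomial P mu * weylDenom P Φ * (bigC P Φ c)⁻¹ *
        planeWave (-(rho P Φ + lam.1))) - b‖ ≤ K * (B * C) * ϱ⁻¹ ^ N := by
    intro N
    rw [← hb a ha N, waveCoeff, norm_sub_rev,
      show K * (B * C) * ϱ⁻¹ ^ N = K * (B * (C * ϱ⁻¹ ^ N)) by ring]
    refine hK _ _ ((hmd.mul (continuous_truncProd a N)).mul (continuous_planeWave _))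
      ((hmd.mul ((continuous_bigC hϱ hc).inv₀ (bigC_ne_zero hϱ hc))).mul (continuous_planeWave _))
      _ fun xi => ?_
    have h1 := hC N xi
    rw [hprod] at h1
    simp only [Pi.mul_apply, Pi.inv_apply] at hB ⊢
    rw [← sub_mul, ← mul_sub, norm_mul, norm_mul, norm_planeWave, mul_one]
    exact mul_le_mul (hB xi) h1 (norm_nonneg _) ((norm_nonneg _).trans (hB xi))
  have hlim : Tendsto (fun N : ℕ => K * (B * C) * ϱ⁻¹ ^ N) atTop (nhds 0) := by
    have := (tendsto_pow_atTop_nhds_zero_of_lt_one (inv_nonneg.2 (by linarith))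
      (inv_lt_one_of_one_lt₀ hϱ)).const_mul (K * (B * C))
    rwa [mul_zero] at this
  have h0 := ge_of_tendsto' hlim key
  exact sub_eq_zero.1 (norm_le_zero_iff.1 h0)

theorem alcoveInner_dress_self (hP : IsEuclidean P) (hΦ : IsPositiveSystem P Φ) (hϱ : 1 < ϱ)
    (hc : ∀ i ∈ posRoots1 P Φ, IsCFunction ϱ (c ‖P.root i‖)) (lam : DomWeight P Φ) :
    alcoveInner P Φ (dress P Φ c (monomial P lam.1)) (asymptoticWave P Φ c lam) = 1 := by
  refine alcoveInner_eq_of_waveCoeff hP hΦ hϱ hc lam.1 lam 1 fun a ha N => ?_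
  have h := ((isLead_monomial hP hΦ lam).mul hΦ (isLead_weylDenom hΦ)).mul hΦ
    (isLead_truncProd hΦ ha N)
  rw [add_zero, add_comm, mul_one, mul_one] at h
  exact h.waveCoeff_eq hP hΦ

/-- The exponents of m_μ δ/Ĉ all lie below ρ + μ, because 1/Ĉ contributes only negative roots. -/
theorem alcoveInner_dress_of_not_dominates (hP : IsEuclidean P) (hΦ : IsPositiveSystem P Φ)
    (hϱ : 1 < ϱ) (hc : ∀ i ∈ posRoots1 P Φ, IsCFunction ϱ (c ‖P.root i‖))
    (mu lam : DomWeight P Φ) (h : ¬ Dominates P Φ lam mu) :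
    alcoveInner P Φ (dress P Φ c (monomial P mu.1)) (asymptoticWave P Φ c lam) = 0 := by
  refine alcoveInner_eq_of_waveCoeff hP hΦ hϱ hc mu.1 lam 0 fun a ha N => ?_
  have hl := ((isLead_monomial hP hΦ mu).mul hΦ (isLead_weylDenom hΦ)).mul hΦ
    (isLead_truncProd hΦ ha N)
  have e : mu.1 + rho P Φ + 0 - (rho P Φ + lam.1) = mu.1 - lam.1 := by abel
  refine waveCoeff_eq_zero_of_below hP hl.mem ?_ ?_
  · rw [e]
    exact sub_mem (domWeight_mem_weightLattice hP hΦ mu) (domWeight_mem_weightLattice hP hΦ lam)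
  · rw [e]
    exact h

end Pairing

/-! ### Dominance and induction along the admissible order. -/

section Order

variable {ι E : Type*} [NormedAddCommGroup E] [InnerProductSpace ℝ E]
  {P : RootPairing ι ℝ E E} {Φ : Finset ι}

theorem Dominates.antisymm (hΦ : IsPositiveSystem P Φ) {mu lam : DomWeight P Φ}
    (h : Dominates P Φ mu lam) (h' : Dominates P Φ lam mu) : mu = lam := by
  have := posCone_antisymm hΦ h (by rw [neg_sub]; exact h')
  exact Subtype.ext (sub_eq_zero.1 this).symm

theorem Dominates.trans {mu nu lam : DomWeight P Φ} (h : Dominates P Φ mu nu)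
    (h' : Dominates P Φ nu lam) : Dominates P Φ mu lam := by
  have := add_mem h' h
  rwa [sub_add_sub_cancel] at this

theorem IsAdmissibleOrder.induction {le : DomWeight P Φ → DomWeight P Φ → Prop}
    (hle : IsAdmissibleOrder P Φ le) {p : DomWeight P Φ → Prop}
    (h : ∀ lam, (∀ mu, le mu lam → mu ≠ lam → p mu) → p lam) (lam : DomWeight P Φ) : p lam := by
  induction hn : {mu | le mu lam}.ncard using Nat.strong_induction_on generalizing lam with
  | h n ih =>
    refine h lam fun mu hmu hne => ih _ ?_ mu rfl
    rw [← hn]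
    refine Set.ncard_lt_ncard ⟨fun nu hnu => hle.trans _ _ _ hnu hmu, fun hsub => ?_⟩
      (hle.finite_le lam)
    exact hne (hle.antisymm _ _ hmu (hsub (hle.refl lam)))

end Order

/-! ### Antisymmetrization and the Weyl character formula. -/

section AntiSymmetrization

variable {ι E : Type*} [NormedAddCommGroup E] [InnerProductSpace ℝ E] [Finite ι]
  {P : RootPairing ι ℝ E E} [P.IsRootSystem] {Φ : Finset ι}

/-- `f ↦ ∑_w (-1)^w f ∘ w`. -/
def antiSym (P : RootPairing ι ℝ E E) [P.IsRootSystem] : (E → ℂ) →ₗ[ℂ] (E → ℂ) where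
  toFun f := fun xi => ∑ w : weyl P, sgn P w * f (w.1 xi)
  map_add' _ _ := funext fun _ => by
    simp only [Pi.add_apply, mul_add, Finset.sum_add_distrib]
  map_smul' _ _ := funext fun _ => by
    simp only [Pi.smul_apply, smul_eq_mul, mul_left_comm (sgn P _), Finset.mul_sum, RingHom.id_apply]

theorem antiSym_apply (f : E → ℂ) (xi : E) :
    antiSym P f xi = ∑ w : weyl P, sgn P w * f (w.1 xi) := rfl

theorem antiSym_eq (f : E → ℂ) :
    antiSym P f = ∑ w : weyl P, sgn P w • fun xi => f (w.1 xi) := by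
  ext xi
  rw [Finset.sum_apply]
  rfl

theorem antiSym_comp_weyl [FiniteDimensional ℝ E] (hP : IsEuclidean P) (u : weyl P) (f : E → ℂ) :
    antiSym P (fun xi => f (u.1 xi)) = sgn P u • antiSym P f := by
  ext xi
  rw [Pi.smul_apply, antiSym_apply, antiSym_apply, smul_eq_mul, Finset.mul_sum,
    ← Equiv.sum_comp (Equiv.mulLeft u) fun w => sgn P u * (sgn P w * f (w.1 xi))]
  refine Finset.sum_congr rfl fun w _ => ?_
  rw [Equiv.coe_mulLeft, sgn_mul, ← mul_assoc, ← mul_assoc, sgn_mul_self hP, one_mul,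
    weyl_mul_apply]

theorem antiSym_planeWave_weyl [FiniteDimensional ℝ E] (hP : IsEuclidean P) (u : weyl P) (k : E) :
    antiSym P (planeWave (u.1 k)) = sgn P u • antiSym P (planeWave k) := by
  have h : planeWave (u.1 k) = fun xi => planeWave k ((u⁻¹).1 xi) := by
    ext xi
    rw [planeWave_weyl hP, inv_inv]
  rw [h, antiSym_comp_weyl hP, sgn_inv hP]

theorem antiSym_planeWave_wall [FiniteDimensional ℝ E] (hP : IsEuclidean P) {k : E} {i : ι}
    (h : inner ℝ k (P.root i) = 0) : antiSym P (planeWave k) = 0 := by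
  have h1 := antiSym_planeWave_weyl hP (simpleRefl P i) k
  have h2 : (simpleRefl P i).1 k = k := by
    rw [simpleRefl_apply, reflection_eq hP, inner_coroot hP, h]
    simp
  rw [h2, sgn_simpleRefl hP, neg_one_smul] at h1
  exact self_eq_neg.1 h1

theorem antiSym_of_antisymm [FiniteDimensional ℝ E] (hP : IsEuclidean P) {f : E → ℂ}
    (hf : ∀ (w : weyl P) (xi : E), f (w.1 xi) = sgn P w * f xi) :
    antiSym P f = (Nat.card (weyl P) : ℂ) • f := by
  ext xi
  rw [antiSym_apply, Finset.sum_congr rfl fun w _ => by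
    rw [hf, ← mul_assoc, sgn_mul_self hP, one_mul]]
  rw [Finset.sum_const, Finset.card_univ, Nat.card_eq_fintype_card, nsmul_eq_mul]
  rfl

/-- Only w = 1 can produce the exponent k, so the leading coefficient is not disturbed. -/
theorem isLead_antiSym (hP : IsEuclidean P) {k : E} {f : E → ℂ} {A : Set E}
    (hf : IsLead P Φ k 1 f) (hfA : f ∈ waveSpan A)
    (hA : ∀ x ∈ A, ∀ w : weyl P, w ≠ 1 → k - w.1 x ∈ posCone P Φ ∧ k - w.1 x ≠ 0) :
    IsLead P Φ k 1 (antiSym P f) := by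
  classical
  have h1 : sgn P (1 : weyl P) • (fun xi => f ((1 : weyl P).1 xi)) = f := by
    rw [sgn_one, one_smul]
    rfl
  rw [IsLead, antiSym_eq, ← Finset.add_sum_erase _ _ (Finset.mem_univ (1 : weyl P)), h1,
    add_sub_right_comm]
  refine add_mem hf (sum_mem fun w hw => Submodule.smul_mem _ _
    (comp_weyl_mem_waveSpan hP w hfA fun x hx => ?_))
  have h := hA x hx w⁻¹ (inv_ne_one.2 (Finset.ne_of_mem_erase hw))
  exact ⟨h.1, fun e => h.2 (by rw [show (w⁻¹).1 x = k from e, sub_self])⟩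

/-- The span of the monomial symmetric functions strictly below `λ` in the dominance order. -/
def monoSpan (P : RootPairing ι ℝ E E) [P.IsRootSystem] (Φ : Finset ι) (lam : DomWeight P Φ) :
    Submodule ℂ (E → ℂ) :=
  Submodule.span ℂ ((fun mu : DomWeight P Φ => monomial P mu.1) ''
    {mu | Dominates P Φ mu lam ∧ mu ≠ lam})

theorem monoSpan_mono (hΦ : IsPositiveSystem P Φ) {mu lam : DomWeight P Φ}
    (h : Dominates P Φ mu lam ∧ mu ≠ lam) : monoSpan P Φ mu ≤ monoSpan P Φ lam := by
  refine Submodule.span_mono (Set.image_mono ?_)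
  rintro nu ⟨hnu, hne⟩
  refine ⟨hnu.trans h.1, ?_⟩
  rintro rfl
  exact h.2 (h.1.antisymm hΦ hnu)

variable [P.IsCrystallographic]

theorem rho_add_sub_weyl (hP : IsEuclidean P) (hΦ : IsPositiveSystem P Φ) (lam : DomWeight P Φ)
    (w : weyl P) : rho P Φ + lam.1 - w.1 (rho P Φ + lam.1) ∈ posCone P Φ := by
  rw [map_add, add_sub_add_comm]
  exact add_mem (halfSum_sub_weyl_mem hΦ (isRootChoice_zero hP) w)
    (domWeight_sub_weyl_mem hP hΦ lam w)

theorem isLead_antiSym_planeWave (hP : IsEuclidean P) (hΦ : IsPositiveSystem P Φ)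
    (lam : DomWeight P Φ) :
    IsLead P Φ (rho P Φ + lam.1) 1 (antiSym P (planeWave (rho P Φ + lam.1))) := by
  refine isLead_antiSym hP (isLead_planeWave _)
    (planeWave_mem_waveSpan (Set.mem_singleton (rho P Φ + lam.1))) ?_
  rintro _ rfl w hw
  refine ⟨rho_add_sub_weyl hP hΦ lam w, ?_⟩
  have h := weyl_truncated_ne hP hΦ lam (M := 0) (n := 0) (fun i hi => by
    obtain ⟨n, hn⟩ := lam.2 i hi
    rw [hn]
    simp) (by simp) hw
  simpa using h

/-- The span of the alternating sums `∑_w (-1)^w e^{i ⟨ρ + μ, ξ_w⟩}` for `μ` strictly below `λ`. -/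
def altSpan (P : RootPairing ι ℝ E E) [P.IsRootSystem] (Φ : Finset ι) (lam : DomWeight P Φ) :
    Submodule ℂ (E → ℂ) :=
  Submodule.span ℂ ((fun mu : DomWeight P Φ => antiSym P (planeWave (rho P Φ + mu.1))) ''
    {mu | Dominates P Φ mu lam ∧ mu ≠ lam})

/-- Antisymmetrizations of exponential sums below `ρ + λ` are combinations of alternating sums. -/
theorem exists_antiSym_eq [FiniteDimensional ℝ E] (hP : IsEuclidean P)
    (hΦ : IsPositiveSystem P Φ) (lam : DomWeight P Φ) {f : E → ℂ}
    (hf : f ∈ waveSpan (expSet P Φ lam.1)) : ∃ a : ℂ, ∃ g ∈ altSpan P Φ lam,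
      antiSym P f = a • antiSym P (planeWave (rho P Φ + lam.1)) + g := by
  suffices h : antiSym P f ∈ Submodule.span ℂ (insert (antiSym P (planeWave (rho P Φ + lam.1)))
      ((fun mu : DomWeight P Φ => antiSym P (planeWave (rho P Φ + mu.1))) ''
        {mu | Dominates P Φ mu lam ∧ mu ≠ lam})) from Submodule.mem_span_insert.1 h
  induction hf using Submodule.span_induction with
  | mem f hf =>
    obtain ⟨k, hk, rfl⟩ := hf
    -- Up to sign the exponent may be taken dominant. On a wall the alternating sum vanishes; off
    -- the walls the exponent is ρ + μ with μ dominant and, by the definition of `expSet`, below λ.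
    obtain ⟨w, hw⟩ := exists_weyl_dominant hP hΦ k
    have hk' := weyl_mem_expSet hP hΦ hk w
    have e : antiSym P (planeWave k) = sgn P w⁻¹ • antiSym P (planeWave (w.1 k)) := by
      rw [← antiSym_planeWave_weyl hP, weyl_inv_apply_self]
    rw [e]
    apply Submodule.smul_mem
    by_cases hwall : ∃ i, inner ℝ (w.1 k) (P.root i) = 0
    · obtain ⟨i, hi⟩ := hwall
      rw [antiSym_planeWave_wall hP hi]
      exact zero_mem _
    · push Not at hwall
      have hpos : ∀ i ∈ Φ, 0 < inner ℝ (w.1 k) (P.root i) := fun i hi =>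
        lt_of_le_of_ne (hw i hi) (hwall i).symm
      let mu : DomWeight P Φ := ⟨w.1 k - rho P Φ, dominant_sub_rho hP hΦ hpos hk'.1⟩
      have hmu : w.1 k = rho P Φ + mu.1 := by simp [mu]
      have hd : Dominates P Φ mu lam := by
        have := hk'.2 1
        rw [weyl_one_apply, hmu, add_sub_add_left_eq_sub] at this
        exact this
      rw [hmu]
      apply Submodule.subset_span
      by_cases hml : mu = lam
      · rw [hml]
        exact Set.mem_insert _ _
      · exact Set.mem_insert_of_mem _ ⟨mu, ⟨hd, hml⟩, rfl⟩
  | zero => rw [map_zero]; exact zero_mem _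
  | add f g _ _ hf hg => rw [map_add]; exact add_mem hf hg
  | smul r f _ hf => rw [map_smul]; exact Submodule.smul_mem _ r hf

theorem weylDenom_mul_monomial_mem (hP : IsEuclidean P) (hΦ : IsPositiveSystem P Φ)
    (lam : DomWeight P Φ) :
    weylDenom P Φ * monomial P lam.1 ∈ waveSpan (expSet P Φ lam.1) := by
  have hq := isRootChoice_zero hP
  refine mul_mem_waveSpan weylDenom_mem_waveSpan (monomial_mem_waveSpan hP lam.1) ?_
  rintro x hx _ ⟨w, rfl⟩
  have h1 : ∀ u : weyl P, rho P Φ - u.1 x ∈ posCone P Φ := fun u => by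
    have := sub_mem_of_zonotope (weyl_zonotope hΦ hq u hx)
    rwa [Nat.cast_one, one_smul, ← rho_eq] at this
  refine ⟨?_, fun u => ?_⟩
  · have h2 : rho P Φ - (1 : weyl P).1 x ∈ weightLattice P := posCone_le_weightLattice hP (h1 1)
    replace h2 := neg_mem h2
    rw [weyl_one_apply, neg_sub] at h2
    rw [add_sub_right_comm]
    exact add_mem h2 (weyl_mem_weightLattice hP w (domWeight_mem_weightLattice hP hΦ lam))
  · rw [map_add, add_sub_add_comm]
    exact add_mem (h1 u) (domWeight_sub_weyl_mem hP hΦ lam (u * w))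

/-- Wave vectors strictly below `ρ + λ` in the dominance order. -/
def strictlyBelow (P : RootPairing ι ℝ E E) (Φ : Finset ι) (lam : DomWeight P Φ) : Set E :=
  {x | ∃ mu : DomWeight P Φ, (Dominates P Φ mu lam ∧ mu ≠ lam) ∧ x ∈ below P Φ (rho P Φ + mu.1)}

theorem altSpan_le (hP : IsEuclidean P) (hΦ : IsPositiveSystem P Φ) (lam : DomWeight P Φ) :
    altSpan P Φ lam ≤ waveSpan (strictlyBelow P Φ lam) := by
  refine Submodule.span_le.2 ?_
  rintro _ ⟨mu, hmu, rfl⟩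
  exact waveSpan_mono (B := strictlyBelow P Φ lam) (fun x hx => ⟨mu, hmu, hx⟩) (isLead_antiSym_planeWave hP hΦ mu).mem

section Coefficients

variable [FiniteDimensional ℝ E] [MeasurableSpace E] [BorelSpace E]

theorem waveCoeff_strictlyBelow (hP : IsEuclidean P) (hΦ : IsPositiveSystem P Φ)
    (lam : DomWeight P Φ) {f : E → ℂ} (hf : f ∈ waveSpan (strictlyBelow P Φ lam)) :
    waveCoeff P Φ (rho P Φ + lam.1) f = 0 := by
  refine waveCoeff_eq_zero hP hf ?_
  rintro x ⟨mu, ⟨hmu, hne⟩, hx⟩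
  refine ⟨?_, ?_⟩
  · have h1 : rho P Φ + mu.1 - x + (lam.1 - mu.1) ∈ weightLattice P :=
      posCone_le_weightLattice hP (add_mem hx hmu)
    rw [← neg_mem_iff]
    convert h1 using 1
    abel
  · rintro rfl
    refine hne (hmu.antisymm hΦ ?_)
    change _ - _ ∈ posCone P Φ at hx
    rwa [add_sub_add_left_eq_sub] at hx

/-- The Weyl character formula in triangular form. -/
theorem exists_antiSym_planeWave_eq (hP : IsEuclidean P) (hΦ : IsPositiveSystem P Φ)
    {le : DomWeight P Φ → DomWeight P Φ → Prop} (hle : IsAdmissibleOrder P Φ le)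
    (lam : DomWeight P Φ) : ∃ g ∈ monoSpan P Φ lam,
      antiSym P (planeWave (rho P Φ + lam.1)) = weylDenom P Φ * (monomial P lam.1 + g) := by
  induction lam using hle.induction with
  | h lam ih =>
    have hc : (Nat.card (weyl P) : ℂ) ≠ 0 := Nat.cast_ne_zero.2 Nat.card_pos.ne'
    obtain ⟨a, g, hg, h⟩ := exists_antiSym_eq hP hΦ lam (weylDenom_mul_monomial_mem hP hΦ lam)
    -- δ m_λ is already antisymmetric, so antisymmetrization only multiplies it by |W|.
    rw [antiSym_of_antisymm hP fun w xi => by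
      rw [Pi.mul_apply, Pi.mul_apply, weylDenom_weyl hP hΦ, monomial_weyl, mul_assoc]] at h
    have hl := (isLead_weylDenom hΦ).mul hΦ (isLead_monomial hP hΦ lam)
    rw [mul_one] at hl
    have hl' := isLead_antiSym_planeWave hP hΦ lam
    -- Both δ m_λ and the alternating sum of λ have leading coefficient 1 at ρ + λ, where lower
    -- alternating sums contribute nothing.
    have ha : a = Nat.card (weyl P) := by
      have h1 := congrArg (waveCoeff P Φ (rho P Φ + lam.1)) h
      rw [waveCoeff_smul, hl.waveCoeff_eq hP hΦ, waveCoeff_add _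
        ((continuous_of_mem_waveSpan hl'.mem).const_smul a)
        (continuous_of_mem_waveSpan (altSpan_le hP hΦ lam hg)), waveCoeff_smul,
        hl'.waveCoeff_eq hP hΦ, waveCoeff_strictlyBelow hP hΦ lam (altSpan_le hP hΦ lam hg),
        mul_one, mul_one, add_zero] at h1
      exact h1.symm
    -- The induction hypothesis makes each lower alternating sum δ times a polynomial with monomials
    -- below λ.
    obtain ⟨g', hg', hgg⟩ : ∃ g' ∈ monoSpan P Φ lam, g = weylDenom P Φ * g' := by
      clear h
      induction hg using Submodule.span_induction with
      | mem f hf =>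
        obtain ⟨mu, hmu, rfl⟩ := hf
        obtain ⟨g, hg, h⟩ := ih mu (hle.refines _ _ hmu.1) hmu.2
        exact ⟨_, add_mem (Submodule.subset_span ⟨mu, hmu, rfl⟩) (monoSpan_mono hΦ hmu hg), h⟩
      | zero => exact ⟨0, zero_mem _, (mul_zero _).symm⟩
      | add f g _ _ hf hg =>
        obtain ⟨f', hf', rfl⟩ := hf
        obtain ⟨g', hg', rfl⟩ := hg
        exact ⟨f' + g', add_mem hf' hg', (mul_add _ _ _).symm⟩
      | smul r f _ hf =>
        obtain ⟨f', hf', rfl⟩ := hf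
        exact ⟨r • f', Submodule.smul_mem _ r hf', (mul_smul_comm _ _ _).symm⟩
    refine ⟨-(Nat.card (weyl P) : ℂ)⁻¹ • g', Submodule.smul_mem _ _ hg', ?_⟩
    rw [ha, hgg] at h
    have h2 := congrArg (fun f => (Nat.card (weyl P) : ℂ)⁻¹ • f) h
    simp only [smul_add, inv_smul_smul₀ hc] at h2
    rw [mul_add, mul_smul_comm, neg_smul, h2]
    abel

/-- The truncated asymptotic function is `δ` times a symmetric polynomial with leading term
`m_λ`. -/
theorem exists_truncated_eq (hP : IsEuclidean P) (hΦ : IsPositiveSystem P Φ)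
    {le : DomWeight P Φ → DomWeight P Φ → Prop} (hle : IsAdmissibleOrder P Φ le)
    (lam : DomWeight P Φ) {M : ℕ} (hM : ∀ i ∈ Φ, (M : ℝ) ≤ inner ℝ lam.1 (P.coroot i))
    {a : ι → ℕ → ℂ} (ha : ∀ i ∈ posRoots1 P Φ, a i 0 = 1) : ∃ g ∈ monoSpan P Φ lam,
      antiSym P (truncProd P Φ a M * planeWave (rho P Φ + lam.1)) =
        weylDenom P Φ * (monomial P lam.1 + g) := by
  have hmem : truncProd P Φ a M * planeWave (rho P Φ + lam.1) ∈
      waveSpan {x | ∃ n : ι → ℕ, (∀ i ∈ posRoots1 P Φ, n i ≤ M) ∧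
        x = rho P Φ + lam.1 - ∑ i ∈ posRoots1 P Φ, (n i : ℝ) • P.root i} := by
    refine mul_mem_waveSpan (truncProd_mem_waveSpan a M)
      (planeWave_mem_waveSpan (Set.mem_singleton (rho P Φ + lam.1))) ?_
    rintro _ ⟨n, hn, rfl⟩ _ rfl
    exact ⟨n, hn, by abel⟩
  have hmem' : truncProd P Φ a M * planeWave (rho P Φ + lam.1) ∈
      waveSpan (expSet P Φ lam.1) := by
    refine waveSpan_mono ?_ hmem
    rintro _ ⟨n, hn, rfl⟩
    exact truncated_mem_expSet hP hΦ lam hM hn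
  have hl := (isLead_truncProd hΦ ha M).mul hΦ (isLead_planeWave (rho P Φ + lam.1))
  rw [zero_add, mul_one] at hl
  -- The Weyl images of truncated exponents under w ≠ 1 stay strictly below ρ + λ, so the
  -- coefficient 1 survives.
  have hl2 : IsLead P Φ (rho P Φ + lam.1) 1
      (antiSym P (truncProd P Φ a M * planeWave (rho P Φ + lam.1))) := by
    refine isLead_antiSym hP hl hmem ?_
    rintro _ ⟨n, hn, rfl⟩ w hw
    exact ⟨(truncated_mem_expSet hP hΦ lam hM hn).2 w, weyl_truncated_ne hP hΦ lam hM hn hw⟩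
  obtain ⟨b, g, hg, h⟩ := exists_antiSym_eq hP hΦ lam hmem'
  have hl' := isLead_antiSym_planeWave hP hΦ lam
  have hb : b = 1 := by
    have h1 := congrArg (waveCoeff P Φ (rho P Φ + lam.1)) h
    rw [hl2.waveCoeff_eq hP hΦ, waveCoeff_add _
      ((continuous_of_mem_waveSpan hl'.mem).const_smul b)
      (continuous_of_mem_waveSpan (altSpan_le hP hΦ lam hg)), waveCoeff_smul,
      hl'.waveCoeff_eq hP hΦ, waveCoeff_strictlyBelow hP hΦ lam (altSpan_le hP hΦ lam hg),
      mul_one, add_zero] at h1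
    exact h1.symm
  obtain ⟨g', hg', hgg⟩ : ∃ g' ∈ monoSpan P Φ lam, g = weylDenom P Φ * g' := by
    clear h
    induction hg using Submodule.span_induction with
    | mem f hf =>
      obtain ⟨mu, hmu, rfl⟩ := hf
      obtain ⟨g, hg, h⟩ := exists_antiSym_planeWave_eq hP hΦ hle mu
      exact ⟨_, add_mem (Submodule.subset_span ⟨mu, hmu, rfl⟩) (monoSpan_mono hΦ hmu hg), h⟩
    | zero => exact ⟨0, zero_mem _, (mul_zero _).symm⟩
    | add f g _ _ hf hg =>
      obtain ⟨f', hf', rfl⟩ := hf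
      obtain ⟨g', hg', rfl⟩ := hg
      exact ⟨f' + g', add_mem hf' hg', (mul_add _ _ _).symm⟩
    | smul r f _ hf =>
      obtain ⟨f', hf', rfl⟩ := hf
      exact ⟨r • f', Submodule.smul_mem _ r hf', (mul_smul_comm _ _ _).symm⟩
  obtain ⟨g'', hg'', h''⟩ := exists_antiSym_planeWave_eq hP hΦ hle lam
  refine ⟨g'' + g', add_mem hg'' hg', ?_⟩
  rw [h, hb, one_smul, h'', hgg, ← add_assoc, mul_add _ _ g']

end Coefficients

end AntiSymmetrization

/-! ### Gram-Schmidt along a partial order and triangular pairs. -/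

section GramSchmidt

variable {Λ H : Type*} [PartialOrder Λ] [NormedAddCommGroup H] [InnerProductSpace ℂ H]

/-- The vectors `s` pair with the vectors `m` in a unitriangular way. -/
structure IsTriangularPair (m s : Λ → H) : Prop where
  self : ∀ l, inner ℂ (s l) (m l) = 1
  of_not_le : ∀ l k, ¬ l ≤ k → inner ℂ (s l) (m k) = 0

/-- `p` is an orthonormal family made of `m` by the Gram-Schmidt process along the order of `Λ`. -/
structure IsOrthonormalization (m p : Λ → H) : Prop where
  exists_sub_mem : ∀ l, ∃ r : ℝ, 0 < r ∧ p l - (r : ℂ) • m l ∈ Submodule.span ℂ (m '' Set.Iio l)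
  inner_eq_zero : ∀ l k, k < l → inner ℂ (p k) (p l) = 0
  norm_eq_one : ∀ l, ‖p l‖ = 1

variable {m s p p' : Λ → H}

theorem IsTriangularPair.inner_eq_zero (h : IsTriangularPair m s) (l : Λ) {v : H}
    (hv : v ∈ Submodule.span ℂ (m '' Set.Iio l)) : inner ℂ (s l) v = 0 := by
  induction hv using Submodule.span_induction with
  | mem v hv =>
    obtain ⟨k, hk, rfl⟩ := hv
    exact h.of_not_le l k (not_le_of_gt hk)
  | zero => exact inner_zero_right _
  | add x y _ _ hx hy => rw [inner_add_right, hx, hy, add_zero]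
  | smul r x _ hx => rw [inner_smul_right, hx, mul_zero]

/-- In a linear relation, pairing with s_k for a maximal index k isolates the coefficient of m_k. -/
theorem IsTriangularPair.linearIndependent (h : IsTriangularPair m s) :
    LinearIndependent ℂ m := by
  rw [linearIndependent_iff']
  intro t
  induction t using Finset.strongInduction with
  | H t ih =>
    intro b hb i hi
    obtain ⟨k, hk⟩ := t.exists_maximal ⟨i, hi⟩
    have h1 := congrArg (inner ℂ (s k)) hb
    rw [inner_sum, inner_zero_right, Finset.sum_eq_single_of_mem k hk.1] at h1
    · rw [inner_smul_right, h.self, mul_one] at h1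
      by_cases hik : i = k
      · rw [hik, h1]
      · classical
        refine ih (t.erase k) (Finset.erase_ssubset hk.1) b ?_ i (Finset.mem_erase.2 ⟨hik, hi⟩)
        rwa [← Finset.add_sum_erase _ _ hk.1, h1, zero_smul, zero_add] at hb
    · intro j hj hjk
      rw [inner_smul_right, h.of_not_le k j fun hkj => hjk (le_antisymm (hk.2 hj hkj) hkj),
        mul_zero]

theorem IsTriangularPair.exists_isOrthonormalization (h : IsTriangularPair m s)
    (hfin : ∀ l : Λ, (Set.Iio l).Finite) : ∃ p, IsOrthonormalization m p := by
  have key : ∀ l, ∃ x : H, (∃ r : ℝ, 0 < r ∧ x - (r : ℂ) • m l ∈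
      Submodule.span ℂ (m '' Set.Iio l)) ∧ x ∈ (Submodule.span ℂ (m '' Set.Iio l))ᗮ ∧ ‖x‖ = 1 := by
    intro l
    have : FiniteDimensional ℂ (Submodule.span ℂ (m '' Set.Iio l)) :=
      FiniteDimensional.span_of_finite ℂ ((hfin l).image m)
    set V := Submodule.span ℂ (m '' Set.Iio l)
    set u := m l - V.starProjection (m l) with hu
    have hV : V.starProjection (m l) ∈ V := Submodule.starProjection_apply_mem _ _
    -- The vector s_l pairs to 1 with m_l and to 0 with the span below, so m_l is outside that span.
    have hu0 : u ≠ 0 := by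
      intro h0
      have h1 := h.self l
      rw [sub_eq_zero.1 h0, h.inner_eq_zero l hV] at h1
      exact zero_ne_one h1
    have hn : 0 < ‖u‖ := norm_pos_iff.2 hu0
    refine ⟨((‖u‖⁻¹ : ℝ) : ℂ) • u, ⟨‖u‖⁻¹, inv_pos.2 hn, ?_⟩,
      Submodule.smul_mem _ _ (Submodule.sub_starProjection_mem_orthogonal _), ?_⟩
    · rw [← smul_sub, hu, sub_sub_cancel_left]
      exact Submodule.smul_mem _ _ (neg_mem hV)
    · rw [norm_smul, Complex.norm_real, norm_inv, norm_norm, inv_mul_cancel₀ hn.ne']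
  choose p hp1 hp2 hp3 using key
  refine ⟨p, hp1, fun l k hk => ?_, hp3⟩
  refine (hp2 l) _ ?_
  obtain ⟨r, -, hr⟩ := hp1 k
  rw [← sub_add_cancel (p k) ((r : ℂ) • m k)]
  refine add_mem (Submodule.span_mono (Set.image_mono fun j hj => lt_trans hj hk) hr)
    (Submodule.smul_mem _ _ (Submodule.subset_span ⟨k, hk, rfl⟩))

theorem IsOrthonormalization.mem_span [WellFoundedLT Λ] (hp : IsOrthonormalization m p) (l : Λ) :
    m l ∈ Submodule.span ℂ (p '' Set.Iic l) := by
  induction l using WellFoundedLT.induction with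
  | ind l ih =>
    obtain ⟨r, hr0, hr⟩ := hp.exists_sub_mem l
    have h1 : p l - (r : ℂ) • m l ∈ Submodule.span ℂ (p '' Set.Iic l) := by
      refine Submodule.span_le.2 ?_ hr
      rintro _ ⟨k, hk, rfl⟩
      exact Submodule.span_mono (Set.image_mono (Set.Iic_subset_Iic.2 (le_of_lt hk))) (ih k hk)
    have h2 := sub_mem (Submodule.subset_span (Set.mem_image_of_mem p (Set.mem_Iic.2 le_rfl))) h1
    rw [sub_sub_cancel] at h2
    exact (Submodule.smul_mem_iff _ (Complex.ofReal_ne_zero.2 hr0.ne')).1 h2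

theorem IsOrthonormalization.inner_span_eq_zero [WellFoundedLT Λ]
    (hp : IsOrthonormalization m p) (l : Λ) {v : H}
    (hv : v ∈ Submodule.span ℂ (m '' Set.Iio l)) : inner ℂ (p l) v = 0 := by
  have h1 : v ∈ Submodule.span ℂ (p '' Set.Iio l) := by
    refine Submodule.span_le.2 ?_ hv
    rintro _ ⟨k, hk, rfl⟩
    exact Submodule.span_mono (Set.image_mono fun j hj => lt_of_le_of_lt hj hk) (hp.mem_span k)
  clear hv
  induction h1 using Submodule.span_induction with
  | mem v hv =>
    obtain ⟨k, hk, rfl⟩ := hv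
    exact inner_eq_zero_symm.1 (hp.inner_eq_zero l k hk)
  | zero => exact inner_zero_right _
  | add x y _ _ hx hy => rw [inner_add_right, hx, hy, add_zero]
  | smul r x _ hx => rw [inner_smul_right, hx, mul_zero]

/-- The combination r' p_l - r p'_l cancels m_l, so it lies in the span below l, to which both
vectors are orthogonal. Norm 1 and positivity then give r = r'. -/
theorem IsOrthonormalization.unique [WellFoundedLT Λ] (hp : IsOrthonormalization m p)
    (hp' : IsOrthonormalization m p') : p = p' := by
  ext l
  obtain ⟨r, hr0, hr⟩ := hp.exists_sub_mem l
  obtain ⟨r', hr0', hr'⟩ := hp'.exists_sub_mem l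
  have h1 : (r' : ℂ) • p l - (r : ℂ) • p' l ∈ Submodule.span ℂ (m '' Set.Iio l) := by
    have h := sub_mem (Submodule.smul_mem _ (r' : ℂ) hr) (Submodule.smul_mem _ (r : ℂ) hr')
    convert h using 1
    simp only [smul_sub, smul_smul, mul_comm (r : ℂ)]
    abel
  have h2 : (r' : ℂ) • p l - (r : ℂ) • p' l = 0 := by
    rw [← inner_self_eq_zero (𝕜 := ℂ)]
    nth_rewrite 1 [inner_sub_left]
    rw [inner_smul_left, inner_smul_left, hp.inner_span_eq_zero l h1,
      hp'.inner_span_eq_zero l h1, mul_zero, mul_zero, sub_zero]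
  have h3 := sub_eq_zero.1 h2
  have h4 := congrArg norm h3
  rw [norm_smul, norm_smul, hp.norm_eq_one, hp'.norm_eq_one, mul_one, mul_one, Complex.norm_real,
    Complex.norm_real, Real.norm_of_nonneg hr0.le, Real.norm_of_nonneg hr0'.le] at h4
  rw [h4] at h3
  exact smul_right_injective H (Complex.ofReal_ne_zero.2 hr0.ne') h3

/-- If some combination with leading term `m l` is close to `s l`, then so is the `l`-th
Gram-Schmidt vector. -/
theorem IsOrthonormalization.norm_sub_le [WellFoundedLT Λ] (hp : IsOrthonormalization m p)
    (h : IsTriangularPair m s) (l : Λ) {v : H} (hv : v ∈ Submodule.span ℂ (m '' Set.Iio l)) :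
    ‖p l - s l‖ ≤ 2 * ‖s l - (m l + v)‖ := by
  obtain ⟨r, hr0, hr⟩ := hp.exists_sub_mem l
  have hr0' : (r : ℂ) ≠ 0 := Complex.ofReal_ne_zero.2 hr0.ne'
  set q := m l + v
  have hsp : inner ℂ (s l) (p l) = r := by
    have h1 := h.inner_eq_zero l hr
    rwa [inner_sub_right, inner_smul_right, h.self, mul_one, sub_eq_zero] at h1
  have hpp : inner ℂ (p l) (p l) = (1 : ℂ) := by
    rw [inner_self_eq_norm_sq_to_K, hp.norm_eq_one]
    simp
  have hps : inner ℂ (p l) (s l) = r := by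
    rw [← inner_conj_symm, hsp, Complex.conj_ofReal]
  have hpm : inner ℂ (p l) (m l) = (r : ℂ)⁻¹ := by
    have h1 := hp.inner_span_eq_zero l hr
    rw [inner_sub_right, inner_smul_right, hpp, sub_eq_zero] at h1
    exact eq_inv_of_mul_eq_one_right h1.symm
  have hpq : inner ℂ (p l) q = (r : ℂ)⁻¹ := by
    rw [inner_add_right, hpm, hp.inner_span_eq_zero l hv, add_zero]
  have hsq : inner ℂ (s l) q = 1 := by
    rw [inner_add_right, h.self, h.inner_eq_zero l hv, add_zero]
  -- The pairing of p_l with s_l - q is r - 1/r, and |r - 1/r| dominates |r - 1| because r > 0.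
  have h1 : |r - 1| ≤ ‖s l - q‖ := by
    have h2 := norm_inner_le_norm (𝕜 := ℂ) (p l) (s l - q)
    rw [inner_sub_right, hps, hpq, hp.norm_eq_one, one_mul, ← Complex.ofReal_inv,
      ← Complex.ofReal_sub, Complex.norm_real, Real.norm_eq_abs] at h2
    refine le_trans ?_ h2
    have e : r - r⁻¹ = (r - 1) * (1 + r⁻¹) := by field_simp; ring
    rw [e, abs_mul]
    refine le_mul_of_one_le_right (abs_nonneg _) ?_
    have := inv_pos.2 hr0
    exact le_trans (by linarith) (le_abs_self _)
  have h3 : ‖s l - (r : ℂ) • p l‖ ≤ ‖s l - q‖ := by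
    -- Here r p_l acts as a projection of s_l: the residual s_l - r p_l is orthogonal to q - r p_l,
    -- and is therefore no longer than s_l - q.
    have e : inner ℂ (s l - (r : ℂ) • p l) (s l - (r : ℂ) • p l) =
        inner ℂ (s l - (r : ℂ) • p l) (s l - q) := by
      rw [inner_sub_right, inner_sub_right _ _ q, inner_smul_right]
      simp only [inner_sub_left, inner_smul_left, Complex.conj_ofReal, hsp, hpp, hsq, hpq]
      rw [mul_inv_cancel₀ hr0']
      ring
    have h4 := norm_inner_le_norm (𝕜 := ℂ) (s l - (r : ℂ) • p l) (s l - q)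
    rw [← e, inner_self_eq_norm_sq_to_K, norm_pow] at h4
    simp only [Complex.coe_algebraMap, Complex.norm_real, norm_norm] at h4
    by_contra! hlt
    nlinarith [norm_nonneg (s l - q)]
  calc ‖p l - s l‖ = ‖-((r : ℂ) - 1) • p l - (s l - (r : ℂ) • p l)‖ := by
        congr 1
        rw [neg_smul, sub_smul, one_smul]
        abel
    _ ≤ ‖-((r : ℂ) - 1) • p l‖ + ‖s l - (r : ℂ) • p l‖ := _root_.norm_sub_le _ _
    _ ≤ 2 * ‖s l - q‖ := by
        rw [norm_smul, hp.norm_eq_one, mul_one, norm_neg, ← Complex.ofReal_one,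
          ← Complex.ofReal_sub, Complex.norm_real, Real.norm_eq_abs]
        linarith

end GramSchmidt

/-! ### The Hilbert space L²(A). -/

section AlcoveMeasure

variable {ι E : Type*} [NormedAddCommGroup E] [InnerProductSpace ℝ E] [FiniteDimensional ℝ E]
  [MeasurableSpace E] [BorelSpace E] [Finite ι]
  {P : RootPairing ι ℝ E E} [P.IsRootSystem] {Φ : Finset ι}

/-- The measure of the inner product `alcoveInner`. -/
def alcoveMeasure (P : RootPairing ι ℝ E E) (Φ : Finset ι) : Measure E :=
  ENNReal.ofReal ((Nat.card (weyl P) : ℝ) * volume.real (alcove P Φ))⁻¹ •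
    volume.restrict (alcove P Φ)

theorem memLp_alcove (hΦ : IsPositiveSystem P Φ) (f : C(E, ℂ)) :
    MemLp f 2 (volume.restrict (alcove P Φ)) := by
  obtain ⟨B, hB⟩ := (isBounded_weylStar (P := P)).isCompact_closure.exists_bound_of_continuousOn
    f.continuous.continuousOn
  have : IsFiniteMeasure (volume.restrict (alcove P Φ)) :=
    isFiniteMeasure_restrict.2 (volume_alcove_lt_top hΦ).ne
  refine MemLp.of_bound f.continuous.aestronglyMeasurable B ?_
  filter_upwards [ae_restrict_mem (isOpen_alcove P Φ).measurableSet] with x hx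
  exact hB x (subset_closure (alcove_subset_weylStar hΦ hx))

theorem memLp_alcoveMeasure (hΦ : IsPositiveSystem P Φ) (f : C(E, ℂ)) :
    MemLp f 2 (alcoveMeasure P Φ) :=
  (memLp_alcove hΦ f).smul_measure ENNReal.ofReal_ne_top

theorem isFiniteMeasure_alcoveMeasure (hΦ : IsPositiveSystem P Φ) :
    IsFiniteMeasure (alcoveMeasure P Φ) := by
  have : IsFiniteMeasure (volume.restrict (alcove P Φ)) :=
    isFiniteMeasure_restrict.2 (volume_alcove_lt_top hΦ).ne
  exact Measure.smul_finite _ ENNReal.ofReal_ne_top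

/-- The class of a continuous function in `L²(A)`. -/
def alcoveLp (hΦ : IsPositiveSystem P Φ) : C(E, ℂ) →ₗ[ℂ] Lp ℂ 2 (alcoveMeasure P Φ) where
  toFun f := (memLp_alcoveMeasure hΦ f).toLp f
  map_add' f g := MemLp.toLp_add (memLp_alcoveMeasure hΦ f) (memLp_alcoveMeasure hΦ g)
  map_smul' r f := MemLp.toLp_const_smul r (memLp_alcoveMeasure hΦ f)

theorem inner_alcoveLp (hΦ : IsPositiveSystem P Φ) (f g : C(E, ℂ)) :
    inner ℂ (alcoveLp hΦ g) (alcoveLp hΦ f) = alcoveInner P Φ f g := by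
  rw [L2.inner_def, alcoveInner]
  have h : ∫ a, inner ℂ (alcoveLp hΦ g a) (alcoveLp hΦ f a) ∂(alcoveMeasure P Φ) =
      ∫ a, f a * (starRingEnd ℂ) (g a) ∂(alcoveMeasure P Φ) := by
    refine integral_congr_ae ?_
    filter_upwards [(memLp_alcoveMeasure hΦ f).coeFn_toLp, (memLp_alcoveMeasure hΦ g).coeFn_toLp]
      with x hf hg
    rw [RCLike.inner_apply]
    exact congrArg₂ (fun a b => a * (starRingEnd ℂ) b) hf hg
  rw [h, alcoveMeasure, integral_smul_measure, ENNReal.toReal_ofReal (by positivity),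
    Complex.real_smul]
  push_cast
  rfl

theorem alcoveNorm_eq (hΦ : IsPositiveSystem P Φ) (f : C(E, ℂ)) :
    alcoveNorm P Φ f = ‖alcoveLp hΦ f‖ := by
  rw [alcoveNorm, ← inner_alcoveLp hΦ, inner_self_eq_norm_sq_to_K, ← RCLike.ofReal_pow]
  exact Real.sqrt_sq (norm_nonneg _)

theorem exists_norm_alcoveLp_le (hΦ : IsPositiveSystem P Φ) : ∃ K : ℝ, 0 ≤ K ∧
    ∀ (f : C(E, ℂ)) (B : ℝ), 0 ≤ B → (∀ x, ‖f x‖ ≤ B) → ‖alcoveLp hΦ f‖ ≤ K * B := by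
  have := isFiniteMeasure_alcoveMeasure hΦ
  refine ⟨_, ?_, fun f B hB h => Lp.norm_le_of_ae_bound hB ?_⟩
  · positivity
  · filter_upwards [(memLp_alcoveMeasure hΦ f).coeFn_toLp] with x hf
    exact (congrArg norm hf).trans_le (h x)

end AlcoveMeasure

/-! ### Orders, dressing and monomials in the form used for L²(A). -/

section Order

variable {ι E : Type*} [NormedAddCommGroup E] [InnerProductSpace ℝ E]
  {P : RootPairing ι ℝ E E} {Φ : Finset ι}

/-- The partial order of an admissible order. -/
@[reducible]
def IsAdmissibleOrder.partialOrder {le : DomWeight P Φ → DomWeight P Φ → Prop}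
    (hle : IsAdmissibleOrder P Φ le) : PartialOrder (DomWeight P Φ) where
  le := le
  le_refl := hle.refl
  le_trans := hle.trans
  le_antisymm := hle.antisymm

theorem IsAdmissibleOrder.wellFoundedLT {le : DomWeight P Φ → DomWeight P Φ → Prop}
    (hle : IsAdmissibleOrder P Φ le) :
    let := hle.partialOrder
    WellFoundedLT (DomWeight P Φ) :=
  let := hle.partialOrder
  ⟨⟨hle.induction fun lam h => Acc.intro lam fun mu hmu => h mu hmu.le hmu.ne⟩⟩

end Order

section DressFactor

variable {ι E : Type*} [NormedAddCommGroup E] [InnerProductSpace ℝ E]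
  {P : RootPairing ι ℝ E E} {Φ : Finset ι} {ϱ : ℝ} {c : ℝ → ℂ → ℂ}

/-- `Δ̂^{1/2} δ` as a continuous function. -/
def dressFactor (hϱ : 1 < ϱ) (hc : ∀ i ∈ posRoots1 P Φ, IsCFunction ϱ (c ‖P.root i‖)) :
    C(E, ℂ) where
  toFun xi := sqrtWeight P Φ c xi * weylDenom P Φ xi
  continuous_toFun := by
    have h : Continuous (sqrtWeight P Φ c) := by
      simp_rw [funext (sqrtWeight_eq hϱ hc)]
      exact Complex.continuous_ofReal.comp
        ((continuous_bigC hϱ hc).norm.inv₀ fun x => norm_ne_zero_iff.2 (bigC_ne_zero hϱ hc x))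
    exact h.mul continuous_weylDenom

theorem coe_dressFactor_mul (hϱ : 1 < ϱ)
    (hc : ∀ i ∈ posRoots1 P Φ, IsCFunction ϱ (c ‖P.root i‖)) (f : C(E, ℂ)) :
    ⇑(dressFactor hϱ hc * f) = dress P Φ c f := rfl

end DressFactor

section WeightedInner

variable {ι E : Type*} [NormedAddCommGroup E] [InnerProductSpace ℝ E] [FiniteDimensional ℝ E]
  [MeasurableSpace E] [BorelSpace E] {P : RootPairing ι ℝ E E} {Φ : Finset ι}
  {ϱ : ℝ} {c : ℝ → ℂ → ℂ}

theorem weightedInner_eq (hϱ : 1 < ϱ) (hc : ∀ i ∈ posRoots1 P Φ, IsCFunction ϱ (c ‖P.root i‖))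
    (f g : E → ℂ) :
    weightedInner P Φ c f g = alcoveInner P Φ (dress P Φ c f) (dress P Φ c g) := by
  rw [weightedInner, alcoveInner]
  congr 2
  ext xi
  simp only [dress, LinearMap.coe_mk, AddHom.coe_mk, map_mul, sqrtWeight_eq hϱ hc, weight_eq hϱ hc,
    Complex.conj_ofReal, Complex.ofReal_pow, ← Complex.mul_conj']
  ring

end WeightedInner

section Monomials

variable {ι E : Type*} [NormedAddCommGroup E] [InnerProductSpace ℝ E] [Finite ι]
  {P : RootPairing ι ℝ E E} [P.IsRootSystem] {Φ : Finset ι}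

/-- The monomial symmetric functions as continuous functions. -/
def monoC (hP : IsEuclidean P) (mu : DomWeight P Φ) : C(E, ℂ) :=
  ⟨monomial P mu.1, continuous_monomial hP mu.1⟩

theorem finsum_le_eq {le : DomWeight P Φ → DomWeight P Φ → Prop}
    (hle : IsAdmissibleOrder P Φ le) (hP : IsEuclidean P) (lam : DomWeight P Φ)
    (a : DomWeight P Φ → ℂ) (xi : E) :
    ∑ᶠ mu : {mu // le mu lam}, a mu * monomial P mu.1.1 xi =
      (∑ mu ∈ (hle.finite_le lam).toFinset, a mu • monoC hP mu) xi := by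
  rw [show (∑ᶠ mu : {mu // le mu lam}, a mu * monomial P mu.1.1 xi) =
    ∑ᶠ mu ∈ {mu | le mu lam}, a mu * monomial P mu.1 xi from
      finsum_set_coe_eq_finsum_mem (f := fun mu : DomWeight P Φ => a mu * monomial P mu.1 xi)
        {mu | le mu lam}, finsum_mem_eq_finite_toFinset_sum _ (hle.finite_le lam),
    ContinuousMap.sum_apply]
  rfl

end Monomials

/-! ### From trigonometric polynomials to vectors of L²(A) and back. -/

section Bridge

variable {ι E : Type*} [NormedAddCommGroup E] [InnerProductSpace ℝ E] [FiniteDimensional ℝ E]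
  [MeasurableSpace E] [BorelSpace E] [Finite ι]
  {P : RootPairing ι ℝ E E} [P.IsRootSystem] {Φ : Finset ι}
  {ϱ : ℝ} {c : ℝ → ℂ → ℂ}

/-- The class of `Δ̂^{1/2} δ f` in `L²(A)`. -/
def dressLp (hΦ : IsPositiveSystem P Φ) (hϱ : 1 < ϱ)
    (hc : ∀ i ∈ posRoots1 P Φ, IsCFunction ϱ (c ‖P.root i‖)) :
    C(E, ℂ) →ₗ[ℂ] Lp ℂ 2 (alcoveMeasure P Φ) :=
  alcoveLp hΦ ∘ₗ LinearMap.mulLeft ℂ (dressFactor hϱ hc)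

theorem inner_dressLp (hΦ : IsPositiveSystem P Φ) (hϱ : 1 < ϱ)
    (hc : ∀ i ∈ posRoots1 P Φ, IsCFunction ϱ (c ‖P.root i‖)) (f g : C(E, ℂ)) :
    inner ℂ (dressLp hΦ hϱ hc g) (dressLp hΦ hϱ hc f) = weightedInner P Φ c f g := by
  rw [weightedInner_eq hϱ hc]
  exact inner_alcoveLp hΦ _ _

/-- The asymptotic wave functions as continuous functions. -/
def asymptoticC (hP : IsEuclidean P) (hϱ : 1 < ϱ)
    (hc : ∀ i ∈ posRoots1 P Φ, IsCFunction ϱ (c ‖P.root i‖)) (lam : DomWeight P Φ) : C(E, ℂ) where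
  toFun := asymptoticWave P Φ c lam
  continuous_toFun := continuous_finsetSum _ fun w _ =>
    (continuous_const.mul (continuous_sqrtScatter hP hϱ hc w)).mul
      ((continuous_planeWave _).comp (continuous_weyl hP w))

theorem isTriangularPair [P.IsCrystallographic] (hP : IsEuclidean P) (hΦ : IsPositiveSystem P Φ)
    (hϱ : 1 < ϱ) (hc : ∀ i ∈ posRoots1 P Φ, IsCFunction ϱ (c ‖P.root i‖))
    {le : DomWeight P Φ → DomWeight P Φ → Prop} (hle : IsAdmissibleOrder P Φ le) :
    let := hle.partialOrder
    IsTriangularPair (dressLp hΦ hϱ hc ∘ monoC hP)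
      (alcoveLp hΦ ∘ asymptoticC (Φ := Φ) hP hϱ hc) := by
  let := hle.partialOrder
  refine ⟨fun l => ?_, fun l k h => ?_⟩
  · exact (inner_alcoveLp hΦ _ _).trans (alcoveInner_dress_self hP hΦ hϱ hc l)
  · exact (inner_alcoveLp hΦ _ _).trans
      (alcoveInner_dress_of_not_dominates hP hΦ hϱ hc k l fun hd => h (hle.refines _ _ hd))

theorem IsGramSchmidt.exists_isOrthonormalization (hP : IsEuclidean P)
    (hΦ : IsPositiveSystem P Φ) (hϱ : 1 < ϱ)
    (hc : ∀ i ∈ posRoots1 P Φ, IsCFunction ϱ (c ‖P.root i‖))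
    {le : DomWeight P Φ → DomWeight P Φ → Prop} (hle : IsAdmissibleOrder P Φ le)
    {p : DomWeight P Φ → E → ℂ} (hp : IsGramSchmidt P Φ c le p) :
    let := hle.partialOrder
    ∃ q : DomWeight P Φ → C(E, ℂ), (∀ l, ⇑(q l) = p l) ∧
      (∀ l, q l ∈ Submodule.span ℂ (Set.range (monoC (Φ := Φ) hP))) ∧
      IsOrthonormalization (dressLp hΦ hϱ hc ∘ monoC hP) (dressLp hΦ hϱ hc ∘ q) := by
  classical
  let := hle.partialOrder
  obtain ⟨⟨a, ha, hpa⟩, horth, hnorm⟩ := hp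
  let q : DomWeight P Φ → C(E, ℂ) := fun l =>
    ∑ mu ∈ (hle.finite_le l).toFinset, a l mu • monoC hP mu
  have hq : ∀ l, ⇑(q l) = p l := fun l => funext fun xi => by
    rw [hpa, finsum_le_eq hle hP]
  refine ⟨q, hq, fun l => sum_mem fun mu _ =>
    Submodule.smul_mem _ _ (Submodule.subset_span ⟨mu, rfl⟩), ?_, ?_, ?_⟩
  · intro l
    obtain ⟨r, hr0, hr⟩ := ha l
    refine ⟨r, hr0, ?_⟩
    rw [Function.comp_apply, Function.comp_apply, ← map_smul, ← map_sub, Set.image_comp,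
      ← Submodule.map_span]
    refine Submodule.mem_map_of_mem ?_
    have hl : l ∈ (hle.finite_le l).toFinset := by simpa using hle.refl l
    change ∑ mu ∈ (hle.finite_le l).toFinset, a l mu • monoC hP mu - _ ∈ _
    rw [← hr, ← Finset.add_sum_erase _ _ hl, add_sub_cancel_left]
    refine sum_mem fun mu hmu => Submodule.smul_mem _ _ (Submodule.subset_span ⟨mu, ?_, rfl⟩)
    rw [Finset.mem_erase, Set.Finite.mem_toFinset] at hmu
    exact lt_of_le_of_ne hmu.2 hmu.1
  · intro l k hk
    rw [Function.comp_apply, Function.comp_apply, inner_dressLp, hq, hq]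
    exact horth l k hk.le hk.ne
  · intro l
    have h := inner_dressLp hΦ hϱ hc (q l) (q l)
    rw [hq, hnorm, inner_self_eq_norm_sq_to_K] at h
    have h' : ‖dressLp hΦ hϱ hc (q l)‖ ^ 2 = 1 := Complex.ofReal_injective (by
      rw [Complex.ofReal_one, ← h]
      exact Complex.ofReal_pow _ _)
    exact (pow_eq_one_iff_of_nonneg (norm_nonneg _) two_ne_zero).1 h'

theorem isGramSchmidt_of_isOrthonormalization (hP : IsEuclidean P)
    (hΦ : IsPositiveSystem P Φ) (hϱ : 1 < ϱ)
    (hc : ∀ i ∈ posRoots1 P Φ, IsCFunction ϱ (c ‖P.root i‖))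
    {le : DomWeight P Φ → DomWeight P Φ → Prop} (hle : IsAdmissibleOrder P Φ le)
    {x : DomWeight P Φ → Lp ℂ 2 (alcoveMeasure P Φ)}
    (hx : letI := hle.partialOrder
      IsOrthonormalization (dressLp hΦ hϱ hc ∘ monoC hP) x) :
    ∃ p, IsGramSchmidt P Φ c le p := by
  classical
  let := hle.partialOrder
  choose r hr0 hr using hx.exists_sub_mem
  simp only [Set.image_comp, ← Submodule.map_span] at hr
  choose g hg hgx using hr
  simp only [SetLike.mem_coe, Finsupp.mem_span_image_iff_linearCombination] at hg
  choose b hb hbg using hg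
  have hbs : ∀ l k, ¬ k < l → b l k = 0 := fun l k hk => by
    by_contra h
    exact hk ((Finsupp.mem_supported _ _).1 (hb l) (Finsupp.mem_support_iff.2 h))
  -- `b l` is supported strictly below l, so the diagonal coefficient is exactly r l > 0.
  let a : DomWeight P Φ → DomWeight P Φ → ℂ := fun l k => b l k + if k = l then (r l : ℂ) else 0
  let q : DomWeight P Φ → C(E, ℂ) := fun l => g l + (r l : ℂ) • monoC hP l
  have hqx : ∀ l, dressLp hΦ hϱ hc (q l) = x l := fun l => by
    rw [map_add, map_smul, hgx]
    exact sub_add_cancel _ _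
  have hqa : ∀ l, q l = ∑ mu ∈ (hle.finite_le l).toFinset, a l mu • monoC hP mu := fun l => by
    have hl : l ∈ (hle.finite_le l).toFinset := by simpa using hle.refl l
    have hk : ∀ k, a l k • monoC (Φ := Φ) hP k =
        b l k • monoC hP k + if k = l then (r l : ℂ) • monoC hP l else 0 := fun k => by
      by_cases h : k = l
      · subst h
        have e : a k k = b k k + r k := by simp [a]
        rw [if_pos rfl, e]
        exact add_smul (b k k) (r k : ℂ) (monoC hP k)
      · have e : a l k = b l k := by simp [a, h]
        rw [if_neg h, e, add_zero]
    rw [Finset.sum_congr rfl fun k _ => hk k, Finset.sum_add_distrib,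
      Finset.sum_ite_eq_of_mem' _ _ _ hl]
    simp only [q]
    rw [← hbg l,
      Finsupp.linearCombination_apply_of_mem_supported ℂ (s := (hle.finite_le l).toFinset)]
    rw [Finsupp.mem_supported]
    intro k hk
    rw [Set.Finite.coe_toFinset]
    have h : k < l := (Finsupp.mem_supported _ _).1 (hb l) hk
    exact h.le
  refine ⟨fun l => q l, ⟨a, fun l => ⟨r l, hr0 l, ?_⟩, fun l xi => ?_⟩, fun l k h1 h2 => ?_,
    fun l => ?_⟩
  · simp [a, hbs l l (lt_irrefl l)]
  · rw [finsum_le_eq hle hP, ← hqa]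
  · rw [← inner_dressLp hΦ hϱ hc, hqx, hqx]
    exact hx.inner_eq_zero l k (lt_of_le_of_ne h1 h2)
  · rw [← inner_dressLp hΦ hϱ hc, hqx, inner_self_eq_norm_sq_to_K, hx.norm_eq_one]
    simp

theorem existsUnique_isGramSchmidt [P.IsCrystallographic] (hP : IsEuclidean P)
    (hΦ : IsPositiveSystem P Φ) (hϱ : 1 < ϱ)
    (hc : ∀ i ∈ posRoots1 P Φ, IsCFunction ϱ (c ‖P.root i‖))
    {le : DomWeight P Φ → DomWeight P Φ → Prop} (hle : IsAdmissibleOrder P Φ le) :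
    ∃! p, IsGramSchmidt P Φ c le p := by
  let := hle.partialOrder
  have := hle.wellFoundedLT
  have ht := isTriangularPair hP hΦ hϱ hc hle
  obtain ⟨x, hx⟩ := ht.exists_isOrthonormalization fun l =>
    (hle.finite_le l).subset fun k (hk : k < l) => hk.le
  refine existsUnique_of_exists_of_unique
    (isGramSchmidt_of_isOrthonormalization hP hΦ hϱ hc hle hx) fun p p' hp hp' => ?_
  obtain ⟨q, hq, hqs, hqo⟩ := hp.exists_isOrthonormalization hP hΦ hϱ hc hle
  obtain ⟨q', hq', hqs', hqo'⟩ := hp'.exists_isOrthonormalization hP hΦ hϱ hc hle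
  ext1 l
  have h1 : dressLp hΦ hϱ hc (q l - q' l) = 0 := by
    rw [map_sub, sub_eq_zero]
    exact congrFun (hqo.unique hqo') l
  -- Uniqueness in L² gives equality of functions on all of E, because the dressing map is injective
  -- on the span of the monomials: the dressed monomials are linearly independent.
  have h2 := (Submodule.disjoint_def.1 (Submodule.range_ker_disjoint ht.linearIndependent)) _
    (sub_mem (hqs l) (hqs' l)) h1
  rw [← hq, ← hq', sub_eq_zero.1 h2]

end Bridge

/-! ### Auxiliary bounds and the truncation degree. -/

section Truncation

variable {ι E : Type*} [NormedAddCommGroup E] [InnerProductSpace ℝ E]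
  {P : RootPairing ι ℝ E E} {Φ : Finset ι}

theorem truncProd_zero {a : ι → ℕ → ℂ} (ha : ∀ i ∈ posRoots1 P Φ, a i 0 = 1) (xi : E) :
    truncProd P Φ a 0 xi = 1 := by
  rw [truncProd, Finset.prod_apply]
  refine Finset.prod_eq_one fun i hi => ?_
  simp [ha i hi]

/-- The approximation of 1/Ĉ at degree 0 is the constant 1, at bounded distance. -/
theorem exists_norm_bigC_inv_le {ϱ : ℝ} (hϱ : 1 < ϱ)
    {c : ℝ → ℂ → ℂ} (hc : ∀ i ∈ posRoots1 P Φ, IsCFunction ϱ (c ‖P.root i‖)) :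
    ∃ B : ℝ, ∀ xi, ‖bigC P Φ c xi‖⁻¹ ≤ B := by
  obtain ⟨a, ha, C, -, hC⟩ := exists_truncProd_bound (P := P) (Φ := Φ) hϱ
    (fun i z => (c ‖P.root i‖ z)⁻¹)
    (fun i hi => (hc i hi).analytic.differentiableOn.inv (hc i hi).ne_zero)
    (fun i hi => by simp [(hc i hi).map_zero])
  refine ⟨1 + C, fun xi => ?_⟩
  have h := hC 0 xi
  rw [truncProd_zero ha, Finset.prod_inv_distrib, pow_zero, mul_one] at h
  have h1 := norm_le_norm_add_norm_sub (1 : ℂ) (bigC P Φ c xi)⁻¹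
  rw [norm_one, norm_inv] at h1
  exact h1.trans (add_le_add le_rfl h)

theorem exists_minPairing_eq (lam : DomWeight P Φ) : ∃ M : ℕ, minPairing P Φ lam.1 = M ∧
    ∀ i ∈ Φ, (M : ℝ) ≤ inner ℝ lam.1 (P.coroot i) := by
  rcases isEmpty_or_nonempty Φ with h | h
  -- Without positive roots the infimum is over the empty set and takes the default value 0.
  · exact ⟨0, by rw [minPairing, Real.iInf_of_isEmpty, Nat.cast_zero],
      fun i hi => (h.false ⟨i, hi⟩).elim⟩
  · obtain ⟨i, hi⟩ := exists_eq_ciInf_of_finite (f := fun i : Φ => inner ℝ lam.1 (P.coroot i))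
    obtain ⟨M, hM⟩ := lam.2 i i.2
    refine ⟨M, by rw [minPairing, ← hi, hM], fun j hj => ?_⟩
    rw [← hM]
    exact hi.le.trans (ciInf_le (Set.finite_range _).bddBelow (⟨j, hj⟩ : Φ))

end Truncation

/-! ### The exponential estimate. -/

section Estimate

variable {ι E : Type*} [NormedAddCommGroup E] [InnerProductSpace ℝ E] [FiniteDimensional ℝ E]
  [MeasurableSpace E] [BorelSpace E] [Finite ι]
  {P : RootPairing ι ℝ E E} [P.IsRootSystem] [P.IsCrystallographic] {Φ : Finset ι}
  {ϱ : ℝ} {c : ℝ → ℂ → ℂ}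

/-- Polynomials with leading term `m_λ` approximate the asymptotic wave functions. -/
theorem exists_norm_dress_sub_le (hP : IsEuclidean P) (hΦ : IsPositiveSystem P Φ) (hϱ : 1 < ϱ)
    (hc : ∀ i ∈ posRoots1 P Φ, IsCFunction ϱ (c ‖P.root i‖))
    {le : DomWeight P Φ → DomWeight P Φ → Prop} (hle : IsAdmissibleOrder P Φ le) :
    ∃ K : ℝ, 0 ≤ K ∧ ∀ lam : DomWeight P Φ, ∀ M : ℕ,
      (∀ i ∈ Φ, (M : ℝ) ≤ inner ℝ lam.1 (P.coroot i)) → ∃ g ∈ monoSpan P Φ lam, ∀ xi,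
        ‖asymptoticWave P Φ c lam xi - dress P Φ c (monomial P lam.1 + g) xi‖ ≤
          K * ϱ⁻¹ ^ M := by
  obtain ⟨a, ha, C, hC0, hC⟩ := exists_truncProd_bound (P := P) (Φ := Φ) hϱ
    (fun i => c ‖P.root i‖) (fun i hi => (hc i hi).analytic.differentiableOn)
    (fun i hi => (hc i hi).map_zero)
  obtain ⟨B, hB⟩ := exists_norm_bigC_inv_le (P := P) (Φ := Φ) hϱ hc
  have hB0 : 0 ≤ B := (inv_nonneg.2 (norm_nonneg _)).trans (hB 0)
  refine ⟨Nat.card (weyl P) * (B * C), by positivity, fun lam M hM => ?_⟩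
  obtain ⟨g, hg, h⟩ := exists_truncated_eq hP hΦ hle lam hM ha
  refine ⟨g, hg, fun xi => ?_⟩
  have e : dress P Φ c (monomial P lam.1 + g) xi =
      ((‖bigC P Φ c xi‖⁻¹ : ℝ) : ℂ) *
        antiSym P (truncProd P Φ a M * planeWave (rho P Φ + lam.1)) xi := by
    rw [h, ← sqrtWeight_eq hϱ hc]
    exact mul_assoc _ _ _
  rw [e, asymptoticWave, antiSym_apply, Finset.mul_sum, ← Finset.sum_sub_distrib]
  have hterm : ∀ w : weyl P, ‖sgn P w * sqrtScatter P Φ c w xi *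
      planeWave (rho P Φ + lam.1) (w.1 xi) - ((‖bigC P Φ c xi‖⁻¹ : ℝ) : ℂ) *
        (sgn P w * (truncProd P Φ a M * planeWave (rho P Φ + lam.1)) (w.1 xi))‖ ≤
      B * (C * ϱ⁻¹ ^ M) := by
    intro w
    -- Since |Ĉ| is Weyl invariant, both terms carry the same factor |Ĉ(ξ)|⁻¹ and the same
    -- unimodular wave; only the Taylor error of Ĉ at ξ_w remains.
    have e2 : sgn P w * sqrtScatter P Φ c w xi *
        planeWave (rho P Φ + lam.1) (w.1 xi) - ((‖bigC P Φ c xi‖⁻¹ : ℝ) : ℂ) *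
          (sgn P w * (truncProd P Φ a M * planeWave (rho P Φ + lam.1)) (w.1 xi)) =
        ((‖bigC P Φ c xi‖⁻¹ : ℝ) : ℂ) * (sgn P w * planeWave (rho P Φ + lam.1) (w.1 xi)) *
          (bigC P Φ c (w.1 xi) - truncProd P Φ a M (w.1 xi)) := by
      rw [sqrtScatter, norm_bigC_weyl hP hΦ hϱ hc w xi, Pi.mul_apply, Complex.ofReal_inv]
      ring
    rw [e2, norm_mul, norm_mul, norm_mul, norm_sgn hP, norm_planeWave, mul_one, mul_one,
      Complex.norm_real, norm_inv, norm_norm, norm_sub_rev]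
    exact mul_le_mul (hB xi) (hC M (w.1 xi)) (norm_nonneg _) hB0
  refine (norm_sum_le_of_le _ fun w _ => hterm w).trans_eq ?_
  rw [Finset.sum_const, Finset.card_univ, ← Nat.card_eq_fintype_card, nsmul_eq_mul]
  ring

theorem exists_alcoveNorm_le (hP : IsEuclidean P) (hΦ : IsPositiveSystem P Φ) (hϱ : 1 < ϱ)
    (hc : ∀ i ∈ posRoots1 P Φ, IsCFunction ϱ (c ‖P.root i‖))
    {le : DomWeight P Φ → DomWeight P Φ → Prop} (hle : IsAdmissibleOrder P Φ le)
    {p : DomWeight P Φ → E → ℂ} (hp : IsGramSchmidt P Φ c le p) :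
    ∃ K : ℝ, ∀ lam : DomWeight P Φ, ∀ M : ℕ,
      (∀ i ∈ Φ, (M : ℝ) ≤ inner ℝ lam.1 (P.coroot i)) →
        alcoveNorm P Φ (waveFunction P Φ c p lam - asymptoticWave P Φ c lam) ≤ K * ϱ⁻¹ ^ M := by
  let := hle.partialOrder
  have := hle.wellFoundedLT
  have h0 : 0 < ϱ := by linarith
  have ht := isTriangularPair hP hΦ hϱ hc hle
  obtain ⟨q, hq, -, hqo⟩ := hp.exists_isOrthonormalization hP hΦ hϱ hc hle
  obtain ⟨K, hK0, hK⟩ := exists_norm_dress_sub_le hP hΦ hϱ hc hle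
  obtain ⟨K', hK0', hK'⟩ := exists_norm_alcoveLp_le hΦ
  refine ⟨2 * (K' * K), fun lam M hM => ?_⟩
  obtain ⟨g, hg, hgB⟩ := hK lam M hM
  -- Lower terms in the dominance order are lower in ⪯ as well, which makes them admissible for
  -- Gram-Schmidt.
  obtain ⟨g', hg', rfl⟩ : ∃ g' ∈ Submodule.span ℂ (monoC (Φ := Φ) hP '' Set.Iio lam),
      ⇑g' = g := by
    clear hgB
    induction hg using Submodule.span_induction with
    | mem f hf =>
      obtain ⟨mu, ⟨hmu, hne⟩, rfl⟩ := hf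
      have hlt : mu < lam := lt_of_le_of_ne (hle.refines _ _ hmu) hne
      exact ⟨monoC hP mu, Submodule.subset_span ⟨mu, hlt, rfl⟩, rfl⟩
    | zero => exact ⟨0, zero_mem _, rfl⟩
    | add f g _ _ hf hg =>
      obtain ⟨f', hf', rfl⟩ := hf
      obtain ⟨g', hg', rfl⟩ := hg
      exact ⟨f' + g', add_mem hf' hg', rfl⟩
    | smul r f _ hf =>
      obtain ⟨f', hf', rfl⟩ := hf
      exact ⟨r • f', Submodule.smul_mem _ r hf', rfl⟩
  have hmem : dressLp hΦ hϱ hc g' ∈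
      Submodule.span ℂ ((dressLp hΦ hϱ hc ∘ monoC hP) '' Set.Iio lam) := by
    rw [Set.image_comp, ← Submodule.map_span]
    exact Submodule.mem_map_of_mem hg'
  have h1 := hqo.norm_sub_le ht lam hmem
  have h2 : alcoveNorm P Φ (waveFunction P Φ c p lam - asymptoticWave P Φ c lam) =
      ‖dressLp hΦ hϱ hc (q lam) - alcoveLp hΦ (asymptoticC hP hϱ hc lam)‖ := by
    have e : waveFunction P Φ c p lam - asymptoticWave P Φ c lam =
        ⇑(dressFactor hϱ hc * q lam - asymptoticC hP hϱ hc lam) := by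
      rw [ContinuousMap.coe_sub, coe_dressFactor_mul, hq]
      rfl
    rw [e, alcoveNorm_eq hΦ, map_sub]
    rfl
  have h3 : ‖alcoveLp hΦ (asymptoticC hP hϱ hc lam) -
      (dressLp hΦ hϱ hc (monoC hP lam) + dressLp hΦ hϱ hc g')‖ ≤ K' * (K * ϱ⁻¹ ^ M) := by
    rw [← map_add]
    have := hK' (asymptoticC hP hϱ hc lam - dressFactor hϱ hc * (monoC hP lam + g'))
      (K * ϱ⁻¹ ^ M) (by positivity) hgB
    rwa [map_sub] at this
  rw [h2]
  refine h1.trans ?_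
  calc 2 * _ ≤ 2 * (K' * (K * ϱ⁻¹ ^ M)) := mul_le_mul_of_nonneg_left h3 zero_le_two
    _ = _ := by ring

end Estimate

end WeylAlcove

end

/-! ### The plane wave asymptotics. -/

theorem theorem4p1 (ϱ : ℝ) (hϱ : 1 < ϱ) :
    -- the decay rate depends on `ϱ` only
    ∃ ε : ℝ, 0 < ε ∧
      ∀ {ι E : Type*} [Finite ι] [NormedAddCommGroup E] [InnerProductSpace ℝ E]
        [FiniteDimensional ℝ E] [MeasurableSpace E] [BorelSpace E]
        (P : RootPairing ι ℝ E E) [P.IsRootSystem] [P.IsCrystallographic] [P.IsIrreducible]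
        (_hP : WeylAlcove.IsEuclidean P)
        (Φ : Finset ι) (_hΦ : WeylAlcove.IsPositiveSystem P Φ)
        (c : ℝ → ℂ → ℂ)
        (_hc : ∀ i ∈ WeylAlcove.posRoots1 P Φ, WeylAlcove.IsCFunction ϱ (c ‖P.root i‖))
        (le : WeylAlcove.DomWeight P Φ → WeylAlcove.DomWeight P Φ → Prop)
        (_hle : WeylAlcove.IsAdmissibleOrder P Φ le),
        -- `Ŝ_w^{1/2}` is the continuous square root of `Ŝ_w` with value `1` at the origin
        (∀ w : WeylAlcove.weyl P,
          Continuous (WeylAlcove.sqrtScatter P Φ c w) ∧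
          WeylAlcove.sqrtScatter P Φ c w 0 = 1 ∧
          ∀ xi : E, WeylAlcove.sqrtScatter P Φ c w xi ^ 2 = WeylAlcove.scatter P Φ c w xi) ∧
        -- `Ψ_λ^∞ = Δ̂^{1/2} δ P_λ^∞` on the alcove
        (∀ lam : WeylAlcove.DomWeight P Φ, ∀ xi ∈ WeylAlcove.alcove P Φ,
          WeylAlcove.asymptoticWave P Φ c lam xi =
            WeylAlcove.sqrtWeight P Φ c xi * WeylAlcove.weylDenom P Φ xi *
              WeylAlcove.asymptoticPoly P Φ c lam xi) ∧
        -- the polynomials `P_λ` exist and are unique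
        (∃! p : WeylAlcove.DomWeight P Φ → E → ℂ, WeylAlcove.IsGramSchmidt P Φ c le p) ∧
        -- the wave functions tend to the plane waves exponentially fast
        ∀ p : WeylAlcove.DomWeight P Φ → E → ℂ, WeylAlcove.IsGramSchmidt P Φ c le p →
          (∀ lam, MemLp (WeylAlcove.waveFunction P Φ c p lam) 2
            (volume.restrict (WeylAlcove.alcove P Φ))) ∧
          (∀ lam, MemLp (WeylAlcove.asymptoticWave P Φ c lam) 2
            (volume.restrict (WeylAlcove.alcove P Φ))) ∧
          (fun lam : WeylAlcove.DomWeight P Φ =>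
            WeylAlcove.alcoveNorm P Φ
              (WeylAlcove.waveFunction P Φ c p lam - WeylAlcove.asymptoticWave P Φ c lam))
            =O[comap (fun lam : WeylAlcove.DomWeight P Φ => WeylAlcove.minPairing P Φ lam.1) atTop]
          (fun lam => Real.exp (-ε * WeylAlcove.minPairing P Φ lam.1)) := by
  -- The rate log ϱ is that of the Taylor coefficients on the circle of radius ϱ.
  refine ⟨Real.log ϱ, Real.log_pos hϱ, ?_⟩
  intro ι E _ _ _ _ _ _ P _ _ _ hP Φ hΦ c hc le hle
  refine ⟨fun w => ⟨WeylAlcove.continuous_sqrtScatter hP hϱ hc w,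
    WeylAlcove.sqrtScatter_zero hϱ hc w, WeylAlcove.sqrtScatter_sq hϱ hc w⟩,
    fun lam xi h => WeylAlcove.asymptoticWave_eq hP hΦ hϱ hc lam h,
    WeylAlcove.existsUnique_isGramSchmidt hP hΦ hϱ hc hle, fun p hp => ⟨fun lam => ?_, fun lam =>
      WeylAlcove.memLp_alcove hΦ (WeylAlcove.asymptoticC hP hϱ hc lam), ?_⟩⟩
  · obtain ⟨q, hq, -⟩ := hp.exists_isOrthonormalization hP hΦ hϱ hc hle
    have h := WeylAlcove.memLp_alcove hΦ (WeylAlcove.dressFactor hϱ hc * q lam)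
    rwa [WeylAlcove.coe_dressFactor_mul, hq] at h
  · obtain ⟨K, hK⟩ := WeylAlcove.exists_alcoveNorm_le hP hΦ hϱ hc hle hp
    -- The bound holds for every λ, with M = m(λ), not only in the limit.
    refine IsBigO.of_bound K (Eventually.of_forall fun lam => ?_)
    obtain ⟨M, hM, hM'⟩ := WeylAlcove.exists_minPairing_eq lam
    have h : Real.exp (-Real.log ϱ * M) = ϱ⁻¹ ^ M := by
      rw [mul_comm, Real.exp_nat_mul, Real.exp_neg, Real.exp_log (by linarith)]
    rw [hM, h, Real.norm_of_nonneg (r := WeylAlcove.alcoveNorm _ _ _) (Real.sqrt_nonneg _), Real.norm_of_nonneg (by positivity)]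
    exact hK lam M hM'
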